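/- **Setting.** Let $\mathcal H_0,\mathcal H_1$ be complex Hilbert spaces, $A_0,A_1$ (possibly unbounded) selfadjoint operators in $\mathcal H_0,\mathcal H_1$, $B_{10}:\mathcal H_0\to\mathcal H_1$ bounded and $B_{01}=B_{10}^*$. Let $J^0=(\mu_0^{(1)},\mu_0^{(2)})$, $-\infty\le\mu_0^{(1)}<\mu_0^{(2)}\le\infty$; assume that the spectrum of $A_0$ is absolutely continuous and equals $\overline{J^0}$, and that $\sigma(A_1)\subset J^0$. Let $E_0$ be the spectral measure of $A_0$ and $K_B(\mu)=B_{10}E_0((-\infty,\mu))B_{01}$. Assume that $K_B$ is differentiable on $J^0$ in operator norm, that $K_B'$ is continuous on $\overline{J^0}$ and has an analytic continuation from $J^0$ to a simply connected domain $D^-\subset\mathbb C^-$ whose boundary contains $J^0$; continue it to the mirror image $D^+$ of $D^-$ by $K_B'(\bar\mu)=[K_B'(\mu)]^*$. For $l=\pm1$ let $\Gamma^l$ be a $K_B$-bounded contour in $D^l$: a (locally) rectifiable Jordan curve obtained by a continuous deformation of $J^0$ with fixed end points (the finite end points, or infinity), with $\mathcal V_0(B,\Gamma^l)=\int_{\Gamma^l}|d\mu|\,\|K'_B(\mu)\|<\infty$.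 Put $d_0(\Gamma)=\operatorname{dist}\{\sigma(A_1),\Gamma\}$ and assume $\mathcal V_0(B,\Gamma^l)<\frac14d_0^2(\Gamma^l)$ for $l=\pm1$. The two contours need not be mirror images of each other, but $\Gamma^{+1}$ and the mirror image $\overline{\Gamma^{-1}}$ of $\Gamma^{-1}$ are assumed to agree at the ends of $J^0$ in the following sense (trivially satisfied if they coincide): for every $\varepsilon>0$, arbitrarily near to each end there are points of $\Gamma^{+1}$ and of $\overline{\Gamma^{-1}}$ that can be joined in $D^{+}$ by a rectifiable arc $c$ whose distance from $\sigma(A_1)$ is at least $\min\{d_0(\Gamma^{+1}),d_0(\Gamma^{-1})\}$ and for which $\int_c|d\mu|\,\|K'_B(\mu)\|<\varepsilon$. Let $X^{(l)}$ be the bounded operator in $\mathcal H_1$ with $X^{(l)}=\int_{\Gamma^l}d\mu\,K_B'(\mu)(A_1+X^{(l)}-\mu)^{-1}$ and $\|X^{(l)}\|\le r_{\min}(\Gamma^l)=\frac{d_0(\Gamma^l)}2-\sqrt{\frac{d_0^2(\Gamma^l)}4-\mathcal V_0(B,\Gamma^l)}$. Put $$H_1^{(l)}=A_1+X^{(l)},\qquad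 M_1(z,\Gamma^l)=A_1-z+\int_{\Gamma^l}d\mu\,K'_B(\mu)(z-\mu)^{-1},$$ $$\Omega^{(l)}=\int_{\Gamma^l}d\mu\,(H_1^{(-l)*}-\mu)^{-1}K_B'(\mu)(H_1^{(l)}-\mu)^{-1},\qquad \mathcal O=\{z\in\mathbb C:\operatorname{dist}\{z,\sigma(A_1)\}\le d_0(\Gamma^l)/2\}.$$ **Theorem.** For $l=\pm1$: 1. The integral $\Omega^{(l)}$ converges in norm, $\|\Omega^{(l)}\|<1$ and $\Omega^{(-l)}=\Omega^{(l)*}$. 2. $(I+\Omega^{(l)})^{-1}H_1^{(-l)*}=H_1^{(l)}(I+\Omega^{(l)})^{-1}$, including equality of the domains. 3. For $z\in\mathcal O\setminus\sigma(H_1^{(l)})$ the operator $M_1(z,\Gamma^l)$ has a bounded inverse, and $[M_1(z,\Gamma^l)]^{-1}u$ is integrable along every rectifiable closed curve in this set, for every $u\in\mathcal H_1$. If $A_1$ is bounded and $\gamma$ is an arbitrary closed contour consisting of finitely many rectifiable closed curves in $\mathcal O\setminus\sigma(H_1^{(l)})$ and going around $\sigma(H_1^{(l)})$ in the positive direction (total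 winding number $1$ about every point of $\sigma(H_1^{(l)})$), then, in the strong sense (that is, applied to vectors), $$-\frac1{2\pi i}\int_\gamma dz\,[M_1(z,\Gamma^l)]^{-1}=(I+\Omega^{(l)})^{-1},$$ $$-\frac1{2\pi i}\int_\gamma dz\,z\,[M_1(z,\Gamma^l)]^{-1}=(I+\Omega^{(l)})^{-1}H_1^{(-l)*}=H_1^{(l)}(I+\Omega^{(l)})^{-1}.$$ 4. In general ($A_1$ possibly unbounded), let $a_k\to-\infty$, $b_k\to+\infty$ be such that the lines $\operatorname{Re}z=a_k$ and $\operatorname{Re}z=b_k$ do not meet $\mathcal O$, and let $\gamma_k$ be a closed contour as in 3, lying in $\{z\in\mathcal O\setminus\sigma(H_1^{(l)}):a_k<\operatorname{Re}z<b_k\}$ and going around $\{z\in\sigma(H_1^{(l)}):a_k<\operatorname{Re}z<b_k\}$ in the positive direction. Then the two formulas of 3 hold with $\int_\gamma$ replaced by the strong limit of $\int_{\gamma_k}$ as $k\to\infty$, the first one on all $u\in\mathcal H_1$ and the second one on all $u$ in the domain of $H_1^{(-l)*}$. -/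

import Mathlib

open Set Filter Topology MeasureTheory
open scoped ComplexConjugate InnerProductSpace

noncomputable section

namespace TwoChannel

/-! ### Unbounded operators -/

section Operators

variable {H : Type*} [NormedAddCommGroup H] [InnerProductSpace ℂ H]

/-- The operator `A + X` on `dom A`, for a bounded everywhere defined `X`. -/
def perturb (A : H →ₗ.[ℂ] H) (X : H →L[ℂ] H) : H →ₗ.[ℂ] H :=
  (X : H →ₗ[ℂ] H) +ᵥ A

/-- The operator `A - z` on `dom A`. -/
def shift (A : H →ₗ.[ℂ] H) (z : ℂ) : H →ₗ.[ℂ] H :=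
  perturb A (-(z • (1 : H →L[ℂ] H)))

/-- `R` is an everywhere defined bounded two-sided inverse of `T`. -/
def IsBoundedInverse (T : H →ₗ.[ℂ] H) (R : H →L[ℂ] H) : Prop :=
  (∀ x : H, ∃ h : R x ∈ T.domain, T ⟨R x, h⟩ = x) ∧ ∀ x : T.domain, R (T x) = x

/-- `T` is boundedly invertible. -/
def IsBoundedlyInvertible (T : H →ₗ.[ℂ] H) : Prop := ∃ R : H →L[ℂ] H, IsBoundedInverse T R

open Classical in
/-- The bounded inverse `T⁻¹` (and `0` if `T` is not boundedly invertible). -/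
def boundedInverse (T : H →ₗ.[ℂ] H) : H →L[ℂ] H :=
  if h : IsBoundedlyInvertible T then h.choose else 0

/-- The resolvent `(A - z)⁻¹`. -/
def res (A : H →ₗ.[ℂ] H) (z : ℂ) : H →L[ℂ] H := boundedInverse (shift A z)

/-- The spectrum `σ(A)`. -/
def spec (A : H →ₗ.[ℂ] H) : Set ℂ := {z | ¬ IsBoundedlyInvertible (shift A z)}

end Operators

/-! ### Spectral measures -/

section SpectralMeasures

variable (H : Type*) [NormedAddCommGroup H] [InnerProductSpace ℂ H] [CompleteSpace H]

/-- A projection-valued measure on the Borel sets of the real line. -/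
structure ProjectionValuedMeasure where
  toFun : Set ℝ → H →L[ℂ] H
  isStarProjection : ∀ S, MeasurableSet S → IsStarProjection (toFun S)
  univ : toFun Set.univ = 1
  hasSum : ∀ S : ℕ → Set ℝ, (∀ n, MeasurableSet (S n)) → Pairwise (Function.onFun Disjoint S) →
    ∀ u : H, HasSum (fun n => toFun (S n) u) (toFun (⋃ n, S n) u)

variable {H}

namespace ProjectionValuedMeasure

theorem empty (E : ProjectionValuedMeasure H) (u : H) : E.toFun ∅ u = 0 := by
  have h := E.hasSum (fun _ => ∅) (fun _ => MeasurableSet.empty)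
    (fun _ _ _ => by simp [Function.onFun]) u
  simp only [Set.iUnion_empty] at h
  have h2 := h.summable.tendsto_atTop_zero
  exact tendsto_nhds_unique tendsto_const_nhds h2

theorem nonneg (E : ProjectionValuedMeasure H) {S : Set ℝ} (hS : MeasurableSet S) (u : H) :
    0 ≤ (⟪u, E.toFun S u⟫_ℂ).re := by
  have hp := E.isStarProjection S hS
  have h1 : E.toFun S u = E.toFun S (E.toFun S u) := by
    have := congrArg (fun T : H →L[ℂ] H => T u) hp.isIdempotentElem
    simpa using this.symm
  have h2 : ⟪u, E.toFun S (E.toFun S u)⟫_ℂ = ⟪E.toFun S u, E.toFun S u⟫_ℂ := by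
    have hs := hp.isSelfAdjoint
    rw [← ContinuousLinearMap.adjoint_inner_left, ← ContinuousLinearMap.star_eq_adjoint,
      hs.star_eq]
  rw [h1, h2]
  exact inner_self_nonneg (𝕜 := ℂ)

/-- The scalar measure `S ↦ ⟨u, E(S) u⟩`. -/
def scalarMeasure (E : ProjectionValuedMeasure H) (u : H) : Measure ℝ :=
  Measure.ofMeasurable (fun S _ => ENNReal.ofReal (⟪u, E.toFun S u⟫_ℂ).re)
    (by simp [E.empty])
    (by
      intro S hS hd
      have h1 : HasSum (fun n => (⟪u, E.toFun (S n) u⟫_ℂ).re)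
          (⟪u, E.toFun (⋃ n, S n) u⟫_ℂ).re :=
        ((E.hasSum S hS hd u).mapL (innerSL ℂ u)).mapL Complex.reCLM
      rw [← h1.tsum_eq]
      exact ENNReal.ofReal_tsum_of_nonneg (fun n => E.nonneg (hS n) u) h1.summable)

/-- `A = ∫ λ dE(λ)`: the domain of `A` is `{u | ∫ λ² d⟨u, E(λ) u⟩ < ∞}`, and
`⟨u, A u⟩ = ∫ λ d⟨u, E(λ) u⟩` there. By polarization this determines `A`. -/
def Represents (E : ProjectionValuedMeasure H) (A : H →ₗ.[ℂ] H) : Prop :=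
  (∀ u : H, u ∈ A.domain ↔ ∫⁻ t, ENNReal.ofReal (t ^ 2) ∂(E.scalarMeasure u) < ⊤) ∧
  ∀ u : A.domain, ⟪(u : H), A u⟫_ℂ = ((∫ t, t ∂(E.scalarMeasure (u : H)) : ℝ) : ℂ)

end ProjectionValuedMeasure

end SpectralMeasures

/-! ### The two-channel Hamiltonian -/

section Channel

variable (H₀ H₁ : Type*) [NormedAddCommGroup H₀] [InnerProductSpace ℂ H₀] [CompleteSpace H₀]
  [NormedAddCommGroup H₁] [InnerProductSpace ℂ H₁] [CompleteSpace H₁]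

/-- The entries of the matrix Hamiltonian, with the standing assumptions. -/
structure Model where
  /-- the end points of `J⁰ = (a, b)` -/
  a : EReal
  b : EReal
  a_lt_b : a < b
  A₀ : H₀ →ₗ.[ℂ] H₀
  A₁ : H₁ →ₗ.[ℂ] H₁
  isSelfAdjoint₀ : IsSelfAdjoint A₀
  isSelfAdjoint₁ : IsSelfAdjoint A₁
  B₁₀ : H₀ →L[ℂ] H₁
  /-- the spectral measure of `A₀` -/
  E₀ : ProjectionValuedMeasure H₀
  represents : E₀.Represents A₀
  /-- the spectrum of `A₀` is absolutely continuous and fills the interval -/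
  absolutelyContinuous : ∀ u : H₀, E₀.scalarMeasure u ≪ volume
  spec₀ : spec A₀ = (fun x : ℝ => (x : ℂ)) '' closure {x : ℝ | a < x ∧ (x : EReal) < b}
  spec₁ : spec A₁ ⊆ (fun x : ℝ => (x : ℂ)) '' {x : ℝ | a < x ∧ (x : EReal) < b}
  /-- the domain `D⁻` -/
  Dm : Set ℂ
  isOpen_Dm : IsOpen Dm
  isSimplyConnected_Dm : IsSimplyConnected Dm
  Dm_subset : Dm ⊆ {z | z.im < 0}
  subset_frontier : (fun x : ℝ => (x : ℂ)) '' {x : ℝ | a < x ∧ (x : EReal) < b} ⊆ frontier Dm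
  /-- the derivative `K'_B` on the closed interval and its continuation to `D⁻` -/
  Kc : ℂ → H₁ →L[ℂ] H₁
  hasDerivAt : ∀ x : ℝ, a < x → (x : EReal) < b →
    HasDerivAt (fun y : ℝ => B₁₀ ∘L E₀.toFun (Iio y) ∘L ContinuousLinearMap.adjoint B₁₀) (Kc x) x
  continuousOn_closure :
    ContinuousOn Kc ((fun x : ℝ => (x : ℂ)) '' closure {x : ℝ | a < x ∧ (x : EReal) < b})
  continuousOn_Dm :
    ContinuousOn Kc (Dm ∪ (fun x : ℝ => (x : ℂ)) '' {x : ℝ | a < x ∧ (x : EReal) < b})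
  differentiableOn_Dm : DifferentiableOn ℂ Kc Dm

variable {H₀ H₁}

namespace Model

variable (M : Model H₀ H₁)

/-- The open interval `J⁰`. -/
def J : Set ℝ := {x : ℝ | M.a < x ∧ (x : EReal) < M.b}

/-- `D^l` for `l = ±1`: the domain `D⁻` and its mirror image `D⁺`. -/
def D (l : ℤˣ) : Set ℂ := if l = -1 then M.Dm else {z | conj z ∈ M.Dm}

/-- `K'_B` on `D⁻ ∪ J⁰ ∪ D⁺`, continued to `D⁺` by `K'_B(μ) = K'_B(μ̄)*`. -/
def K' (μ : ℂ) : H₁ →L[ℂ] H₁ :=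
  if 0 < μ.im then ContinuousLinearMap.adjoint (M.Kc (conj μ)) else M.Kc μ

/-- The neighbourhood filter in `ℂ` of an end point of `J⁰`. -/
def endNhds (e : EReal) : Filter ℂ :=
  if e = ⊥ ∨ e = ⊤ then cocompact ℂ else 𝓝 ((e.toReal : ℝ) : ℂ)

/-- The filter of points of `J⁰` tending to its left end. -/
def leftEnd : Filter ℝ := comap (fun x : ℝ => (x : EReal)) (𝓝[>] M.a)

/-- The filter of points of `J⁰` tending to its right end. -/
def rightEnd : Filter ℝ := comap (fun x : ℝ => (x : EReal)) (𝓝[<] M.b)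

/-- `∫_Γ f(μ) dμ` for a curve `Γ` parametrized by `J⁰`. -/
def integral {F : Type*} [NormedAddCommGroup F] [NormedSpace ℂ F] (Γ : ℝ → ℂ) (f : ℂ → F) : F :=
  ∫ x in M.J, deriv Γ x • f (Γ x)

/-- `𝒱₀(B, Γ) = ∫_Γ |dμ| ‖K'_B(μ)‖`. -/
def variation (Γ : ℝ → ℂ) : ℝ := ∫ x in M.J, ‖deriv Γ x‖ * ‖M.K' (Γ x)‖

/-- `Γ` is a `K_B`-bounded contour in `D^l`: a Jordan curve, locally rectifiable and of finite
length over bounded parts of `J⁰`, obtained from `J⁰` by a continuous deformation `Φ`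
with fixed end points, and with finite `𝒱₀(B, Γ)`. -/
structure IsContour (l : ℤˣ) (Γ : ℝ → ℂ) : Prop where
  locallyLipschitzOn : LocallyLipschitzOn M.J Γ
  integrableOn_deriv : ∀ r : ℝ, IntegrableOn (deriv Γ) (M.J ∩ Icc (-r) r)
  injOn : InjOn Γ M.J
  mapsTo : MapsTo Γ M.J (M.D l)
  deformation : ∃ Φ : ℝ × ℝ → ℂ, ContinuousOn Φ (Icc 0 1 ×ˢ M.J) ∧
    (∀ x ∈ M.J, Φ (0, x) = x) ∧ (∀ x ∈ M.J, Φ (1, x) = Γ x) ∧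
    (∀ s ∈ Ioc (0 : ℝ) 1, ∀ x ∈ M.J, Φ (s, x) ∈ M.D l) ∧
    Tendsto Φ (𝓟 (Icc 0 1) ×ˢ (M.leftEnd ⊓ 𝓟 M.J)) (endNhds M.a) ∧
    Tendsto Φ (𝓟 (Icc 0 1) ×ˢ (M.rightEnd ⊓ 𝓟 M.J)) (endNhds M.b)
  finite_variation : IntegrableOn (fun x => ‖deriv Γ x‖ * ‖M.K' (Γ x)‖) M.J

/-- `d₀(Γ) = dist{σ(A₁), Γ}`. -/
def d₀ (Γ : ℝ → ℂ) : ℝ := sInf (image2 dist (spec M.A₁) (Γ '' M.J))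

/-- The smallness condition `𝒱₀(B, Γ) < d₀(Γ)² / 4`. -/
def IsSmall (Γ : ℝ → ℂ) : Prop := M.variation Γ < M.d₀ Γ ^ 2 / 4

/-- `r_min(Γ)`. -/
def rmin (Γ : ℝ → ℂ) : ℝ := M.d₀ Γ / 2 - √(M.d₀ Γ ^ 2 / 4 - M.variation Γ)

/-- `V₁(Y, Γ) = ∫_Γ dμ K'_B(μ) (Y - μ)⁻¹` for an operator `Y` in `H₁`. -/
def V₁op (Y : H₁ →ₗ.[ℂ] H₁) (Γ : ℝ → ℂ) : H₁ →L[ℂ] H₁ :=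
  M.integral Γ fun μ => M.K' μ ∘L res Y μ

/-- `V₁(z, Γ) = ∫_Γ dμ K'_B(μ) (z - μ)⁻¹` for a number `z`. -/
def V₁ (z : ℂ) (Γ : ℝ → ℂ) : H₁ →L[ℂ] H₁ :=
  M.integral Γ fun μ => (z - μ)⁻¹ • M.K' μ

/-- The continued transfer function `M₁(z, Γ) = A₁ - z + V₁(z, Γ)`, on `dom A₁`. -/
def M₁ (z : ℂ) (Γ : ℝ → ℂ) : H₁ →ₗ.[ℂ] H₁ := perturb (shift M.A₁ z) (M.V₁ z Γ)

/-- `X` is the solution of `X = V₁(A₁ + X, Γ)` in the ball `‖X‖ ≤ r_min(Γ)`. -/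
def IsSolution (Γ : ℝ → ℂ) (X : H₁ →L[ℂ] H₁) : Prop :=
  ‖X‖ ≤ M.rmin Γ ∧ X = M.V₁op (perturb M.A₁ X) Γ

/-- The integrand of `Ω^{(l)}`; here `Γ = Γ^l`, `X = X^{(l)}` and `X' = X^{(-l)}`. -/
def omegaIntegrand (X' X : H₁ →L[ℂ] H₁) (μ : ℂ) : H₁ →L[ℂ] H₁ :=
  res (perturb M.A₁ X').adjoint μ ∘L M.K' μ ∘L res (perturb M.A₁ X) μ

/-- `Ω^{(l)} = ∫_{Γ^l} dμ (H₁^{(-l)*} - μ)⁻¹ K'_B(μ) (H₁^{(l)} - μ)⁻¹`. -/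
def omega (X' X : H₁ →L[ℂ] H₁) (Γ : ℝ → ℂ) : H₁ →L[ℂ] H₁ :=
  M.integral Γ (M.omegaIntegrand X' X)

/-- The set `𝒪_r(A₁)` with `r = d₀(Γ) / 2`. -/
def nbhd (Γ : ℝ → ℂ) : Set ℂ := {z | Metric.infDist z (spec M.A₁) ≤ M.d₀ Γ / 2}

/-- There is a rectifiable arc `c` in `D^l` from `p` to `q` at distance at least `δ` from `σ(A₁)`
with `∫_c |dμ| ‖K'_B(μ)‖ < ε`. -/
def JoinedBySmallArc (l : ℤˣ) (δ ε : ℝ) (p q : ℂ) : Prop :=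
  ∃ c : ℝ → ℂ, (∃ C, LipschitzOnWith C c (Icc 0 1)) ∧ c 0 = p ∧ c 1 = q ∧
    (∀ t ∈ Icc (0 : ℝ) 1, c t ∈ M.D l ∧ ∀ w ∈ spec M.A₁, δ ≤ dist (c t) w) ∧
    ∫ t in (0 : ℝ)..1, ‖deriv c t‖ * ‖M.K' (c t)‖ < ε

/-- Two contours `Γ`, `Γ'` in `D^l` are `K_B`-close at the ends of `J⁰`: arbitrarily near to each
end there are points of `Γ` and `Γ'` joined in `D^l`, away from `σ(A₁)`, by rectifiable arcs
along which the variation of `K_B` is arbitrarily small. -/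
def SameEnds (l : ℤˣ) (Γ Γ' : ℝ → ℂ) : Prop :=
  ∀ ε > 0, ∀ x ∈ M.J,
    (∃ y ∈ M.J, ∃ y' ∈ M.J, y < x ∧ y' < x ∧
      M.JoinedBySmallArc l (min (M.d₀ Γ) (M.d₀ Γ')) ε (Γ y) (Γ' y')) ∧
    (∃ y ∈ M.J, ∃ y' ∈ M.J, x < y ∧ x < y' ∧
      M.JoinedBySmallArc l (min (M.d₀ Γ) (M.d₀ Γ')) ε (Γ y) (Γ' y'))

end Model

end Channel

/-! ### Closed contours -/

section Contours

/-- A rectifiable closed curve, with a Lipschitz parametrization over `[0, 1]`. -/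
def IsClosedCurve (γ : ℝ → ℂ) : Prop :=
  (∃ C, LipschitzOnWith C γ (Icc 0 1)) ∧ γ 0 = γ 1

/-- `∫_γ f(z) dz`. -/
def contourIntegral {F : Type*} [NormedAddCommGroup F] [NormedSpace ℂ F]
    (γ : ℝ → ℂ) (f : ℂ → F) : F :=
  ∫ t in (0 : ℝ)..1, deriv γ t • f (γ t)

/-- The winding number of `γ` about `w`. -/
def winding (γ : ℝ → ℂ) (w : ℂ) : ℂ :=
  (2 * Real.pi * Complex.I)⁻¹ * contourIntegral γ fun z => (z - w)⁻¹

/-- The closed contour consisting of the rectifiable closed curves `γ 0, …, γ (n - 1)` lies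
in `O \ S` and goes around `S` once in the positive direction. -/
structure IsContourAround (O S : Set ℂ) {n : ℕ} (γ : Fin n → ℝ → ℂ) : Prop where
  isClosedCurve : ∀ i, IsClosedCurve (γ i)
  mem : ∀ i, ∀ t ∈ Icc (0 : ℝ) 1, γ i t ∈ O \ S
  winding : ∀ w ∈ S, ∑ i, winding (γ i) w = 1

/-- `-(2πi)⁻¹ ∫_γ f(z) dz` for a closed contour made of finitely many closed curves. -/
def cauchyIntegral {F : Type*} [NormedAddCommGroup F] [NormedSpace ℂ F] {n : ℕ}
    (γ : Fin n → ℝ → ℂ) (f : ℂ → F) : F :=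
  (-(2 * Real.pi * Complex.I)⁻¹ : ℂ) • ∑ i, contourIntegral (γ i) f

/-- The open vertical strip `a < Re z < b`. -/
def strip (a b : ℝ) : Set ℂ := {z | a < z.re ∧ z.re < b}

end Contours

end TwoChannel

end

open Set Filter Topology MeasureTheory
open scoped ComplexConjugate InnerProductSpace

noncomputable section

/-! Write `R(z)` for the resolvent of `H₁^{(l)} = A₁ + X` and `R'(z)` for that of `H₁^{(-l)*} = A₁ +
Y`, where `Y` is the adjoint of `X^{(-l)}`. The adjoint of the equation for `X^{(-l)}` reads `Y = ∫
R'(μ) K'_B(μ) dμ` along the mirror image of `Γ^{-l}`, and Cauchy's theorem moves this integral to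
`Γ^l` (`isSolutionPair`). From then on both equations live on one curve.

The rest is algebra with the resolvent identities. Multiplying the equation for `X` by `R(z)` gives
the factorization `M₁(z) = W(z) (H₁^{(l)} - z)` with `W(z) = 1 + ∫ (z - μ)⁻¹ K'_B(μ) R(μ) dμ`. With
`N(z) = ∫ (z - μ)⁻¹ R'(μ) K'_B(μ) R(μ) dμ` one finds `(1 + Ω) R(z) = R'(z) W(z) - N(z) = R'(z) (1 +
Ω)` (`one_add_overlap_mul_res`). The outer terms give the similarity of the two operators. The first
equality gives `M₁(z)⁻¹ = (1 + Ω)⁻¹ (R'(z) - N(z) W(z)⁻¹)`. The smallness condition yields `‖Ω‖ <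
1`, and `‖W(z) - 1‖ < 1` on an open neighbourhood of `𝒪`; there `N W⁻¹` is holomorphic, so contour
integrals see only `R'`.

What remains is the Riesz integral of `R'`. The contour is homologous to the circle on the diameter
`[a_k, b_k]`, and the circle integrals tend strongly to the identity (`tendsto_circleProj`): they
are uniformly bounded by comparison with the orthogonal spectral projections of `A₁`, and they
converge on the dense range of a squared resolvent. If `A₁` is bounded, a constant sequence of
contours does the job.

The exchange of contours needs care, since `R'` may be singular inside `D^l`. Away from `σ(A₁)` it
is a uniform limit of Neumann sums in the resolvent of `A₁`, which are holomorphic off the real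
axis, and Cauchy's theorem is applied to those sums (`isHolomorphicLimit_res`,
`integral_mul_mul_eq_of_sameEnds`). Uniqueness of the fixed point supplies the norm bound for
`X^{(-l)}` relative to the other contour. -/

namespace TwoChannel

/-! ### Integration along Lipschitz curves and holomorphic parameter integrals -/

section CurveIntegrals

variable {E : Type*} [NormedAddCommGroup E] [NormedSpace ℂ E]

theorem norm_deriv_le_ae_of_lipschitzOnWith {γ : ℝ → ℂ} {a b : ℝ} {C : NNReal}
    (hγ : LipschitzOnWith C γ (uIcc a b)) :
    ∀ᵐ t ∂(volume.restrict (uIoc a b)), ‖deriv γ t‖ ≤ C := by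
  rw [ae_restrict_iff' measurableSet_uIoc]
  -- The interval `uIoc a b` contains its right end point, where the Lipschitz bound is only
  -- one-sided; this null set is discarded.
  have h₁ : ∀ᵐ x : ℝ, x ≠ max a b := by simp [ae_iff, measure_singleton]
  filter_upwards [h₁] with t ht ht'
  refine norm_deriv_le_of_lipschitzOn (s := uIcc a b) ?_ hγ
  exact Icc_mem_nhds ht'.1 (lt_of_le_of_ne ht'.2 ht)

theorem intervalIntegrable_deriv_smul {γ : ℝ → ℂ} {a b : ℝ} {C : NNReal}
    (hγ : LipschitzOnWith C γ (uIcc a b)) {F : ℝ → E} (hF : ContinuousOn F (uIcc a b)) :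
    IntervalIntegrable (fun t => deriv γ t • F t) volume a b := by
  obtain ⟨B, hB⟩ := isCompact_uIcc.exists_bound_of_continuousOn hF
  rw [intervalIntegrable_iff]
  refine Integrable.mono' (g := fun _ => C * B) (integrableOn_const (by simp)) ?_ ?_
  · exact (measurable_deriv γ).aestronglyMeasurable.smul
      ((hF.mono uIoc_subset_uIcc).aestronglyMeasurable measurableSet_uIoc)
  · filter_upwards [norm_deriv_le_ae_of_lipschitzOnWith hγ, ae_restrict_mem measurableSet_uIoc]
      with t ht ht'
    rw [norm_smul]
    exact mul_le_mul ht (hB t (uIoc_subset_uIcc ht')) (norm_nonneg _) C.2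

/-- The fundamental theorem of calculus along a rectifiable curve. -/
theorem integral_deriv_smul_eq_sub [CompleteSpace E] {γ : ℝ → ℂ} {a b : ℝ} {C : NNReal}
    (hγ : LipschitzOnWith C γ (uIcc a b)) {U : Set ℂ} (hU : IsOpen U)
    (hmem : ∀ t ∈ uIcc a b, γ t ∈ U) {g f : ℂ → E} (hf : ContinuousOn f U)
    (hg : ∀ z ∈ U, HasDerivAt g (f z) z) :
    ∫ t in a..b, deriv γ t • f (γ t) = g (γ b) - g (γ a) := by
  have hFc : ContinuousOn (fun t => f (γ t)) (uIcc a b) := hf.comp hγ.continuousOn hmem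
  have hint := intervalIntegrable_deriv_smul hγ hFc
  -- A function with continuous derivative is strictly differentiable, hence locally Lipschitz; so
  -- `g ∘ γ` is Lipschitz on the compact interval and thus absolutely continuous.
  have hloc : LocallyLipschitzOn (uIcc a b) (fun t => g (γ t)) := by
    intro t ht
    have hs : HasStrictDerivAt g (f (γ t)) (γ t) :=
      hasStrictDerivAt_of_hasDerivAt_of_continuousAt
        (by filter_upwards [hU.mem_nhds (hmem t ht)] with z hz using hg z hz)
        (hf.continuousAt (hU.mem_nhds (hmem t ht)))
    obtain ⟨K, s, hs, hK⟩ := hs.hasStrictFDerivAt.exists_lipschitzOnWith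
    refine ⟨K * C, γ ⁻¹' s ∩ uIcc a b, ?_, ?_⟩
    · exact inter_mem (hγ.continuousOn t ht hs) self_mem_nhdsWithin
    · exact hK.comp (hγ.mono inter_subset_right) (fun x hx => hx.1)
  obtain ⟨K, hK⟩ := hloc.exists_lipschitzOnWith_of_compact isCompact_uIcc
  have hac₁ := hK.absolutelyContinuousOnInterval
  have hac₂ : AbsolutelyContinuousOnInterval
      (fun x => ∫ t in a..x, deriv γ t • f (γ t)) a b := by
    obtain ⟨B, hB⟩ := isCompact_uIcc.exists_bound_of_continuousOn hFc
    have hb : ∀ᵐ t, t ∈ uIoc a b → ‖deriv γ t • f (γ t)‖ ≤ C * B := by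
      filter_upwards [(ae_restrict_iff' measurableSet_uIoc).1
        (norm_deriv_le_ae_of_lipschitzOnWith hγ)] with t ht ht'
      rw [norm_smul]
      exact mul_le_mul (ht ht') (hB t (uIoc_subset_uIcc ht')) (norm_nonneg _) C.2
    refine LipschitzOnWith.absolutelyContinuousOnInterval (K := Real.toNNReal (C * B))
      (LipschitzOnWith.of_dist_le_mul fun x hx y hy => ?_)
    rw [dist_eq_norm, intervalIntegral.integral_interval_sub_left
      (hint.mono_set (uIcc_subset_uIcc left_mem_uIcc hx))
      (hint.mono_set (uIcc_subset_uIcc left_mem_uIcc hy)), Real.dist_eq]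
    refine (intervalIntegral.norm_integral_le_of_norm_le_const_ae (C := C * B) ?_).trans
      (mul_le_mul_of_nonneg_right (Real.le_coe_toNNReal _) (abs_nonneg _))
    filter_upwards [hb] with t ht ht'
    refine ht ?_
    rw [mem_uIoc] at ht' ⊢
    rw [mem_uIcc] at hx hy
    grind
  -- An absolutely continuous function with derivative `0` almost everywhere is constant. The chain
  -- rule is needed only at the points where `γ` is differentiable, which is almost everywhere.
  have hac : AbsolutelyContinuousOnInterval
      ((fun t => g (γ t)) - fun x => ∫ t in a..x, deriv γ t • f (γ t)) a b := hac₁.sub hac₂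
  have hd : ∀ᵐ x, x ∈ uIcc a b → HasDerivAt
      ((fun t => g (γ t)) - fun x => ∫ t in a..x, deriv γ t • f (γ t)) 0 x := by
    filter_upwards [hγ.absolutelyContinuousOnInterval.boundedVariationOn.ae_differentiableAt_of_mem_uIcc,
      hint.ae_hasDerivAt_integral] with x h1 h2 hx
    have h3 : HasDerivAt (fun t => g (γ t)) (deriv γ x • f (γ x)) x :=
      HasDerivAt.scomp x (hg _ (hmem x hx)) (h1 hx).hasDerivAt
    have h4 := h3.sub (h2 hx a (by simp))
    rwa [sub_self] at h4
  obtain ⟨c, hc⟩ := hac.const_of_ae_hasDerivAt_zero hd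
  have ha := hc a (by simp)
  have hb := hc b (by simp)
  simp only [Pi.sub_apply, intervalIntegral.integral_same, sub_zero] at ha hb
  rw [ha, ← hb]
  abel

/-- An integral depending on a parameter holomorphically is holomorphic. -/
theorem differentiableAt_integral_of_bounded [CompleteSpace E] {α : Type*} [MeasurableSpace α]
    {ν : Measure α} {G : ℂ → α → E} {w₀ : ℂ} {r : ℝ} (hr : 0 < r) {B : α → ℝ}
    (hB : Integrable B ν)
    (hm : ∀ w ∈ Metric.ball w₀ r, AEStronglyMeasurable (G w) ν)
    (hd : ∀ᵐ x ∂ν, DifferentiableOn ℂ (fun w => G w x) (Metric.ball w₀ r))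
    (hb : ∀ᵐ x ∂ν, ∀ w ∈ Metric.ball w₀ r, ‖G w x‖ ≤ B x) :
    DifferentiableAt ℂ (fun w => ∫ x, G w x ∂ν) w₀ := by
  have hw₀ : w₀ ∈ Metric.ball w₀ r := Metric.mem_ball_self hr
  have hder : ∀ᵐ x ∂ν, HasDerivAt (fun w => G w x) (deriv (fun w => G w x) w₀) w₀ := by
    filter_upwards [hd] with x hx
    exact (hx.differentiableAt (Metric.ball_mem_nhds _ hr)).hasDerivAt
  refine (hasDerivAt_integral_of_dominated_loc_of_lip (F' := fun x => deriv (fun w => G w x) w₀)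
    (bound := fun x => B x * (4 / r))
    (Metric.ball_mem_nhds w₀ (half_pos hr)) ?_ ?_ ?_ ?_ (hB.mul_const _) hder).2.differentiableAt
  · filter_upwards [Metric.ball_mem_nhds w₀ hr] with w hw using hm w hw
  · exact hB.mono' (hm w₀ hw₀) (by filter_upwards [hb] with x hx using hx w₀ hw₀)
  -- The derivative at `w₀` is measurable in `x` as a limit of difference quotients along this null
  -- sequence.
  · let h : ℕ → ℂ := fun n => ((r / 2 / (n + 1) : ℝ) : ℂ)
    have hpos : ∀ n : ℕ, 0 < r / 2 / ((n : ℝ) + 1) := fun n => by positivity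
    have h0 : ∀ n, h n ≠ 0 := fun n => by
      simpa only [h, ne_eq, Complex.ofReal_eq_zero] using (hpos n).ne'
    have hlim : Tendsto h atTop (𝓝 0) := by
      have := (tendsto_const_div_atTop_nhds_zero_nat (r / 2)).comp (tendsto_add_atTop_nat 1)
      have h2 := (Complex.continuous_ofReal.tendsto 0).comp this
      simpa [Function.comp_def, h] using h2
    have hmem : ∀ n, w₀ + h n ∈ Metric.ball w₀ r := fun n => by
      rw [Metric.mem_ball, dist_eq_norm, add_sub_cancel_left, Complex.norm_real, Real.norm_eq_abs,
        abs_of_pos (hpos n)]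
      calc r / 2 / ((n : ℝ) + 1) ≤ r / 2 := div_le_self (by positivity) (by linarith [n.cast_nonneg (α := ℝ)])
        _ < r := by linarith
    refine aestronglyMeasurable_of_tendsto_ae (u := atTop)
      (f := fun n x => (h n)⁻¹ • (G (w₀ + h n) x - G w₀ x)) (fun n => ?_) ?_
    · exact ((hm _ (hmem n)).sub (hm _ hw₀)).const_smul _
    · filter_upwards [hder] with x hx
      have := hx.tendsto_slope_zero
      exact this.comp (tendsto_nhdsWithin_iff.2 ⟨hlim, Eventually.of_forall h0⟩)
  -- Cauchy's estimate on discs of radius `r / 4` centred in the half-size ball bounds the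
  -- derivative by `4 B / r`.
  · filter_upwards [hd, hb] with x hx hbx
    refine (convex_ball w₀ (r / 2)).lipschitzOnWith_of_nnnorm_hasDerivWithin_le
      (f' := fun w => deriv (fun w => G w x) w) (fun w hw => ?_) (fun w hw => ?_)
    · refine (hx.differentiableAt ?_).hasDerivAt.hasDerivWithinAt
      exact Metric.isOpen_ball.mem_nhds (Metric.ball_subset_ball (by linarith) hw)
    · have hsub : Metric.closedBall w (r / 4) ⊆ Metric.ball w₀ r := by
        intro z hz
        rw [Metric.mem_closedBall] at hz
        rw [Metric.mem_ball] at hw ⊢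
        linarith [dist_triangle z w w₀]
      rw [← NNReal.coe_le_coe, coe_nnnorm, Real.coe_nnabs]
      refine le_trans ?_ (le_abs_self _)
      have := Complex.norm_deriv_le_of_forall_mem_sphere_norm_le (c := w) (R := r / 4)
        (C := B x) (f := fun w => G w x) (by positivity)
        ((hx.mono ((Metric.closure_ball_subset_closedBall).trans hsub)).diffContOnCl)
        (fun z hz => hbx z (hsub (Metric.sphere_subset_closedBall hz)))
      calc _ ≤ B x / (r / 4) := this
        _ = B x * (4 / r) := by field_simp

end CurveIntegrals

/-! ### Cauchy's theorem for rectifiable cycles, in its homology form -/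

section Chains

variable {E : Type*} [NormedAddCommGroup E] [NormedSpace ℂ E]
variable {ι : Type*} [Fintype ι]

/-- The integral of `f` along the chain formed by the curves `γ i`, each over `[a i, b i]`. -/
def chainIntegral (γ : ι → ℝ → ℂ) (a b : ι → ℝ) (f : ℂ → E) : E :=
  ∑ i, ∫ t in a i..b i, deriv (γ i) t • f (γ i t)

/-- The rectifiable curves `γ i`, each over `[a i, b i]`, form a cycle in `U`. -/
structure IsCycle (U : Set ℂ) (γ : ι → ℝ → ℂ) (a b : ι → ℝ) : Prop where
  lipschitz : ∀ i, ∃ C, LipschitzOnWith C (γ i) (uIcc (a i) (b i))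
  mem : ∀ i, ∀ t ∈ uIcc (a i) (b i), γ i t ∈ U
  boundary : ∀ g : ℂ → ℂ, ∑ i, (g (γ i (b i)) - g (γ i (a i))) = 0

/-- The union of the curves of a chain. -/
def support (γ : ι → ℝ → ℂ) (a b : ι → ℝ) : Set ℂ := ⋃ i, γ i '' uIcc (a i) (b i)

variable {γ : ι → ℝ → ℂ} {a b : ι → ℝ} {U : Set ℂ}

omit [Fintype ι] in
theorem mem_support {i : ι} {t : ℝ} (ht : t ∈ uIcc (a i) (b i)) : γ i t ∈ support γ a b :=
  mem_iUnion.2 ⟨i, mem_image_of_mem _ ht⟩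

theorem IsCycle.isCompact_support (h : IsCycle U γ a b) : IsCompact (support γ a b) :=
  isCompact_iUnion fun i => isCompact_uIcc.image_of_continuousOn
    (h.lipschitz i).choose_spec.continuousOn

theorem IsCycle.support_subset (h : IsCycle U γ a b) : support γ a b ⊆ U := by
  refine iUnion_subset fun i => ?_
  rintro _ ⟨t, ht, rfl⟩
  exact h.mem i t ht

theorem IsCycle.mono (h : IsCycle U γ a b) {V : Set ℂ} (hV : support γ a b ⊆ V) :
    IsCycle V γ a b :=
  ⟨h.lipschitz, fun _ _ ht => hV (mem_support ht), h.boundary⟩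

theorem IsCycle.intervalIntegrable (h : IsCycle U γ a b) {f : ℂ → E} (hf : ContinuousOn f U)
    (i : ι) : IntervalIntegrable (fun t => deriv (γ i) t • f (γ i t)) volume (a i) (b i) := by
  obtain ⟨C, hC⟩ := h.lipschitz i
  exact intervalIntegrable_deriv_smul hC (hf.comp hC.continuousOn (h.mem i))

theorem IsCycle.chainIntegral_sub (h : IsCycle U γ a b) {f g : ℂ → E} (hf : ContinuousOn f U)
    (hg : ContinuousOn g U) :
    chainIntegral γ a b (fun z => f z - g z) = chainIntegral γ a b f - chainIntegral γ a b g := by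
  simp only [chainIntegral, ← Finset.sum_sub_distrib, smul_sub]
  exact Finset.sum_congr rfl fun i _ =>
    intervalIntegral.integral_sub (h.intervalIntegrable hf i) (h.intervalIntegrable hg i)

theorem IsCycle.chainIntegral_congr (h : IsCycle U γ a b) {f g : ℂ → E} (hfg : EqOn f g U) :
    chainIntegral γ a b f = chainIntegral γ a b g := by
  refine Finset.sum_congr rfl fun i _ => intervalIntegral.integral_congr fun t ht => ?_
  simp only [hfg (h.mem i t ht)]

theorem chainIntegral_smul_const [CompleteSpace E] (f : ℂ → ℂ) (u : E) :
    chainIntegral γ a b (fun z => f z • u) = chainIntegral γ a b f • u := by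
  simp only [chainIntegral, Finset.sum_smul, ← intervalIntegral.integral_smul_const, smul_eq_mul,
    mul_smul]

theorem IsCycle.chainIntegral_eq_zero_of_hasDerivAt (h : IsCycle U γ a b) (hU : IsOpen U)
    {f g : ℂ → ℂ} (hf : ContinuousOn f U) (hg : ∀ z ∈ U, HasDerivAt g (f z) z) :
    chainIntegral γ a b f = 0 := by
  rw [← h.boundary g]
  refine Finset.sum_congr rfl fun i _ => ?_
  obtain ⟨C, hC⟩ := h.lipschitz i
  exact integral_deriv_smul_eq_sub hC hU (h.mem i) hf hg

/-- A cycle has winding number `0` about a point from which a ray escapes. -/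
theorem IsCycle.winding_eq_zero_of_slitPlane (h : IsCycle U γ a b) {w θ : ℂ}
    (hθ : ∀ z ∈ support γ a b, θ * (z - w) ∈ Complex.slitPlane) :
    chainIntegral γ a b (fun z => (z - w)⁻¹) = 0 := by
  let V : Set ℂ := (fun z => θ * (z - w)) ⁻¹' Complex.slitPlane
  have hV : IsOpen V := Complex.isOpen_slitPlane.preimage (by fun_prop)
  have h0 : ∀ z ∈ V, θ ≠ 0 ∧ z - w ≠ 0 := fun z hz =>
    mul_ne_zero_iff.1 (Complex.slitPlane_ne_zero hz)
  refine (h.mono (V := V) hθ).chainIntegral_eq_zero_of_hasDerivAt hV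
    (g := fun z => Complex.log (θ * (z - w))) ?_ fun z hz => ?_
  · exact ContinuousOn.inv₀ (by fun_prop) fun z hz => (h0 z hz).2
  · have h1 : HasDerivAt (fun z => θ * (z - w)) θ z := by
      simpa using ((hasDerivAt_id z).sub_const w).const_mul θ
    convert h1.clog hz using 1
    have := (h0 z hz).1
    have := (h0 z hz).2
    field_simp

/-- On the cycle the quotient `(z - w) / (z - w₀)` stays within distance less than `1` of `1`, so
its principal logarithm is a single-valued primitive of the difference of the two integrands. -/
theorem IsCycle.winding_eq_of_mem_ball (h : IsCycle U γ a b) {w₀ w : ℂ} {ρ : ℝ}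
    (hρ : ∀ z ∈ support γ a b, ρ ≤ dist z w₀) (hw : w ∈ Metric.ball w₀ ρ) :
    chainIntegral γ a b (fun z => (z - w)⁻¹) = chainIntegral γ a b (fun z => (z - w₀)⁻¹) := by
  let V : Set ℂ := {z | dist w w₀ < dist z w₀}
  have hV : IsOpen V := isOpen_lt continuous_const (by fun_prop)
  have hs : support γ a b ⊆ V := fun z hz => lt_of_lt_of_le hw (hρ z hz)
  have h0 : ∀ z ∈ V, z - w₀ ≠ 0 := fun z hz => by
    rw [← norm_pos_iff, ← dist_eq_norm]
    exact lt_of_le_of_lt dist_nonneg hz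
  have h1 : ∀ z ∈ V, z - w ≠ 0 := fun z hz => by
    rintro h
    rw [sub_eq_zero] at h
    subst h
    exact lt_irrefl _ (show dist z w₀ < dist z w₀ from hz)
  have hc0 : ContinuousOn (fun z : ℂ => (z - w₀)⁻¹) V := ContinuousOn.inv₀ (by fun_prop) h0
  have hc1 : ContinuousOn (fun z : ℂ => (z - w)⁻¹) V := ContinuousOn.inv₀ (by fun_prop) h1
  rw [← sub_eq_zero, ← (h.mono hs).chainIntegral_sub hc1 hc0]
  refine (h.mono hs).chainIntegral_eq_zero_of_hasDerivAt hV (hc1.sub hc0)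
    (g := fun z => Complex.log ((z - w) / (z - w₀))) fun z hz => ?_
  have h2 : HasDerivAt (fun z => (z - w) / (z - w₀)) ((1 * (z - w₀) - (z - w) * 1) / (z - w₀) ^ 2)
      z := ((hasDerivAt_id z).sub_const w).div ((hasDerivAt_id z).sub_const w₀) (h0 z hz)
  have hslit : (z - w) / (z - w₀) ∈ Complex.slitPlane := by
    have : (z - w) / (z - w₀) = 1 + (w₀ - w) / (z - w₀) := by
      have := h0 z hz
      field_simp
      ring
    rw [this]
    refine Complex.mem_slitPlane_of_norm_lt_one ?_
    rw [norm_div, div_lt_one (norm_pos_iff.2 (h0 z hz)), norm_sub_rev, ← dist_eq_norm,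
      ← dist_eq_norm]
    exact hz
  convert h2.clog hslit using 1
  have := h0 z hz
  have := h1 z hz
  field_simp

theorem IsCycle.differentiableAt_cauchyTransform [CompleteSpace E] (h : IsCycle U γ a b)
    {f : ℂ → E} (hf : ContinuousOn f U) {w₀ : ℂ} (hw₀ : w₀ ∉ support γ a b) :
    DifferentiableAt ℂ (fun w => chainIntegral γ a b fun z => (z - w)⁻¹ • f z) w₀ := by
  obtain ⟨ρ, hρ, hball⟩ := Metric.isOpen_iff.1 h.isCompact_support.isClosed.isOpen_compl w₀ hw₀
  have hdist : ∀ i, ∀ t ∈ uIcc (a i) (b i), ∀ w ∈ Metric.ball w₀ (ρ / 2),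
      ρ / 2 ≤ ‖γ i t - w‖ := by
    intro i t ht w hw
    by_contra! hlt
    refine hball (a := γ i t) ?_ (mem_support ht)
    rw [Metric.mem_ball] at hw ⊢
    rw [← dist_eq_norm] at hlt
    linarith [dist_triangle (γ i t) w w₀]
  have hne : ∀ i, ∀ t ∈ uIcc (a i) (b i), ∀ w ∈ Metric.ball w₀ (ρ / 2), γ i t - w ≠ 0 :=
    fun i t ht w hw => norm_pos_iff.1 (lt_of_lt_of_le (by positivity) (hdist i t ht w hw))
  unfold chainIntegral
  refine DifferentiableAt.fun_sum fun i _ => ?_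
  simp only [intervalIntegral.intervalIntegral_eq_integral_uIoc]
  refine DifferentiableAt.const_smul (differentiableAt_integral_of_bounded
    (G := fun w t => deriv (γ i) t • (γ i t - w)⁻¹ • f (γ i t)) (r := ρ / 2) (by positivity)
    (B := fun t => (ρ / 2)⁻¹ * ‖deriv (γ i) t • f (γ i t)‖) ?_ ?_ ?_ ?_) _
  · exact (((intervalIntegrable_iff.1 (h.intervalIntegrable hf i))).norm).const_mul _
  · intro w hw
    have hcont : ContinuousOn (fun t => (γ i t - w)⁻¹ • f (γ i t)) (uIcc (a i) (b i)) := by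
      obtain ⟨C, hC⟩ := h.lipschitz i
      refine ContinuousOn.smul (ContinuousOn.inv₀ ?_ fun t ht => hne i t ht w hw)
        (hf.comp hC.continuousOn (h.mem i))
      exact hC.continuousOn.sub continuousOn_const
    exact (intervalIntegrable_iff.1
      (intervalIntegrable_deriv_smul (h.lipschitz i).choose_spec hcont)).aestronglyMeasurable
  · filter_upwards [ae_restrict_mem measurableSet_uIoc] with t ht
    have hd : DifferentiableOn ℂ (fun w => (γ i t - w)⁻¹) (Metric.ball w₀ (ρ / 2)) :=
      DifferentiableOn.inv (by fun_prop) fun w hw => hne i t (uIoc_subset_uIcc ht) w hw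
    exact (hd.smul_const _).const_smul _
  · filter_upwards [ae_restrict_mem measurableSet_uIoc] with t ht w hw
    rw [smul_comm, norm_smul, norm_inv]
    exact mul_le_mul_of_nonneg_right
      (inv_anti₀ (by positivity) (hdist i t (uIoc_subset_uIcc ht) w hw)) (norm_nonneg _)

/-- Points `z` close to `w₀` are handled by the mean value inequality; for the others the numerator
is bounded and `‖z - w‖ ≥ r / 2`. Uniformity in `w` is what differentiation under the integral sign
requires. -/
theorem exists_bound_dslope {f : ℂ → E} [CompleteSpace E] (hU : IsOpen U)
    (hf : DifferentiableOn ℂ f U) {w₀ : ℂ} (hw₀ : w₀ ∈ U) {K : Set ℂ} (hK : IsCompact K)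
    (hKU : K ⊆ U) :
    ∃ ρ > 0, Metric.ball w₀ ρ ⊆ U ∧ ∃ B, ∀ w ∈ Metric.ball w₀ ρ, ∀ z ∈ K, ‖dslope f w z‖ ≤ B := by
  obtain ⟨r, hr, hrU⟩ := Metric.nhds_basis_closedBall.mem_iff.1 (hU.mem_nhds hw₀)
  have hcb := isCompact_closedBall w₀ r
  obtain ⟨M, hM⟩ := hcb.exists_bound_of_continuousOn
    ((hf.deriv hU).continuousOn.mono hrU)
  obtain ⟨B₁, hB₁⟩ := hcb.exists_bound_of_continuousOn (hf.continuousOn.mono hrU)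
  obtain ⟨B₂, hB₂⟩ := hK.exists_bound_of_continuousOn (hf.continuousOn.mono hKU)
  have hsub : Metric.ball w₀ (r / 2) ⊆ Metric.closedBall w₀ r :=
    Metric.ball_subset_closedBall.trans (Metric.closedBall_subset_closedBall (by linarith))
  refine ⟨r / 2, by positivity, hsub.trans hrU, max M ((r / 2)⁻¹ * (B₂ + B₁)), ?_⟩
  intro w hw z hz
  have hwr := hsub hw
  by_cases hzr : z ∈ Metric.closedBall w₀ r
  · refine le_max_of_le_left ?_
    rcases eq_or_ne z w with rfl | hne
    · rw [dslope_same]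
      exact hM z hzr
    · rw [dslope_of_ne _ hne, slope_def_module, norm_smul, norm_inv]
      have := (convex_closedBall w₀ r).norm_image_sub_le_of_norm_deriv_le (f := f) (C := M)
        (fun x hx => hf.differentiableAt (hU.mem_nhds (hrU hx))) (fun x hx => hM x hx) hwr hzr
      rw [inv_mul_le_iff₀ (norm_pos_iff.2 (sub_ne_zero.2 hne)), mul_comm]
      exact this
  · refine le_max_of_le_right ?_
    have hzw : r / 2 ≤ ‖z - w‖ := by
      rw [Metric.mem_closedBall, not_le] at hzr
      rw [Metric.mem_ball] at hw
      rw [← dist_eq_norm]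
      linarith [dist_triangle z w w₀]
    have hne : z ≠ w := by
      rintro rfl
      simp at hzw
      linarith
    rw [dslope_of_ne _ hne, slope_def_module, norm_smul, norm_inv]
    refine mul_le_mul (inv_anti₀ (by positivity) hzw) ?_ (norm_nonneg _) (by positivity)
    exact (norm_sub_le _ _).trans (add_le_add (hB₂ z hz) (hB₁ w hwr))

theorem IsCycle.differentiableAt_dslope [CompleteSpace E] (h : IsCycle U γ a b) (hU : IsOpen U)
    {f : ℂ → E} (hf : DifferentiableOn ℂ f U) {w₀ : ℂ} (hw₀ : w₀ ∈ U) :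
    DifferentiableAt ℂ (fun w => chainIntegral γ a b (dslope f w)) w₀ := by
  obtain ⟨ρ, hρ, hρU, B, hB⟩ := exists_bound_dslope hU hf hw₀ h.isCompact_support h.support_subset
  have hcont : ∀ w ∈ U, ContinuousOn (dslope f w) U := fun w hw =>
    (continuousOn_dslope (hU.mem_nhds hw)).2
      ⟨hf.continuousOn, hf.differentiableAt (hU.mem_nhds hw)⟩
  unfold chainIntegral
  refine DifferentiableAt.fun_sum fun i _ => ?_
  obtain ⟨C, hC⟩ := h.lipschitz i
  simp only [intervalIntegral.intervalIntegral_eq_integral_uIoc]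
  refine DifferentiableAt.const_smul (differentiableAt_integral_of_bounded
    (G := fun w t => deriv (γ i) t • dslope f w (γ i t)) hρ (B := fun _ => C * B) ?_ ?_ ?_ ?_) _
  · exact integrableOn_const (by simp)
  · intro w hw
    exact (intervalIntegrable_iff.1
      (h.intervalIntegrable (hcont w (hρU hw)) i)).aestronglyMeasurable
  · filter_upwards [ae_restrict_mem measurableSet_uIoc] with t ht
    have ht' := h.mem i t (uIoc_subset_uIcc ht)
    -- The slope is symmetric in its two arguments, so for fixed `γ i t` it is holomorphic in the
    -- base point `w` too.
    have := (Complex.differentiableOn_dslope (hU.mem_nhds ht')).2 hf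
    refine DifferentiableOn.const_smul ((this.mono hρU).congr fun w _ => ?_) _
    rcases eq_or_ne (γ i t) w with e | e
    · rw [e]
    · rw [dslope_of_ne _ e, dslope_of_ne _ e.symm, slope_comm]
  · filter_upwards [ae_restrict_mem measurableSet_uIoc, norm_deriv_le_ae_of_lipschitzOnWith hC]
      with t ht htC w hw
    rw [norm_smul]
    exact mul_le_mul htC (hB w hw _ (mem_support (uIoc_subset_uIcc ht))) (norm_nonneg _) C.2

theorem IsCycle.tendsto_cauchyTransform (h : IsCycle U γ a b)
    {f : ℂ → E} (hf : ContinuousOn f U) :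
    Tendsto (fun w => chainIntegral γ a b fun z => (z - w)⁻¹ • f z) (cocompact ℂ) (𝓝 0) := by
  obtain ⟨ρ, hρ⟩ := h.isCompact_support.isBounded.subset_closedBall 0
  unfold chainIntegral
  rw [show (0 : E) = ∑ i : ι, (0 : E) by simp]
  refine tendsto_finsetSum _ fun i _ => ?_
  have hint := (intervalIntegrable_iff.1 (h.intervalIntegrable hf i)).norm
  have hlim : Tendsto (fun w : ℂ =>
      ∫ t in uIoc (a i) (b i), (‖w‖ - ρ)⁻¹ * ‖deriv (γ i) t • f (γ i t)‖)
      (cocompact ℂ) (𝓝 0) := by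
    simp only [integral_const_mul]
    rw [← zero_mul (∫ t in uIoc (a i) (b i), ‖deriv (γ i) t • f (γ i t)‖)]
    refine Tendsto.mul_const _ (tendsto_inv_atTop_zero.comp ?_)
    simpa [sub_eq_add_neg] using
      tendsto_atTop_add_const_right (cocompact ℂ) (-ρ) (tendsto_norm_cocompact_atTop (E := ℂ))
  refine squeeze_zero_norm' ?_ hlim
  filter_upwards [(tendsto_norm_cocompact_atTop (E := ℂ)).eventually_gt_atTop ρ] with w hw
  rw [intervalIntegral.norm_intervalIntegral_eq]
  refine norm_integral_le_of_norm_le (hint.const_mul _) ?_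
  filter_upwards [ae_restrict_mem measurableSet_uIoc] with t ht
  rw [smul_comm, norm_smul, norm_inv]
  refine mul_le_mul_of_nonneg_right (inv_anti₀ (sub_pos.2 hw) ?_) (norm_nonneg _)
  have h1 := hρ (mem_support (uIoc_subset_uIcc ht))
  rw [mem_closedBall_zero_iff] at h1
  rw [norm_sub_rev]
  linarith [norm_sub_norm_le w (γ i t)]

theorem IsCycle.winding_eq_zero_of_norm_lt (h : IsCycle U γ a b) {ρ : ℝ}
    (hρ : support γ a b ⊆ Metric.closedBall 0 ρ) {w : ℂ} (hw : ρ < ‖w‖) :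
    chainIntegral γ a b (fun z => (z - w)⁻¹) = 0 := by
  rcases (support γ a b).eq_empty_or_nonempty with he | ⟨z₀, hz₀⟩
  · exact h.winding_eq_zero_of_slitPlane (θ := 1) (by simp [he])
  have hρ0 : 0 ≤ ρ := (norm_nonneg _).trans (mem_closedBall_zero_iff.1 (hρ hz₀))
  have hw0 : w ≠ 0 := norm_pos_iff.1 (lt_of_le_of_lt hρ0 hw)
  -- The cut is the ray that starts at `w` and points away from the origin; it misses the disc
  -- containing the cycle.
  refine h.winding_eq_zero_of_slitPlane (θ := -w⁻¹) fun z hz => ?_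
  have : -w⁻¹ * (z - w) = 1 + -(z / w) := by
    field_simp
    ring
  rw [this]
  refine Complex.mem_slitPlane_of_norm_lt_one ?_
  rw [norm_neg, norm_div, div_lt_one (norm_pos_iff.2 hw0)]
  exact lt_of_le_of_lt (mem_closedBall_zero_iff.1 (hρ hz)) hw

/-- The homology version of **Cauchy's integral theorem** for rectifiable cycles. -/
theorem IsCycle.chainIntegral_eq_zero [CompleteSpace E] (h : IsCycle U γ a b) (hU : IsOpen U)
    {f : ℂ → E} (hf : DifferentiableOn ℂ f U)
    (hw : ∀ w ∉ U, chainIntegral γ a b (fun z => (z - w)⁻¹) = 0) :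
    chainIntegral γ a b f = 0 := by
  classical
  -- Dixon's argument: off the support, and where the winding number vanishes, the integral of the
  -- divided difference equals the Cauchy transform. The two therefore glue to an entire function
  -- tending to `0` at infinity, which is zero by Liouville's theorem.
  have key : ∀ F : ℂ → E, DifferentiableOn ℂ F U →
      ∀ w ∈ U, chainIntegral γ a b (dslope F w) = 0 := by
    intro F hF
    have hcomp : ∀ w ∈ U, w ∉ support γ a b → chainIntegral γ a b (fun z => (z - w)⁻¹) = 0 →
        chainIntegral γ a b (dslope F w) = chainIntegral γ a b fun z => (z - w)⁻¹ • F z := by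
      intro w hwU hws hwind
      have h' : IsCycle (support γ a b) γ a b := h.mono subset_rfl
      have hinv : ContinuousOn (fun z : ℂ => (z - w)⁻¹) (support γ a b) :=
        ContinuousOn.inv₀ (by fun_prop) fun z hz => sub_ne_zero.2 (ne_of_mem_of_not_mem hz hws)
      calc chainIntegral γ a b (dslope F w)
          = chainIntegral γ a b (fun z => (z - w)⁻¹ • F z - (z - w)⁻¹ • F w) := by
            refine h'.chainIntegral_congr fun z hz => ?_
            rw [dslope_of_ne _ (ne_of_mem_of_not_mem hz hws), slope_def_module, smul_sub]
        _ = _ := by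
            rw [h'.chainIntegral_sub (f := fun z => (z - w)⁻¹ • F z)
              (g := fun z => (z - w)⁻¹ • F w) (hinv.smul (hF.continuousOn.mono h.support_subset))
              (hinv.smul continuousOn_const), chainIntegral_smul_const, hwind, zero_smul, sub_zero]
    let H : ℂ → E := fun w => if w ∈ U then chainIntegral γ a b (dslope F w) else
      chainIntegral γ a b fun z => (z - w)⁻¹ • F z
    have hdiff : Differentiable ℂ H := by
      intro w₀
      by_cases hw₀ : w₀ ∈ U
      · refine (h.differentiableAt_dslope hU hF hw₀).congr_of_eventuallyEq ?_
        filter_upwards [hU.mem_nhds hw₀] with w hwU using if_pos hwU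
      · have hs : w₀ ∉ support γ a b := fun hs => hw₀ (h.support_subset hs)
        refine (h.differentiableAt_cauchyTransform hF.continuousOn hs).congr_of_eventuallyEq ?_
        obtain ⟨ρ, hρ, hball⟩ :=
          Metric.isOpen_iff.1 h.isCompact_support.isClosed.isOpen_compl w₀ hs
        filter_upwards [Metric.ball_mem_nhds w₀ hρ] with w hwb
        by_cases hwU : w ∈ U
        · refine (if_pos hwU).trans (hcomp w hwU (hball hwb) ?_)
          rw [h.winding_eq_of_mem_ball (fun z hz => ?_) hwb, hw w₀ hw₀]
          by_contra! hlt
          exact hball hlt hz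
        · exact if_neg hwU
    have hlim : Tendsto H (cocompact ℂ) (𝓝 0) := by
      refine (h.tendsto_cauchyTransform hF.continuousOn).congr' ?_
      obtain ⟨ρ, hρ⟩ := h.isCompact_support.isBounded.subset_closedBall 0
      filter_upwards [(tendsto_norm_cocompact_atTop (E := ℂ)).eventually_gt_atTop ρ] with w hwρ
      by_cases hwU : w ∈ U
      · refine ((if_pos hwU).trans (hcomp w hwU (fun hs => ?_)
          (h.winding_eq_zero_of_norm_lt hρ hwρ))).symm
        exact absurd (mem_closedBall_zero_iff.1 (hρ hs)) (not_le.2 hwρ)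
      · exact (if_neg hwU).symm
    intro w hwU
    rw [← hdiff.apply_eq_of_tendsto_cocompact w hlim]
    exact (if_pos hwU).symm
  rcases isEmpty_or_nonempty ι with he | ⟨⟨i⟩⟩
  · simp [chainIntegral]
  have hw₀ : γ i (a i) ∈ U := h.mem i _ left_mem_uIcc
  set w₀ := γ i (a i)
  -- The divided difference of `(z - w₀) f(z)` with base point `w₀` is `f(z)` itself, including at
  -- `z = w₀`.
  have hF : DifferentiableOn ℂ (fun z => (z - w₀) • f z) U :=
    DifferentiableOn.smul (by fun_prop) hf
  rw [← key _ hF w₀ hw₀]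
  refine h.chainIntegral_congr fun z hz => ?_
  rcases eq_or_ne z w₀ with he | hne
  · have h1 := ((hasDerivAt_id w₀).sub_const w₀).smul
      (hf.differentiableAt (hU.mem_nhds hw₀)).hasDerivAt
    rw [he, dslope_same]
    have h2 : HasDerivAt (fun z => (z - w₀) • f z) (f w₀) w₀ := by
      simp only [id, sub_self, zero_smul, one_smul, zero_add] at h1
      exact h1
    exact h2.deriv.symm
  · rw [dslope_of_ne _ hne, slope_def_module]
    simp [smul_smul, sub_ne_zero.2 hne]

/-- On a simply connected open set omitting `w`, the function `z - w` has a holomorphic logarithm,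
which is a primitive of `(z - w)⁻¹`. -/
theorem IsCycle.winding_eq_zero_of_isSimplyConnected (h : IsCycle U γ a b) (hU : IsOpen U)
    (hsc : IsSimplyConnected U) {w : ℂ} (hw : w ∉ U) :
    chainIntegral γ a b (fun z => (z - w)⁻¹) = 0 := by
  have h0 : ∀ z ∈ U, z - w ≠ 0 := fun z hz => sub_ne_zero.2 (ne_of_mem_of_not_mem hz hw)
  obtain ⟨g, hgc, hg⟩ := Complex.exists_continuousOn_eqOn_exp_comp hsc hU
    (g := fun z => z - w) (by fun_prop) (by rintro ⟨z, hz, hz'⟩; exact h0 z hz hz')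
  refine h.chainIntegral_eq_zero_of_hasDerivAt hU (g := g)
    (ContinuousOn.inv₀ (by fun_prop) h0) fun z hz => ?_
  have hexp : Complex.exp (g z) = z - w := hg hz
  rw [← hexp]
  refine HasDerivAt.of_local_left_inverse (f := fun y => Complex.exp y + w)
    (hgc.continuousAt (hU.mem_nhds hz)) ((Complex.hasDerivAt_exp _).add_const w)
    (Complex.exp_ne_zero _) ?_
  filter_upwards [hU.mem_nhds hz] with y hy
  have : Complex.exp (g y) = y - w := hg hy
  rw [this, sub_add_cancel]

end Chains

/-! ### Resolvents of unbounded operators and of their bounded perturbations -/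

section Resolvents

variable {H : Type*} [NormedAddCommGroup H] [InnerProductSpace ℂ H]
variable {A T : H →ₗ.[ℂ] H} {R S X Y : H →L[ℂ] H} {z w : ℂ}

theorem perturb_apply (x : A.domain) : perturb A X x = X x + A x := rfl

/-- Operators are compared through their graphs throughout, so that equalities of domains come along
without separate bookkeeping. -/
theorem mem_graph_perturb {x y : H} :
    (x, y) ∈ (perturb A X).graph ↔ (x, y - X x) ∈ A.graph := by
  simp only [LinearPMap.mem_graph_iff]
  constructor
  · rintro ⟨v, rfl, h⟩
    exact ⟨v, rfl, by rw [← h]; exact (add_sub_cancel_left (X v) (A v)).symm⟩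
  · rintro ⟨v, rfl, h⟩
    exact ⟨v, rfl, (perturb_apply v).trans (by rw [h]; simp)⟩

theorem mem_graph_shift {x y : H} : (x, y) ∈ (shift A z).graph ↔ (x, y + z • x) ∈ A.graph := by
  rw [shift, mem_graph_perturb]
  simp only [neg_apply, smul_apply, one_apply_eq_self, sub_neg_eq_add]

theorem eq_of_graph_iff {T T' : H →ₗ.[ℂ] H} (h : ∀ x y, (x, y) ∈ T.graph ↔ (x, y) ∈ T'.graph) :
    T = T' :=
  LinearPMap.eq_of_eq_graph (SetLike.ext fun ⟨x, y⟩ => h x y)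

theorem perturb_perturb : perturb (perturb A X) Y = perturb A (X + Y) :=
  eq_of_graph_iff fun x y => by
    rw [mem_graph_perturb, mem_graph_perturb, mem_graph_perturb, sub_sub, add_comm (Y x)]
    rfl

theorem perturb_zero : perturb A 0 = A :=
  eq_of_graph_iff fun x y => by
    rw [mem_graph_perturb, zero_apply, sub_zero]

theorem shift_perturb : shift (perturb A X) z = perturb (shift A z) X := by
  rw [shift, shift, perturb_perturb, perturb_perturb, add_comm]

theorem shift_shift : shift A z = perturb (shift A w) (-((z - w) • (1 : H →L[ℂ] H))) := by
  rw [shift, shift, perturb_perturb, sub_smul]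
  congr 1
  abel

theorem isBoundedInverse_iff :
    IsBoundedInverse T R ↔ (∀ x, (R x, x) ∈ T.graph) ∧ ∀ x y, (x, y) ∈ T.graph → R y = x := by
  simp only [LinearPMap.mem_graph_iff]
  constructor
  · rintro ⟨h1, h2⟩
    refine ⟨fun x => ?_, ?_⟩
    · obtain ⟨h, hx⟩ := h1 x
      exact ⟨⟨R x, h⟩, rfl, hx⟩
    · rintro x y ⟨v, rfl, rfl⟩
      exact h2 v
  · rintro ⟨h1, h2⟩
    refine ⟨fun x => ?_, fun x => h2 x _ ⟨x, rfl, rfl⟩⟩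
    obtain ⟨v, hv, hx⟩ := h1 x
    have hv' : R x ∈ T.domain := hv ▸ v.2
    exact ⟨hv', by rw [show (⟨R x, hv'⟩ : T.domain) = v from Subtype.ext hv.symm, hx]⟩

theorem IsBoundedInverse.unique (h : IsBoundedInverse T R) (h' : IsBoundedInverse T S) :
    R = S := by
  rw [isBoundedInverse_iff] at h h'
  ext x
  exact h.2 _ _ (h'.1 x)

theorem IsBoundedInverse.boundedInverse_eq (h : IsBoundedInverse T R) :
    boundedInverse T = R := by
  have h' : IsBoundedlyInvertible T := ⟨R, h⟩
  rw [boundedInverse, dif_pos h']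
  exact h'.choose_spec.unique h

theorem IsBoundedlyInvertible.isBoundedInverse (h : IsBoundedlyInvertible T) :
    IsBoundedInverse T (boundedInverse T) := by
  rw [boundedInverse, dif_pos h]
  exact h.choose_spec

theorem isBoundedInverse_res (hz : z ∉ spec A) : IsBoundedInverse (shift A z) (res A z) :=
  (not_not.1 hz : IsBoundedlyInvertible _).isBoundedInverse

theorem IsBoundedInverse.notMem_spec (h : IsBoundedInverse (shift A z) R) : z ∉ spec A :=
  fun hz => hz ⟨R, h⟩

theorem IsBoundedInverse.res_eq (h : IsBoundedInverse (shift A z) R) : res A z = R :=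
  h.boundedInverse_eq

theorem res_mem_graph (hz : z ∉ spec A) (x : H) :
    (res A z x, x + z • res A z x) ∈ A.graph :=
  mem_graph_shift.1 ((isBoundedInverse_iff.1 (isBoundedInverse_res hz)).1 x)

theorem res_apply_sub (hz : z ∉ spec A) {x y : H} (h : (x, y) ∈ A.graph) :
    res A z (y - z • x) = x :=
  (isBoundedInverse_iff.1 (isBoundedInverse_res hz)).2 _ _ (mem_graph_shift.2 (by simpa using h))

theorem mem_graph_iff_res (hz : z ∉ spec A) {x y : H} :
    (x, y) ∈ A.graph ↔ res A z (y - z • x) = x := by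
  refine ⟨res_apply_sub hz, fun h => ?_⟩
  have := res_mem_graph hz (y - z • x)
  rwa [h, sub_add_cancel] at this

/-- The first resolvent identity. -/
theorem res_sub_res (hz : z ∉ spec A) (hw : w ∉ spec A) :
    res A z - res A w = (z - w) • (res A z * res A w) := by
  ext x
  have h := res_apply_sub hz (res_mem_graph hw x)
  rw [add_sub_assoc, map_add, ← sub_smul, map_smul] at h
  change res A z x - res A w x = (z - w) • res A z (res A w x)
  rw [← sub_eq_zero] at h ⊢
  rw [← h, ← neg_sub z w, neg_smul]
  abel

/-- The second resolvent identity. -/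
theorem res_perturb_sub_res_perturb (hz : z ∉ spec (perturb A X)) (hz' : z ∉ spec (perturb A Y)) :
    res (perturb A X) z - res (perturb A Y) z =
      res (perturb A X) z * (Y - X) * res (perturb A Y) z := by
  ext x
  set v := res (perturb A Y) z x with hv
  have h : (v, x + z • v - Y v) ∈ A.graph := mem_graph_perturb.1 (res_mem_graph hz' x)
  have h1 : (v, x + z • v - Y v + X v) ∈ (perturb A X).graph :=
    mem_graph_perturb.2 (by rwa [add_sub_cancel_right])
  have h2 := res_apply_sub hz h1
  rw [show x + z • v - Y v + X v - z • v = x - (Y - X) v by rw [sub_apply]; abel, map_sub] at h2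
  change res (perturb A X) z x - v = res (perturb A X) z ((Y - X) v)
  rw [← sub_eq_zero] at h2 ⊢
  rw [← h2]
  abel

theorem isUnit_apply_inverse (hS : IsUnit S) (x : H) : S (Ring.inverse S x) = x :=
  congrArg (fun L : H →L[ℂ] H => L x) (Ring.mul_inverse_cancel _ hS)

theorem isUnit_inverse_apply (hS : IsUnit S) (x : H) : Ring.inverse S (S x) = x :=
  congrArg (fun L : H →L[ℂ] H => L x) (Ring.inverse_mul_cancel _ hS)

/-- The Neumann-type criterion for a perturbation to be boundedly invertible. -/
theorem IsBoundedInverse.perturb (h : IsBoundedInverse T R) (hU : IsUnit (1 + S * R)) :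
    IsBoundedInverse (perturb T S) (R * Ring.inverse (1 + S * R)) := by
  rw [isBoundedInverse_iff] at h ⊢
  refine ⟨fun x => ?_, fun x y hxy => ?_⟩
  · rw [mem_graph_perturb]
    have h4 : Ring.inverse (1 + S * R) x + S (R (Ring.inverse (1 + S * R) x)) = x :=
      isUnit_apply_inverse hU x
    change (R (Ring.inverse (1 + S * R) x), x - S (R (Ring.inverse (1 + S * R) x))) ∈ _
    generalize Ring.inverse (1 + S * R) x = v at h4
    rw [← h4, add_sub_cancel_right]
    exact h.1 v
  · rw [mem_graph_perturb] at hxy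
    have h3 := h.2 _ _ hxy
    have h4 : (1 + S * R) (y - S x) = y := by
      change y - S x + S (R (y - S x)) = y
      rw [h3, sub_add_cancel]
    change R (Ring.inverse (1 + S * R) y) = x
    rw [← h4, isUnit_inverse_apply hU, h3]

theorem isBoundedInverse_res_perturb (hz : z ∉ spec A) (hU : IsUnit (1 + Y * res A z)) :
    IsBoundedInverse (shift (perturb A Y) z) (res A z * Ring.inverse (1 + Y * res A z)) := by
  rw [shift_perturb]
  exact (isBoundedInverse_res hz).perturb hU

/-- Intertwining the resolvents at a single point suffices: `(x, y)` is in the graph exactly when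
the resolvent maps `y - z x` to `x`, and the injective `S` carries this relation over. -/
theorem perturb_mem_graph_iff_mul (hz : z ∉ spec A) (hS : IsUnit S) {T' : H →ₗ.[ℂ] H}
    (hz' : z ∉ spec T') (h : S * res A z = res T' z * S) {x y : H} :
    (x, y) ∈ A.graph ↔ (S x, S y) ∈ T'.graph := by
  rw [mem_graph_iff_res hz, mem_graph_iff_res hz']
  have h1 : res T' z (S y - z • S x) = S (res A z (y - z • x)) := by
    rw [← map_smul, ← map_sub]
    exact (congrArg (fun L : H →L[ℂ] H => L (y - z • x)) h).symm
  have hinj : Function.Injective S := Function.LeftInverse.injective (isUnit_inverse_apply hS)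
  rw [h1, hinj.eq_iff]

section Complete

variable [CompleteSpace H]

/-- A Neumann series gives invertibility. The norm bound follows from the second resolvent identity
by absorbing the term that contains `‖Y‖`. -/
theorem notMem_spec_perturb {δ : ℝ} (hz : z ∉ spec A) (hb : ‖res A z‖ ≤ δ⁻¹) (hY : ‖Y‖ < δ) :
    z ∉ spec (perturb A Y) ∧ ‖res (perturb A Y) z‖ ≤ (δ - ‖Y‖)⁻¹ := by
  have hδ : 0 < δ := (norm_nonneg Y).trans_lt hY
  have h1 : ‖Y * res A z‖ < 1 := by
    refine (norm_mul_le _ _).trans_lt ?_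
    calc ‖Y‖ * ‖res A z‖ ≤ ‖Y‖ * δ⁻¹ := by gcongr
      _ < δ * δ⁻¹ := by gcongr
      _ = 1 := mul_inv_cancel₀ hδ.ne'
  have hU : IsUnit (1 + Y * res A z) := by
    rw [show (1 : H →L[ℂ] H) + Y * res A z = 1 - (-(Y * res A z)) by simp]
    exact isUnit_one_sub_of_norm_lt_one (by rwa [norm_neg])
  have hz' := (isBoundedInverse_res_perturb hz hU).notMem_spec
  refine ⟨hz', ?_⟩
  have h2 := res_perturb_sub_res_perturb (A := A) (X := Y) (Y := 0) hz' (by rwa [perturb_zero])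
  rw [perturb_zero, zero_sub, sub_eq_iff_eq_add] at h2
  have h3 : ‖res (perturb A Y) z‖ ≤ ‖res (perturb A Y) z‖ * ‖Y‖ * δ⁻¹ + δ⁻¹ := by
    conv_lhs => rw [h2]
    refine (norm_add_le _ _).trans (add_le_add ?_ hb)
    refine (norm_mul_le _ _).trans ?_
    refine mul_le_mul ((norm_mul_le _ _).trans (by rw [norm_neg])) hb (norm_nonneg _) (by positivity)
  rw [← one_div, le_div_iff₀ (sub_pos.2 hY)]
  have h4 := mul_le_mul_of_nonneg_right h3 hδ.le
  rw [add_mul, inv_mul_cancel_right₀ hδ.ne', inv_mul_cancel₀ hδ.ne'] at h4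
  linarith

/-- Near `z` the resolvent is an explicit expression in `Ring.inverse`, from which openness of the
resolvent set and holomorphy are read off. -/
theorem eventually_res_eq (hz : z ∉ spec A) :
    ∀ᶠ w in 𝓝 z, w ∉ spec A ∧
      res A w = res A z * Ring.inverse (1 + (-((w - z) • (1 : H →L[ℂ] H))) * res A z) := by
  have h1 : Tendsto (fun w : ℂ => 1 + (-((w - z) • (1 : H →L[ℂ] H))) * res A z) (𝓝 z) (𝓝 1) := by
    have : Continuous fun w : ℂ => 1 + (-((w - z) • (1 : H →L[ℂ] H))) * res A z := by fun_prop
    simpa using this.tendsto z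
  filter_upwards [h1 (Units.isOpen.mem_nhds isUnit_one)] with w hw
  have h2 := (isBoundedInverse_res hz).perturb (S := -((w - z) • (1 : H →L[ℂ] H))) hw
  rw [← shift_shift] at h2
  exact ⟨h2.notMem_spec, h2.res_eq⟩

theorem isOpen_compl_spec : IsOpen (spec A)ᶜ :=
  isOpen_iff_mem_nhds.2 fun _ hz => (eventually_res_eq hz).mono fun _ h => h.1

theorem differentiableAt_res (hz : z ∉ spec A) : DifferentiableAt ℂ (res A) z := by
  have h1 : DifferentiableAt ℂ
      (fun w => res A z * Ring.inverse (1 + (-((w - z) • (1 : H →L[ℂ] H))) * res A z)) z := by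
    refine DifferentiableAt.const_mul ?_ _
    have h2 : DifferentiableAt ℂ Ring.inverse
        (1 + (-((z - z) • (1 : H →L[ℂ] H))) * res A z) := by
      simpa using differentiableAt_inverse (𝕜 := ℂ) (R := H →L[ℂ] H) (isUnit_one)
    exact DifferentiableAt.comp (f := fun w => 1 + (-((w - z) • (1 : H →L[ℂ] H))) * res A z) z h2
      (by fun_prop)
  exact h1.congr_of_eventuallyEq ((eventually_res_eq hz).mono fun _ h => h.2)

theorem differentiableOn_res : DifferentiableOn ℂ (res A) (spec A)ᶜ :=
  fun _ hz => (differentiableAt_res hz).differentiableWithinAt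

/-- `(A + X)* = A + X*` for a selfadjoint `A`. -/
theorem adjoint_perturb (hA : IsSelfAdjoint A) :
    (perturb A X).adjoint = perturb A (ContinuousLinearMap.adjoint X) := by
  have hd : Dense (A.domain : Set H) := hA.dense_domain
  have hA' : A.adjoint = A := hA
  have hd' : Dense ((perturb A X).domain : Set H) := hd
  refine eq_of_graph_iff fun x y => ?_
  rw [mem_graph_perturb]
  conv_rhs => rw [← hA']
  rw [LinearPMap.adjoint_graph_eq_graph_adjoint hd', LinearPMap.adjoint_graph_eq_graph_adjoint hd,
    Submodule.mem_adjoint_iff, Submodule.mem_adjoint_iff]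
  have key : ∀ a b : H, ⟪b, x⟫_ℂ - ⟪a, y - ContinuousLinearMap.adjoint X x⟫_ℂ =
      ⟪b + X a, x⟫_ℂ - ⟪a, y⟫_ℂ := fun a b => by
    rw [inner_sub_right, ContinuousLinearMap.adjoint_inner_right, inner_add_left]
    ring
  refine ⟨fun h a b hab => ?_, fun h a b hab => ?_⟩
  · rw [key]
    exact h a _ (mem_graph_perturb.2 (by rwa [add_sub_cancel_right]))
  · have := h a _ (mem_graph_perturb.1 hab)
    rwa [key, sub_add_cancel] at this

theorem adjoint_shift (hA : IsSelfAdjoint A) :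
    (shift (perturb A X) z).adjoint =
      shift (perturb A (ContinuousLinearMap.adjoint X)) (conj z) := by
  rw [shift, perturb_perturb, adjoint_perturb hA, shift, perturb_perturb]
  congr 1
  simp only [map_add, map_neg, ← ContinuousLinearMap.star_eq_adjoint, star_smul, star_one]
  rfl

theorem IsBoundedInverse.adjoint (hT : Dense (T.domain : Set H)) (h : IsBoundedInverse T R) :
    IsBoundedInverse T.adjoint (ContinuousLinearMap.adjoint R) := by
  rw [isBoundedInverse_iff] at h ⊢
  simp only [LinearPMap.adjoint_graph_eq_graph_adjoint hT, Submodule.mem_adjoint_iff]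
  refine ⟨fun x a b hab => ?_, fun x y hxy => ?_⟩
  · rw [ContinuousLinearMap.adjoint_inner_right, h.2 a b hab, sub_self]
  · refine ext_inner_left ℂ fun v => ?_
    have := hxy _ _ (h.1 v)
    rw [ContinuousLinearMap.adjoint_inner_right]
    exact (sub_eq_zero.1 this).symm

theorem isBoundedInverse_adjoint_res (hA : IsSelfAdjoint A) (hz : z ∉ spec (perturb A X)) :
    IsBoundedInverse (shift (perturb A (ContinuousLinearMap.adjoint X)) (conj z))
      (ContinuousLinearMap.adjoint (res (perturb A X) z)) := by
  rw [← adjoint_shift hA]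
  exact (isBoundedInverse_res hz).adjoint hA.dense_domain

theorem notMem_spec_adjoint (hA : IsSelfAdjoint A) (hz : z ∉ spec (perturb A X)) :
    conj z ∉ spec (perturb A (ContinuousLinearMap.adjoint X)) :=
  (isBoundedInverse_adjoint_res hA hz).notMem_spec

theorem adjoint_res (hA : IsSelfAdjoint A) (hz : z ∉ spec (perturb A X)) :
    ContinuousLinearMap.adjoint (res (perturb A X) z) =
      res (perturb A (ContinuousLinearMap.adjoint X)) (conj z) :=
  (isBoundedInverse_adjoint_res hA hz).res_eq.symm

omit [CompleteSpace H] in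
theorem res_mul_comm (hz : z ∉ spec A) (hw : w ∉ spec A) :
    res A z * res A w = res A w * res A z := by
  rcases eq_or_ne z w with rfl | hne
  · rfl
  have h1 := res_sub_res hz hw
  have h2 := res_sub_res hw hz
  rw [← neg_sub, h1, ← neg_sub z w, neg_smul, neg_inj] at h2
  exact smul_right_injective _ (sub_ne_zero.2 hne) h2

omit [CompleteSpace H] in
-- The inverse comes from the scalar identity `(k - 1 / (s - z))⁻¹ = k⁻¹ + k⁻² / (s - z - k⁻¹)`.
theorem notMem_spectrum_res (hz : z ∉ spec A) {k : ℂ} (hk : k ≠ 0) (hw : z + k⁻¹ ∉ spec A) :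
    k ∉ spectrum ℂ (res A z) := by
  rw [spectrum.notMem_iff]
  have h1 := res_sub_res hz hw
  have h2 := res_mul_comm hz hw
  have h3 : (k • (1 : H →L[ℂ] H) - res A z) * (k⁻¹ • 1 + (k ^ 2)⁻¹ • res A (z + k⁻¹)) = 1 := by
    have : res A z * res A (z + k⁻¹) = -k • (res A z - res A (z + k⁻¹)) := by
      rw [h1, smul_smul]
      simp [hk]
    simp only [sub_mul, mul_add, smul_mul_assoc, mul_smul_comm, one_mul, mul_one, this, smul_smul,
      smul_sub, ← sub_eq_zero (b := (1 : H →L[ℂ] H))]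
    match_scalars <;> field_simp <;> ring
  have h4 : (k⁻¹ • 1 + (k ^ 2)⁻¹ • res A (z + k⁻¹)) * (k • (1 : H →L[ℂ] H) - res A z) = 1 := by
    refine Eq.trans ?_ h3
    have hc : Commute (res A z) (res A (z + k⁻¹)) := h2
    have h5 : Commute (k⁻¹ • 1 + (k ^ 2)⁻¹ • res A (z + k⁻¹)) (res A z) :=
      ((Commute.one_left _).smul_left k⁻¹).add_left (hc.symm.smul_left _)
    have h6 : Commute (k⁻¹ • 1 + (k ^ 2)⁻¹ • res A (z + k⁻¹)) (k • (1 : H →L[ℂ] H)) :=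
      (Commute.one_right _).smul_right k
    exact (h6.sub_right h5).eq
  rw [Algebra.algebraMap_eq_smul_one]
  exact ⟨⟨_, _, h3, h4⟩, rfl⟩

/-- The resolvent of a selfadjoint operator is bounded by the inverse distance to the spectrum. -/
theorem norm_res_le (hA : IsSelfAdjoint A) {δ : ℝ} (hδ : 0 < δ)
    (hd : ∀ s ∈ spec A, δ ≤ ‖z - s‖) : z ∉ spec A ∧ ‖res A z‖ ≤ δ⁻¹ := by
  have hz : z ∉ spec A := fun hz => by
    have := hd z hz
    simp at this
    linarith
  refine ⟨hz, ?_⟩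
  have hz0 : z ∉ spec (perturb A 0) := by rwa [perturb_zero]
  have hstar : star (res A z) = res A (conj z) := by
    have := adjoint_res hA hz0
    rwa [map_zero, perturb_zero] at this
  have hcz : conj z ∉ spec A := by
    have := notMem_spec_adjoint hA hz0
    rwa [map_zero, perturb_zero] at this
  -- The adjoint of the resolvent is the resolvent at the conjugate point, so the two commute. For a
  -- normal operator the norm is the spectral radius, which `notMem_spectrum_res` controls.
  have hn : IsStarNormal (res A z) := ⟨by
    rw [hstar]
    exact res_mul_comm hcz hz⟩
  have h1 := IsStarNormal.spectralRadius_eq_nnnorm (res A z)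
  have h2 : spectralRadius ℂ (res A z) ≤ ENNReal.ofReal δ⁻¹ := by
    refine iSup₂_le fun k hk => ?_
    rcases eq_or_ne k 0 with rfl | hk0
    · simp
    rw [← enorm_eq_nnnorm, ← ofReal_norm]
    refine ENNReal.ofReal_le_ofReal ?_
    have h3 : z + k⁻¹ ∈ spec A := by
      by_contra h
      exact notMem_spectrum_res hz hk0 h hk
    have h4 := hd _ h3
    simp only [sub_add_cancel_left, norm_neg, norm_inv] at h4
    exact (le_inv_comm₀ hδ (norm_pos_iff.2 hk0)).1 h4
  rw [h1, ← enorm_eq_nnnorm, ← ofReal_norm] at h2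
  exact (ENNReal.ofReal_le_ofReal_iff (by positivity)).1 h2

omit [CompleteSpace H] in
theorem dense_range_res (hd : Dense (A.domain : Set H)) (hz : z ∉ spec A) :
    DenseRange (res A z) := by
  refine hd.mono fun x hx => ?_
  exact ⟨_, res_apply_sub hz (LinearPMap.mem_graph A ⟨x, hx⟩)⟩

end Complete

end Resolvents

/-! ### Estimates for integrals over circles centred on the real axis -/

section RieszProjections

open scoped Real

theorem circleIntegral_swap {E : Type*} [NormedAddCommGroup E] [NormedSpace ℂ E]
    {c : ℂ} {ρ ρ' : ℝ} (hρ : 0 ≤ ρ) (hρ' : 0 ≤ ρ') {f : ℂ → ℂ → E}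
    (hf : ContinuousOn (Function.uncurry f) (Metric.sphere c ρ ×ˢ Metric.sphere c ρ')) :
    (∮ z in C(c, ρ), ∮ w in C(c, ρ'), f z w) = ∮ w in C(c, ρ'), ∮ z in C(c, ρ), f z w := by
  simp only [circleIntegral, intervalIntegral.integral_of_le Real.two_pi_pos.le, ← integral_smul]
  rw [integral_integral_swap]
  · exact integral_congr_ae (ae_of_all _ fun φ => integral_congr_ae (ae_of_all _ fun θ =>
      smul_comm _ _ _))
  · have hc : Continuous (Function.uncurry fun θ φ => deriv (circleMap c ρ) θ •
        deriv (circleMap c ρ') φ • f (circleMap c ρ θ) (circleMap c ρ' φ)) := by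
      have h1 : Continuous fun p : ℝ × ℝ => f (circleMap c ρ p.1) (circleMap c ρ' p.2) :=
        hf.comp_continuous (f := fun p : ℝ × ℝ => (circleMap c ρ p.1, circleMap c ρ' p.2))
          (by fun_prop) fun p =>
            ⟨circleMap_mem_sphere c hρ _, circleMap_mem_sphere c hρ' _⟩
      simp only [deriv_circleMap, Function.uncurry_def]
      exact (((continuous_circleMap 0 ρ).comp continuous_fst).mul continuous_const).smul
        ((((continuous_circleMap 0 ρ').comp continuous_snd).mul continuous_const).smul h1)
    rw [Measure.prod_restrict]
    exact (hc.continuousOn.integrableOn_compact (isCompact_Icc.prod isCompact_Icc)).mono_set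
      (prod_mono Ioc_subset_Icc_self Ioc_subset_Icc_self)

theorem circleIntegral_clm_apply {E F : Type*} [NormedAddCommGroup E] [NormedSpace ℂ E]
    [NormedAddCommGroup F] [NormedSpace ℂ F] [CompleteSpace E] [CompleteSpace F]
    (L : E →L[ℂ] F) {f : ℂ → E} {c : ℂ} {ρ : ℝ}
    (hf : CircleIntegrable f c ρ) : L (∮ z in C(c, ρ), f z) = ∮ z in C(c, ρ), L (f z) := by
  simp only [circleIntegral, ← L.map_smul]
  exact (L.intervalIntegral_comp_comm hf.out).symm

/-- The primitive is `(π / δ) arctan`, whose increments stay below `π ^ 2 / δ`. The point is that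
this bound does not depend on the radius `ρ`. -/
theorem integral_lorentzian_le {δ ρ : ℝ} (hδ : 0 < δ) (hρ : 0 < ρ) (s : ℝ) :
    ∫ θ in (0 : ℝ)..2 * π, ρ * (2 / δ ^ 2 * (1 + (2 * ρ / (π * δ) * (θ - s)) ^ 2)⁻¹) ≤
      π ^ 2 / δ := by
  have h1 : ∀ θ ∈ uIcc 0 (2 * π), HasDerivAt
      (fun θ => π / δ * Real.arctan (2 * ρ / (π * δ) * (θ - s)))
      (ρ * (2 / δ ^ 2 * (1 + (2 * ρ / (π * δ) * (θ - s)) ^ 2)⁻¹)) θ := fun θ _ => by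
    have h2 : HasDerivAt (fun θ => 2 * ρ / (π * δ) * (θ - s)) (2 * ρ / (π * δ)) θ := by
      simpa using ((hasDerivAt_id θ).sub_const s).const_mul (2 * ρ / (π * δ))
    refine ((h2.arctan).const_mul (π / δ)).congr_deriv ?_
    rw [one_div]
    generalize (1 + (2 * ρ / (π * δ) * (θ - s)) ^ 2)⁻¹ = y
    field_simp
  rw [intervalIntegral.integral_eq_sub_of_hasDerivAt h1]
  · have h2 := Real.arctan_lt_pi_div_two (2 * ρ / (π * δ) * (2 * π - s))
    have h3 := Real.neg_pi_div_two_lt_arctan (2 * ρ / (π * δ) * (0 - s))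
    have h4 : 0 < π / δ := by positivity
    calc _ = π / δ * (Real.arctan (2 * ρ / (π * δ) * (2 * π - s)) -
        Real.arctan (2 * ρ / (π * δ) * (0 - s))) := by ring
      _ ≤ π / δ * π := by
        refine mul_le_mul_of_nonneg_left ?_ h4.le
        linarith
      _ = π ^ 2 / δ := by ring
  · refine Continuous.intervalIntegrable ?_ _ _
    exact continuous_const.mul (continuous_const.mul
      (Continuous.inv₀ (by fun_prop) fun x => by positivity))

/-- Jordan's inequality `|sin x| ≥ (2 / π) |x|` for `|x| ≤ π / 2`, combined with the fact that the
square of the maximum dominates the mean of the two squares. -/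
theorem inv_max_sq_le {δ ρ θ s : ℝ} (hδ : 0 < δ) (hρ : 0 < ρ) (hs : |θ - s| ≤ π / 2)
    (hsin : |Real.sin θ| = |Real.sin (θ - s)|) :
    (max δ |ρ * Real.sin θ| ^ 2)⁻¹ ≤ 2 / δ ^ 2 * (1 + (2 * ρ / (π * δ) * (θ - s)) ^ 2)⁻¹ := by
  have h1 := Real.mul_abs_le_abs_sin hs
  rw [← hsin] at h1
  set m := max δ |ρ * Real.sin θ| with hm
  have hmδ : δ ≤ m := le_max_left _ _
  have hms : ρ * (2 / π * |θ - s|) ≤ m := by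
    refine le_trans ?_ (le_max_right _ _)
    rw [abs_mul, abs_of_pos hρ]
    gcongr
  have h2 : δ ^ 2 ≤ m ^ 2 := by gcongr
  have h3 : (ρ * (2 / π * |θ - s|)) ^ 2 ≤ m ^ 2 := by gcongr
  have h4 : 2 / δ ^ 2 * (1 + (2 * ρ / (π * δ) * (θ - s)) ^ 2)⁻¹ =
      2 / (δ ^ 2 + (ρ * (2 / π * |θ - s|)) ^ 2) := by
    rw [mul_pow ρ, mul_pow (2 / π), sq_abs]
    field_simp
  rw [h4, inv_eq_one_div, div_le_div_iff₀ (by positivity) (by positivity)]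
  linarith

/-- The circle meets the real axis only at the angles `0`, `π` and `2π`; near each of them one
Lorentzian dominates the integrand. -/
theorem integral_inv_max_sq_le {δ ρ : ℝ} (hδ : 0 < δ) (hρ : 0 < ρ) :
    ∫ θ in (0 : ℝ)..2 * π, ρ * (max δ |ρ * Real.sin θ| ^ 2)⁻¹ ≤ 3 * π ^ 2 / δ := by
  let g : ℝ → ℝ → ℝ := fun s θ => ρ * (2 / δ ^ 2 * (1 + (2 * ρ / (π * δ) * (θ - s)) ^ 2)⁻¹)
  have hg : ∀ s, Continuous (g s) := fun s => continuous_const.mul (continuous_const.mul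
      (Continuous.inv₀ (by fun_prop) fun x => by positivity))
  have hg0 : ∀ s θ, 0 ≤ g s θ := fun s θ => by positivity
  have hl : Continuous fun θ => ρ * (max δ |ρ * Real.sin θ| ^ 2)⁻¹ :=
    continuous_const.mul (Continuous.inv₀ (by fun_prop) fun x =>
      (pow_pos (hδ.trans_le (le_max_left _ _)) 2).ne')
  calc ∫ θ in (0 : ℝ)..2 * π, ρ * (max δ |ρ * Real.sin θ| ^ 2)⁻¹
      ≤ ∫ θ in (0 : ℝ)..2 * π, (g 0 θ + g π θ + g (2 * π) θ) := by
        refine intervalIntegral.integral_mono_on Real.two_pi_pos.le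
          (hl.intervalIntegrable _ _) (((hg _).add (hg _)).add (hg _) |>.intervalIntegrable _ _) ?_
        intro θ hθ
        have h0 := hg0 0 θ
        have h1 := hg0 π θ
        have h2 := hg0 (2 * π) θ
        rcases le_total θ (π / 2) with h | h
        · have : ρ * (max δ |ρ * Real.sin θ| ^ 2)⁻¹ ≤ g 0 θ :=
            mul_le_mul_of_nonneg_left (inv_max_sq_le hδ hρ
              (by rw [sub_zero, abs_of_nonneg hθ.1]; exact h) (by simp)) hρ.le
          linarith
        rcases le_total θ (3 * π / 2) with h' | h'
        · have : ρ * (max δ |ρ * Real.sin θ| ^ 2)⁻¹ ≤ g π θ :=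
            mul_le_mul_of_nonneg_left (inv_max_sq_le hδ hρ
              (by rw [abs_le]; constructor <;> linarith) (by simp [Real.sin_sub_pi])) hρ.le
          linarith
        · have : ρ * (max δ |ρ * Real.sin θ| ^ 2)⁻¹ ≤ g (2 * π) θ :=
            mul_le_mul_of_nonneg_left (inv_max_sq_le hδ hρ
              (by rw [abs_le]; constructor <;> linarith [hθ.2, Real.pi_pos])
              (by simp [Real.sin_sub_two_pi])) hρ.le
          linarith
    _ = (∫ θ in (0 : ℝ)..2 * π, g 0 θ) + (∫ θ in (0 : ℝ)..2 * π, g π θ) +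
        ∫ θ in (0 : ℝ)..2 * π, g (2 * π) θ := by
        rw [intervalIntegral.integral_add (f := fun θ => g 0 θ + g π θ)
          (((hg _).add (hg _)).intervalIntegrable _ _)
          ((hg _).intervalIntegrable _ _), intervalIntegral.integral_add
          ((hg _).intervalIntegrable _ _) ((hg _).intervalIntegrable _ _)]
    _ ≤ π ^ 2 / δ + π ^ 2 / δ + π ^ 2 / δ :=
        add_le_add (add_le_add (integral_lorentzian_le hδ hρ _) (integral_lorentzian_le hδ hρ _))
          (integral_lorentzian_le hδ hρ _)
    _ = 3 * π ^ 2 / δ := by ring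

/-- A bound for circle integrals of functions decaying away from the real axis. -/
theorem norm_circleIntegral_le {E : Type*} [NormedAddCommGroup E] [NormedSpace ℂ E]
    {f : ℂ → E} {c ρ δ C : ℝ} (hδ : 0 < δ) (hρ : 0 < ρ) (hC : 0 ≤ C)
    (hf : ∀ z ∈ Metric.sphere (c : ℂ) ρ, ‖f z‖ ≤ C * (max δ |z.im| ^ 2)⁻¹) :
    ‖(-(2 * π * Complex.I)⁻¹ : ℂ) • ∮ z in C((c : ℂ), ρ), f z‖ ≤ C * (2 * π / δ) := by
  have h1 : ‖∮ z in C((c : ℂ), ρ), f z‖ ≤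
      ∫ θ in (0 : ℝ)..2 * π, C * (ρ * (max δ |ρ * Real.sin θ| ^ 2)⁻¹) := by
    refine intervalIntegral.norm_integral_le_of_norm_le Real.two_pi_pos.le
      (Eventually.of_forall fun θ _ => ?_) (Continuous.intervalIntegrable ?_ _ _)
    · have h2 := hf _ (circleMap_mem_sphere (c : ℂ) hρ.le θ)
      have h3 : (circleMap (c : ℂ) ρ θ).im = ρ * Real.sin θ := by
        simp [circleMap, Complex.exp_im]
      rw [h3] at h2
      rw [norm_smul, deriv_circleMap, norm_mul, Complex.norm_I, mul_one, norm_circleMap_zero,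
        abs_of_pos hρ]
      calc _ ≤ ρ * (C * (max δ |ρ * Real.sin θ| ^ 2)⁻¹) := by gcongr
        _ = _ := by ring
    · exact continuous_const.mul (continuous_const.mul (Continuous.inv₀ (by fun_prop) fun x =>
        (pow_pos (hδ.trans_le (le_max_left _ _)) 2).ne'))
  rw [intervalIntegral.integral_const_mul] at h1
  rw [norm_smul, norm_neg, norm_inv, norm_mul, norm_mul, Complex.norm_I, mul_one, Complex.norm_real,
    Complex.norm_two, Real.norm_eq_abs, abs_of_pos Real.pi_pos]
  calc (2 * π)⁻¹ * ‖∮ z in C((c : ℂ), ρ), f z‖ ≤ (2 * π)⁻¹ * (C * (3 * π ^ 2 / δ)) := by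
        gcongr
        exact h1.trans (mul_le_mul_of_nonneg_left (integral_inv_max_sq_le hδ hρ) hC)
    _ = C * (3 / 2 * π / δ) := by field_simp
    _ ≤ C * (2 * π / δ) := by
        gcongr
        norm_num

end RieszProjections

/-! ### Riesz integrals for bounded perturbations of a selfadjoint operator -/

section RieszProjections

open scoped Real

variable {H : Type*} [NormedAddCommGroup H] [InnerProductSpace ℂ H] [CompleteSpace H]
variable {A T : H →ₗ.[ℂ] H} {Y : H →L[ℂ] H} {c ρ δ : ℝ}

/-- The Riesz integral of the resolvent of `T` over a circle. -/
def circleProj (T : H →ₗ.[ℂ] H) (c ρ : ℝ) : H →L[ℂ] H :=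
  (-(2 * π * Complex.I)⁻¹ : ℂ) • ∮ z in C((c : ℂ), ρ), res T z

theorem max_le_norm_sub {z s : ℂ} (hz : z ∈ Metric.sphere (c : ℂ) ρ) (hs : s.im = 0)
    (h : δ ≤ |‖s - c‖ - ρ|) : max δ |z.im| ≤ ‖z - s‖ := by
  refine max_le (h.trans ?_) ?_
  · rw [mem_sphere_iff_norm] at hz
    rw [← hz]
    refine (abs_norm_sub_norm_le _ _).trans ?_
    rw [sub_sub_sub_cancel_right, norm_sub_rev]
  · simpa [hs] using Complex.abs_im_le_norm (z - s)

/-- The resolvent of a bounded perturbation of a selfadjoint operator, on a circle centred at the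
real axis and crossing it away from the spectrum. -/
theorem res_perturb_on_sphere (hA : IsSelfAdjoint A) (hs : ∀ s ∈ spec A, s.im = 0)
    (hY : ‖Y‖ < δ) (hgap : ∀ s ∈ spec A, δ ≤ |‖s - c‖ - ρ|) {z : ℂ}
    (hz : z ∈ Metric.sphere (c : ℂ) ρ) :
    z ∉ spec (perturb A Y) ∧
      ‖res (perturb A Y) z‖ ≤ δ / (δ - ‖Y‖) * (max δ |z.im|)⁻¹ := by
  have hδ : 0 < δ := (norm_nonneg Y).trans_lt hY
  have hm : 0 < max δ |z.im| := hδ.trans_le (le_max_left _ _)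
  obtain ⟨h1, h2⟩ := norm_res_le hA hm fun s h => max_le_norm_sub hz (hs s h) (hgap s h)
  obtain ⟨h3, h4⟩ := notMem_spec_perturb h1 h2 (hY.trans_le (le_max_left _ _))
  refine ⟨h3, h4.trans ?_⟩
  have h5 : 0 < δ - ‖Y‖ := sub_pos.2 hY
  have h6 : δ ≤ max δ |z.im| := le_max_left _ _
  have h7 : 0 < max δ |z.im| - ‖Y‖ := by linarith
  rw [← div_eq_mul_inv, div_div, inv_eq_one_div, div_le_div_iff₀ h7 (by positivity)]
  nlinarith [norm_nonneg Y]

theorem res_on_sphere (hA : IsSelfAdjoint A) (hs : ∀ s ∈ spec A, s.im = 0)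
    (hδ : 0 < δ) (hgap : ∀ s ∈ spec A, δ ≤ |‖s - c‖ - ρ|) {z : ℂ}
    (hz : z ∈ Metric.sphere (c : ℂ) ρ) :
    z ∉ spec A ∧ ‖res A z‖ ≤ (max δ |z.im|)⁻¹ := by
  have h := res_perturb_on_sphere (Y := 0) hA hs (by simpa) hgap hz
  rw [perturb_zero, norm_zero, sub_zero, div_self hδ.ne', one_mul] at h
  exact h

theorem continuousOn_res {s : Set ℂ} (h : ∀ z ∈ s, z ∉ spec T) : ContinuousOn (res T) s :=
  fun z hz => (differentiableAt_res (h z hz)).continuousAt.continuousWithinAt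

theorem circleProj_apply (hρ : 0 ≤ ρ) (h : ∀ z ∈ Metric.sphere (c : ℂ) ρ, z ∉ spec T) (u : H) :
    circleProj T c ρ u = (-(2 * π * Complex.I)⁻¹ : ℂ) • ∮ z in C((c : ℂ), ρ), res T z u := by
  rw [circleProj, smul_apply]
  congr 1
  exact circleIntegral_clm_apply (ContinuousLinearMap.apply ℂ H u)
    ((continuousOn_res h).circleIntegrable hρ)

/-- Conjugation maps the circle to itself with reversed orientation, and this sign cancels against
the conjugation of `2πi`. -/
theorem adjoint_circleProj (hA : IsSelfAdjoint A) (hρ : 0 ≤ ρ)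
    (h : ∀ z ∈ Metric.sphere (c : ℂ) ρ, z ∉ spec A) :
    star (circleProj A c ρ) = circleProj A c ρ := by
  have h1 : star (∮ z in C((c : ℂ), ρ), res A z) = -∮ z in C((c : ℂ), ρ), res A z := by
    let f : ℝ → H →L[ℂ] H := fun θ => deriv (circleMap c ρ) θ • res A (circleMap c ρ θ)
    have h2 : ∀ θ, star (f θ) = -f (2 * π - θ) := fun θ => by
      have h3 : conj (circleMap c ρ θ) = circleMap c ρ (2 * π - θ) := by
        simp only [circleMap, map_add, map_mul, Complex.conj_ofReal, ← Complex.exp_conj,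
          Complex.conj_I]
        congr 2
        rw [Complex.ofReal_sub, sub_mul, Complex.exp_sub]
        push_cast
        rw [Complex.exp_two_pi_mul_I, one_div, ← Complex.exp_neg, mul_neg]
      have h3' : conj (circleMap 0 ρ θ) = circleMap 0 ρ (2 * π - θ) := by
        rw [← circleMap_sub_center c ρ θ, map_sub, h3, Complex.conj_ofReal, circleMap_sub_center]
      have h4 := adjoint_res (X := 0) hA (z := circleMap c ρ θ)
        (by rw [perturb_zero]; exact h _ (circleMap_mem_sphere _ hρ _))
      rw [map_zero, perturb_zero, h3] at h4
      simp only [f, star_smul, ContinuousLinearMap.star_eq_adjoint, h4, deriv_circleMap,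
        RCLike.star_def, map_mul, Complex.conj_I, h3', mul_neg, neg_smul]
    have h5 : star (∫ θ in (0 : ℝ)..2 * π, f θ) = ∫ θ in (0 : ℝ)..2 * π, star (f θ) := by
      have h6 : IntervalIntegrable f volume 0 (2 * π) :=
        ((continuousOn_res h).circleIntegrable hρ).out
      exact ((starL' ℝ (A := H →L[ℂ] H)).toContinuousLinearMap.intervalIntegral_comp_comm h6).symm
    have h7 := intervalIntegral.integral_comp_sub_left (a := 0) (b := 2 * π) f (2 * π)
    rw [sub_self, sub_zero] at h7
    simp only [circleIntegral]
    change star (∫ θ in (0 : ℝ)..2 * π, f θ) = -∫ θ in (0 : ℝ)..2 * π, f θ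
    rw [h5]
    simp only [h2]
    rw [intervalIntegral.integral_neg, h7]
  rw [circleProj, star_smul, h1, smul_neg, ← neg_smul]
  congr 1
  simp

theorem circleIntegral_inv_sub_of_lt {z : ℂ} {r : ℝ} (hr : 0 ≤ r) (h : r < ‖z - c‖) :
    ∮ w in C((c : ℂ), r), (w - z)⁻¹ = 0 := by
  refine Complex.circleIntegral_eq_zero_of_differentiable_on_off_countable hr countable_empty
    (ContinuousOn.inv₀ (by fun_prop) fun w hw h0 => ?_) fun w hw => ?_
  · rw [sub_eq_zero.1 h0, mem_closedBall_iff_norm] at hw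
    linarith
  · refine DifferentiableAt.inv (by fun_prop) fun h0 => ?_
    rw [sub_eq_zero.1 h0] at hw
    have := mem_ball_iff_norm.1 hw.1
    linarith

/-- The classical idempotency argument with two concentric circles: `(z - w)⁻¹` integrates to `-2πi`
over the outer circle in `w`, and to `0` over the inner circle in `z`. -/
theorem circleIntegral_mul_circleIntegral {𝔸 : Type*} [NormedRing 𝔸] [NormedAlgebra ℂ 𝔸]
    [CompleteSpace 𝔸] {f : ℂ → 𝔸} {ρ' : ℝ} (hρ : 0 ≤ ρ) (hlt : ρ < ρ')
    (hf : ContinuousOn f (Metric.sphere (c : ℂ) ρ))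
    (hf' : ContinuousOn f (Metric.sphere (c : ℂ) ρ'))
    (h : ∀ z ∈ Metric.sphere (c : ℂ) ρ, ∀ w ∈ Metric.sphere (c : ℂ) ρ',
      f z - f w = (z - w) • (f z * f w)) :
    (∮ z in C((c : ℂ), ρ), f z) * (∮ w in C((c : ℂ), ρ'), f w) =
      -(2 * π * Complex.I) • ∮ z in C((c : ℂ), ρ), f z := by
  have hρ' : 0 ≤ ρ' := hρ.trans hlt.le
  have hne : ∀ z ∈ Metric.sphere (c : ℂ) ρ, ∀ w ∈ Metric.sphere (c : ℂ) ρ', z - w ≠ 0 := by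
    intro z hz w hw h0
    rw [sub_eq_zero.1 h0, mem_sphere_iff_norm] at hz
    rw [mem_sphere_iff_norm] at hw
    linarith
  have hcR : ContinuousOn (fun p : ℂ × ℂ => (p.1 - p.2)⁻¹ • f p.2)
      (Metric.sphere (c : ℂ) ρ ×ˢ Metric.sphere (c : ℂ) ρ') :=
    (ContinuousOn.inv₀ (by fun_prop) fun p hp => hne _ hp.1 _ hp.2).smul
      (hf'.comp continuousOn_snd fun p hp => hp.2)
  have hmul : ∀ z, (∮ w in C((c : ℂ), ρ'), f z * f w) = f z * ∮ w in C((c : ℂ), ρ'), f w :=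
    fun z => (circleIntegral_clm_apply (ContinuousLinearMap.mul ℂ 𝔸 (f z))
      (hf'.circleIntegrable hρ')).symm
  have h2 : ∀ z ∈ Metric.sphere (c : ℂ) ρ, (∮ w in C((c : ℂ), ρ'), f z * f w) =
      -(2 * π * Complex.I) • f z - ∮ w in C((c : ℂ), ρ'), (z - w)⁻¹ • f w := by
    intro z hz
    have hci : ContinuousOn (fun w => (z - w)⁻¹) (Metric.sphere (c : ℂ) ρ') :=
      ContinuousOn.inv₀ (by fun_prop) fun w hw => hne _ hz _ hw
    have e1 : (∮ w in C((c : ℂ), ρ'), f z * f w) =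
        ∮ w in C((c : ℂ), ρ'), ((z - w)⁻¹ • f z - (z - w)⁻¹ • f w) := by
      refine circleIntegral.integral_congr hρ' fun w hw => ?_
      rw [← smul_sub, h z hz w hw, inv_smul_smul₀ (hne _ hz _ hw)]
    have e3 := circleIntegral.integral_sub (f := fun w => (z - w)⁻¹ • f z)
      (g := fun w => (z - w)⁻¹ • f w)
      (ContinuousOn.circleIntegrable hρ' (hci.smul continuousOn_const))
      (ContinuousOn.circleIntegrable hρ' (hci.smul hf'))
    have e2 : (∮ w in C((c : ℂ), ρ'), (z - w)⁻¹) = -(2 * π * Complex.I) := by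
      rw [← circleIntegral.integral_sub_inv_of_mem_ball (c := c) (w := z) (R := ρ')
        (by rw [mem_ball_iff_norm, mem_sphere_iff_norm.1 hz]; exact hlt)]
      rw [← neg_one_smul ℂ (∮ w in C((c : ℂ), ρ'), (w - z)⁻¹), ← circleIntegral.integral_smul]
      refine circleIntegral.integral_congr hρ' fun w hw => ?_
      change _ = (-1 : ℂ) • (w - z)⁻¹
      rw [neg_one_smul, ← inv_neg, neg_sub]
    rw [e1, e3, circleIntegral.integral_smul_const, e2]
  have h3 : (∮ z in C((c : ℂ), ρ), ∮ w in C((c : ℂ), ρ'), (z - w)⁻¹ • f w) = 0 := by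
    rw [circleIntegral_swap (f := fun z w => (z - w)⁻¹ • f w) hρ hρ' hcR]
    have e1 : EqOn (fun w => ∮ z in C((c : ℂ), ρ), (z - w)⁻¹ • f w) (fun _ => 0)
        (Metric.sphere (c : ℂ) ρ') := fun w hw => by
      change (∮ z in C((c : ℂ), ρ), (z - w)⁻¹ • f w) = 0
      rw [circleIntegral.integral_smul_const, circleIntegral_inv_sub_of_lt hρ, zero_smul]
      rw [mem_sphere_iff_norm.1 hw]
      exact hlt
    rw [circleIntegral.integral_congr hρ' e1]
    simp [circleIntegral]
  have h4 : (∮ z in C((c : ℂ), ρ), f z) * (∮ w in C((c : ℂ), ρ'), f w) =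
      ∮ z in C((c : ℂ), ρ), f z * ∮ w in C((c : ℂ), ρ'), f w :=
    circleIntegral_clm_apply ((ContinuousLinearMap.mul ℂ 𝔸).flip
      (∮ w in C((c : ℂ), ρ'), f w)) (hf.circleIntegrable hρ)
  have h5 : EqOn (fun z => ∮ w in C((c : ℂ), ρ'), (z - w)⁻¹ • f w)
      (fun z => -(2 * π * Complex.I) • f z - f z * ∮ w in C((c : ℂ), ρ'), f w)
      (Metric.sphere (c : ℂ) ρ) := fun z hz => by
    change _ = -(2 * π * Complex.I) • f z - f z * ∮ w in C((c : ℂ), ρ'), f w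
    rw [← hmul, h2 z hz, sub_sub_cancel]
  have hcc : ContinuousOn (fun z => ∮ w in C((c : ℂ), ρ'), (z - w)⁻¹ • f w)
      (Metric.sphere (c : ℂ) ρ) :=
    ContinuousOn.congr ((hf.const_smul _).sub (hf.mul continuousOn_const)) h5
  have h6 := circleIntegral.integral_sub (f := fun z => -(2 * π * Complex.I) • f z)
    (g := fun z => ∮ w in C((c : ℂ), ρ'), (z - w)⁻¹ • f w)
    (ContinuousOn.circleIntegrable hρ (hf.const_smul _)) (hcc.circleIntegrable hρ)
  rw [h4, ← circleIntegral.integral_smul, ← sub_zero (∮ z in C((c : ℂ), ρ), _ • f z), ← h3, ← h6]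
  refine circleIntegral.integral_congr hρ fun z hz => ?_
  rw [← hmul]
  exact h2 z hz

/-- For selfadjoint `A` the Riesz integral is an orthogonal projection. -/
theorem norm_circleProj_le_one (hA : IsSelfAdjoint A) (hs : ∀ s ∈ spec A, s.im = 0)
    (hρ : 0 < ρ) (hδ : 0 < δ) (hgap : ∀ s ∈ spec A, δ ≤ |‖s - c‖ - ρ|) :
    ‖circleProj A c ρ‖ ≤ 1 := by
  have hδ2 : 0 < δ / 2 := half_pos hδ
  -- Idempotency needs a second, larger circle in the resolvent set; half of the gap is spent on it.
  have hgap' : ∀ r, ρ ≤ r → r ≤ ρ + δ / 2 → ∀ s ∈ spec A, δ / 2 ≤ |‖s - c‖ - r| := by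
    intro r h1 h2 s hs
    have h3 := hgap s hs
    have h4 := abs_sub_abs_le_abs_sub (‖s - c‖ - ρ) (r - ρ)
    rw [abs_of_nonneg (sub_nonneg.2 h1), sub_sub_sub_cancel_right] at h4
    linarith
  have hreg : ∀ r, ρ ≤ r → r ≤ ρ + δ / 2 → ∀ z ∈ Metric.sphere (c : ℂ) r, z ∉ spec A :=
    fun r h1 h2 z hz => (res_on_sphere hA hs hδ2 (hgap' r h1 h2) hz).1
  set ρ' := ρ + δ / 2 with hρ'
  have hlt : ρ < ρ' := by linarith
  have hr1 := hreg ρ le_rfl hlt.le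
  have hr2 := hreg ρ' hlt.le le_rfl
  have hc1 := (continuousOn_res hr1).circleIntegrable hρ.le
  have hc2 := (continuousOn_res hr2).circleIntegrable (hρ.le.trans hlt.le)
  have hann : ∀ z ∈ Metric.closedBall (c : ℂ) ρ' \ Metric.ball (c : ℂ) ρ, z ∉ spec A := by
    intro z hz
    refine hreg ‖z - c‖ ?_ ?_ z (mem_sphere_iff_norm.2 rfl)
    · simpa [dist_eq_norm] using hz.2
    · simpa [dist_eq_norm] using hz.1
  have h1 : ∮ z in C((c : ℂ), ρ'), res A z = ∮ z in C((c : ℂ), ρ), res A z :=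
    Complex.circleIntegral_eq_of_differentiable_on_annulus_off_countable hρ hlt.le
      countable_empty (continuousOn_res hann) fun z hz => differentiableAt_res <|
        hann z ⟨Metric.ball_subset_closedBall hz.1.1, fun h => hz.1.2 (Metric.ball_subset_closedBall h)⟩
  have hP : circleProj A c ρ * circleProj A c ρ = circleProj A c ρ := by
    have h2 := circleIntegral_mul_circleIntegral hρ.le hlt (continuousOn_res hr1)
      (continuousOn_res hr2) fun z hz w hw => res_sub_res (hr1 z hz) (hr2 w hw)
    rw [h1] at h2
    rw [circleProj, smul_mul_smul_comm, h2, ← mul_smul, mul_assoc, neg_mul_neg,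
      inv_mul_cancel₀ Complex.two_pi_I_ne_zero, mul_one]
  exact IsStarProjection.norm_le _ ⟨hP, adjoint_circleProj hA hρ.le hr1⟩

/-- The difference from the orthogonal projection of `A` is the integral of a product of two
resolvents, and its quadratic decay off the real axis makes the bound independent of the circle. The
same estimate for a single resolvent would grow logarithmically with the radius. -/
theorem norm_circleProj_perturb_le (hA : IsSelfAdjoint A) (hs : ∀ s ∈ spec A, s.im = 0)
    (hρ : 0 < ρ) (hY : ‖Y‖ < δ) (hgap : ∀ s ∈ spec A, δ ≤ |‖s - c‖ - ρ|) :
    ‖circleProj (perturb A Y) c ρ‖ ≤ 1 + δ / (δ - ‖Y‖) * ‖Y‖ * (2 * π / δ) := by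
  have hδ : 0 < δ := (norm_nonneg Y).trans_lt hY
  have h5 : 0 < δ - ‖Y‖ := sub_pos.2 hY
  have h1 := fun z hz => res_perturb_on_sphere (z := z) hA hs hY hgap hz
  have h2 := fun z hz => res_on_sphere (z := z) hA hs hδ hgap hz
  have h3 : ‖circleProj (perturb A Y) c ρ - circleProj A c ρ‖ ≤
      δ / (δ - ‖Y‖) * ‖Y‖ * (2 * π / δ) := by
    rw [circleProj, circleProj, ← smul_sub, ← circleIntegral.integral_sub
      ((continuousOn_res fun z hz => (h1 z hz).1).circleIntegrable hρ.le)
      ((continuousOn_res fun z hz => (h2 z hz).1).circleIntegrable hρ.le)]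
    refine norm_circleIntegral_le hδ hρ (by positivity) fun z hz => ?_
    have h4 := res_perturb_sub_res_perturb (A := A) (X := Y) (Y := 0) (h1 z hz).1
      (by rw [perturb_zero]; exact (h2 z hz).1)
    rw [perturb_zero] at h4
    rw [h4]
    have hm : 0 < max δ |z.im| := hδ.trans_le (le_max_left _ _)
    calc _ ≤ ‖res (perturb A Y) z‖ * ‖0 - Y‖ * ‖res A z‖ :=
          (norm_mul_le _ _).trans (mul_le_mul_of_nonneg_right (norm_mul_le _ _) (norm_nonneg _))
      _ ≤ (δ / (δ - ‖Y‖) * (max δ |z.im|)⁻¹) * ‖Y‖ * (max δ |z.im|)⁻¹ := by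
          rw [zero_sub, norm_neg]
          gcongr
          · exact (h1 z hz).2
          · exact (h2 z hz).2
      _ = _ := by rw [sq, mul_inv]; ring
  calc _ = ‖circleProj A c ρ + (circleProj (perturb A Y) c ρ - circleProj A c ρ)‖ := by
        rw [add_sub_cancel]
    _ ≤ _ := (norm_add_le _ _).trans
        (add_le_add (norm_circleProj_le_one hA hs hρ hδ hgap) h3)

/-- The remainder carries `(z - z₀)⁻²`: one power yields the factor `1 / m`, the other supplies the
second inverse power of `max δ |z.im|`, so the radius-free estimate applies again. The number `m`
bounds `‖z‖` from below on the circle. -/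
theorem norm_circleProj_mul_sub_le (hA : IsSelfAdjoint A) (hs : ∀ s ∈ spec A, s.im = 0)
    (hY : ‖Y‖ < δ) (hgap : ∀ s ∈ spec A, δ ≤ |‖s - c‖ - ρ|) {z₀ : ℂ}
    (hz₀ : z₀ ∉ spec (perturb A Y)) {m : ℝ} (hm : m = ρ - |c|) (hδm : δ ≤ m)
    (hzm : 2 * ‖z₀‖ ≤ m) :
    ‖circleProj (perturb A Y) c ρ * (res (perturb A Y) z₀ * res (perturb A Y) z₀) -
      res (perturb A Y) z₀ * res (perturb A Y) z₀‖ ≤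
      4 * (δ / (δ - ‖Y‖)) / m * (2 * π / δ) := by
  have hδ : 0 < δ := (norm_nonneg Y).trans_lt hY
  have h5 : 0 < δ - ‖Y‖ := sub_pos.2 hY
  have hm0 : 0 < m := hδ.trans_le hδm
  have hρ : 0 < ρ := by have := abs_nonneg c; linarith
  have h1 := fun z hz => res_perturb_on_sphere (z := z) hA hs hY hgap hz
  set T := perturb A Y with hT
  set Q := res T z₀ with hQ
  have hzn : ∀ z ∈ Metric.sphere (c : ℂ) ρ, m ≤ ‖z‖ := fun z hz => by
    have h2 := norm_sub_le z (c : ℂ)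
    rw [mem_sphere_iff_norm.1 hz, Complex.norm_real, Real.norm_eq_abs] at h2
    linarith
  have hzz : ∀ z ∈ Metric.sphere (c : ℂ) ρ, ‖z‖ / 2 ≤ ‖z - z₀‖ := fun z hz => by
    have h2 := norm_sub_norm_le z z₀
    have h3 := hzn z hz
    linarith
  have hne : ∀ z ∈ Metric.sphere (c : ℂ) ρ, z - z₀ ≠ 0 := fun z hz => by
    rw [← norm_pos_iff]
    have := hzz z hz
    have := hzn z hz
    linarith
  have hball : z₀ ∈ Metric.ball (c : ℂ) ρ := by
    rw [mem_ball_iff_norm]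
    have h2 := norm_sub_le z₀ (c : ℂ)
    rw [Complex.norm_real, Real.norm_eq_abs] at h2
    linarith
  have hc : ContinuousOn (res T) (Metric.sphere (c : ℂ) ρ) :=
    continuousOn_res fun z hz => (h1 z hz).1
  have hi : ContinuousOn (fun z => (z - z₀)⁻¹) (Metric.sphere (c : ℂ) ρ) :=
    ContinuousOn.inv₀ (by fun_prop) hne
  have hi2 : ContinuousOn (fun z => (z - z₀)⁻¹ * (z - z₀)⁻¹) (Metric.sphere (c : ℂ) ρ) := hi.mul hi
  -- Partial fractions in `z`. After integration the second term vanishes because its pole is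
  -- double, and the third one reproduces `Q * Q`.
  have h2 : ∀ z ∈ Metric.sphere (c : ℂ) ρ, res T z * (Q * Q) =
      ((z - z₀)⁻¹ * (z - z₀)⁻¹) • res T z - ((z - z₀)⁻¹ * (z - z₀)⁻¹) • Q -
        (z - z₀)⁻¹ • (Q * Q) := fun z hz => by
    have e1 := res_sub_res (h1 z hz).1 hz₀
    have e2 : res T z * Q = (z - z₀)⁻¹ • (res T z - Q) := by
      rw [e1, inv_smul_smul₀ (hne z hz)]
    rw [← mul_assoc, e2, smul_mul_assoc, sub_mul, e2, smul_sub, ← mul_smul, smul_sub]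
  have e1 : (∮ z in C((c : ℂ), ρ), res T z * (Q * Q)) =
      (∮ z in C((c : ℂ), ρ), ((z - z₀)⁻¹ * (z - z₀)⁻¹) • res T z) -
        (∮ z in C((c : ℂ), ρ), ((z - z₀)⁻¹ * (z - z₀)⁻¹)) • Q -
        (∮ z in C((c : ℂ), ρ), (z - z₀)⁻¹) • (Q * Q) := by
    rw [circleIntegral.integral_congr hρ.le h2]
    have i1 := ContinuousOn.circleIntegrable hρ.le (hi2.smul hc)
    have i2 := ContinuousOn.circleIntegrable (f := fun z => ((z - z₀)⁻¹ * (z - z₀)⁻¹) • Q) hρ.le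
      (hi2.smul continuousOn_const)
    have i3 := ContinuousOn.circleIntegrable (f := fun z => (z - z₀)⁻¹ • (Q * Q)) hρ.le
      (hi.smul continuousOn_const)
    have s1 := circleIntegral.integral_sub i1 i2
    have s2 := circleIntegral.integral_sub (f := fun z => ((z - z₀)⁻¹ * (z - z₀)⁻¹) • res T z -
      ((z - z₀)⁻¹ * (z - z₀)⁻¹) • Q) (g := fun z => (z - z₀)⁻¹ • (Q * Q)) (i1.sub i2) i3
    rw [s2, ← circleIntegral.integral_smul_const, ← circleIntegral.integral_smul_const]
    exact congrArg (· - _) s1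
  have e2 : (∮ z in C((c : ℂ), ρ), ((z - z₀)⁻¹ * (z - z₀)⁻¹)) = 0 := by
    have := circleIntegral.integral_sub_zpow_of_ne (n := -2) (by norm_num) (c : ℂ) z₀ ρ
    rw [← this]
    refine circleIntegral.integral_congr hρ.le fun z hz => ?_
    rw [zpow_neg, ← mul_inv]
    norm_cast
    rw [sq]
  rw [e2, circleIntegral.integral_sub_inv_of_mem_ball hball, zero_smul, sub_zero] at e1
  have e3 : circleProj T c ρ * (Q * Q) =
      (-(2 * π * Complex.I)⁻¹ : ℂ) • ∮ z in C((c : ℂ), ρ), res T z * (Q * Q) := by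
    rw [circleProj, smul_mul_assoc]
    congr 1
    exact circleIntegral_clm_apply ((ContinuousLinearMap.mul ℂ (H →L[ℂ] H)).flip (Q * Q))
      (hc.circleIntegrable hρ.le)
  rw [e3, e1, smul_sub, ← mul_smul, neg_mul, inv_mul_cancel₀ Complex.two_pi_I_ne_zero, neg_one_smul,
    sub_neg_eq_add, add_sub_cancel_right]
  refine norm_circleIntegral_le hδ hρ (by positivity) fun z hz => ?_
  set q := max δ |z.im| with hq
  have hq0 : 0 < q := hδ.trans_le (le_max_left _ _)
  have hqz : q ≤ ‖z‖ := max_le (hδm.trans (hzn z hz)) (Complex.abs_im_le_norm z)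
  have h6 : q * m / 4 ≤ ‖z - z₀‖ ^ 2 := by
    have := hzz z hz
    have := hzn z hz
    calc q * m / 4 ≤ ‖z‖ * ‖z‖ / 4 := by gcongr
      _ = (‖z‖ / 2) ^ 2 := by ring
      _ ≤ _ := by gcongr
  rw [← mul_inv, ← sq, norm_smul, norm_inv, norm_pow]
  calc (‖z - z₀‖ ^ 2)⁻¹ * ‖res T z‖ ≤ (q * m / 4)⁻¹ * (δ / (δ - ‖Y‖) * q⁻¹) := by
        gcongr
        exact (h1 z hz).2
    _ = _ := by
        field_simp

/-- A uniform bound together with convergence on a dense set, here the range of the squared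
resolvent at one nonreal point. -/
theorem tendsto_circleProj (hA : IsSelfAdjoint A) (hs : ∀ s ∈ spec A, s.im = 0)
    (hY : ‖Y‖ < δ) {a b : ℕ → ℝ} (ha : Tendsto a atTop atBot) (hb : Tendsto b atTop atTop)
    (hgap : ∀ k, ∀ s ∈ spec A, δ ≤ |‖s - ((a k + b k) / 2 : ℝ)‖ - (b k - a k) / 2|) (u : H) :
    Tendsto (fun k => circleProj (perturb A Y) ((a k + b k) / 2) ((b k - a k) / 2) u) atTop
      (𝓝 u) := by
  have hδ : 0 < δ := (norm_nonneg Y).trans_lt hY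
  have h5 : 0 < δ - ‖Y‖ := sub_pos.2 hY
  set T := perturb A Y with hT
  set P : ℕ → H →L[ℂ] H := fun k => circleProj T ((a k + b k) / 2) ((b k - a k) / 2) with hP
  set z₀ : ℂ := ((‖Y‖ + 1 : ℝ) : ℂ) * Complex.I with hz₀def
  have hz₀ : z₀ ∉ spec T := by
    have h1 : 0 < ‖Y‖ + 1 := by positivity
    obtain ⟨h2, h3⟩ := norm_res_le (z := z₀) hA h1 fun s h => by
      have h4 := Complex.abs_im_le_norm (z₀ - s)
      rw [Complex.sub_im, hs s h, sub_zero, hz₀def, Complex.im_ofReal_mul, Complex.I_im, mul_one,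
        abs_of_pos h1] at h4
      exact h4
    exact (notMem_spec_perturb h2 h3 (lt_add_one _)).1
  set Q := res T z₀ with hQ
  have hdense : DenseRange (Q * Q) := by
    have h1 : DenseRange Q := dense_range_res (A := T) hA.dense_domain hz₀
    exact h1.comp h1 Q.continuous
  have hmt : Tendsto (fun k => (b k - a k) / 2 - |(a k + b k) / 2|) atTop atTop := by
    -- The circle has the diameter `[a k, b k]`, so radius minus modulus of the centre is `min (-a
    -- k) (b k)`, which tends to infinity.
    have h1 : ∀ k, (b k - a k) / 2 - |(a k + b k) / 2| = min (-a k) (b k) := fun k => by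
      rcases le_total 0 (a k + b k) with h | h
      · rw [abs_of_nonneg (by linarith), min_eq_left (by linarith)]
        ring
      · rw [abs_of_nonpos (by linarith), min_eq_right (by linarith)]
        ring
    simp only [h1]
    refine tendsto_atTop.2 fun r => ?_
    filter_upwards [(tendsto_neg_atBot_atTop.comp ha).eventually_ge_atTop r,
      hb.eventually_ge_atTop r] with k h2 h3 using le_min h2 h3
  have hev : ∀ᶠ k in atTop, max δ (2 * ‖z₀‖) ≤ (b k - a k) / 2 - |(a k + b k) / 2| :=
    hmt.eventually_ge_atTop _
  have hbd : ∀ᶠ k in atTop, ‖P k‖ ≤ 1 + δ / (δ - ‖Y‖) * ‖Y‖ * (2 * π / δ) := by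
    filter_upwards [hev] with k hk
    refine norm_circleProj_perturb_le hA hs ?_ hY (hgap k)
    have := abs_nonneg ((a k + b k) / 2)
    have := (le_max_left _ _).trans hk
    linarith
  set C := 1 + δ / (δ - ‖Y‖) * ‖Y‖ * (2 * π / δ) with hC
  have hC0 : 0 < C := by positivity
  have hlim : Tendsto (fun k => P k * (Q * Q) - Q * Q) atTop (𝓝 0) := by
    refine squeeze_zero_norm' (a := fun k => 4 * (δ / (δ - ‖Y‖)) /
      ((b k - a k) / 2 - |(a k + b k) / 2|) * (2 * π / δ)) ?_ ?_
    · filter_upwards [hev] with k hk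
      exact norm_circleProj_mul_sub_le hA hs hY (hgap k) hz₀ rfl ((le_max_left _ _).trans hk)
        ((le_max_right _ _).trans hk)
    · simpa using (Tendsto.const_div_atTop hmt (4 * (δ / (δ - ‖Y‖)))).mul_const (2 * π / δ)
  rw [Metric.tendsto_atTop']
  intro ε hε
  obtain ⟨w, hw⟩ := hdense.exists_dist_lt u (show 0 < ε / (2 * (C + 1)) by positivity)
  have h1 : Tendsto (fun k => (P k * (Q * Q) - Q * Q) w) atTop (𝓝 0) := by
    have h2 := ((ContinuousLinearMap.apply ℂ H w).continuous.tendsto 0).comp hlim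
    rw [map_zero] at h2
    exact h2
  obtain ⟨N, hN⟩ := eventually_atTop.1 (hbd.and ((Metric.tendsto_nhds.1 h1) (ε / 2) (half_pos hε)))
  refine ⟨N, fun k hk => ?_⟩
  obtain ⟨h2, h3⟩ := hN k hk.le
  rw [dist_zero_right] at h3
  rw [dist_eq_norm] at hw ⊢
  have e : P k u - u = P k (u - (Q * Q) w) - (u - (Q * Q) w) + (P k * (Q * Q) - Q * Q) w := by
    rw [map_sub, sub_apply]
    change _ = _ + (P k ((Q * Q) w) - _)
    abel
  change ‖P k u - u‖ < ε
  rw [e]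
  calc _ ≤ ‖P k (u - (Q * Q) w)‖ + ‖u - (Q * Q) w‖ + ‖(P k * (Q * Q) - Q * Q) w‖ :=
        (norm_add_le _ _).trans (add_le_add_left (norm_sub_le _ _) _)
    _ ≤ C * (ε / (2 * (C + 1))) + ε / (2 * (C + 1)) + ‖(P k * (Q * Q) - Q * Q) w‖ := by
        gcongr
        exact ((P k).le_opNorm _).trans (by gcongr)
    _ = ε / 2 + ‖(P k * (Q * Q) - Q * Q) w‖ := by
        congr 1
        field_simp
    _ < ε := by linarith

end RieszProjections

/-! ### The interval, the domains `D^l` and curves of finite variation -/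

namespace Model

variable {H₀ H₁ : Type*} [NormedAddCommGroup H₀] [InnerProductSpace ℂ H₀] [CompleteSpace H₀]
  [NormedAddCommGroup H₁] [InnerProductSpace ℂ H₁] [CompleteSpace H₁]
variable (M : Model H₀ H₁) {l : ℤˣ} {Γ Γ' : ℝ → ℂ}

theorem spec_im {s : ℂ} (hs : s ∈ spec M.A₁) : s.im = 0 := by
  obtain ⟨x, -, rfl⟩ := M.spec₁ hs
  exact Complex.ofReal_im x

theorem conj_spec {s : ℂ} (hs : s ∈ spec M.A₁) : conj s = s :=
  Complex.conj_eq_iff_im.2 (M.spec_im hs)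

theorem isOpen_J : IsOpen M.J :=
  (isOpen_lt continuous_const continuous_coe_real_ereal).inter
    (isOpen_lt continuous_coe_real_ereal continuous_const)

theorem ordConnected_J : OrdConnected M.J :=
  ⟨fun _ hx _ hy _ hz => ⟨hx.1.trans_le (EReal.coe_le_coe_iff.2 hz.1),
    (EReal.coe_le_coe_iff.2 hz.2).trans_lt hy.2⟩⟩

theorem exists_seq_left : ∃ u : ℕ → ℝ, (∀ n, u n ∈ M.J) ∧ ∀ x ∈ M.J, ∀ᶠ n in atTop, u n < x := by
  obtain ⟨u, -, h1, h2⟩ := exists_seq_strictAnti_tendsto' M.a_lt_b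
  have h3 : ∀ n, ((u n).toReal : EReal) = u n := fun n =>
    EReal.coe_toReal ((h1 n).2.trans_le le_top).ne (bot_le.trans_lt (h1 n).1).ne'
  refine ⟨fun n => (u n).toReal, fun n => ?_, fun x hx => ?_⟩
  · change M.a < ((u n).toReal : EReal) ∧ ((u n).toReal : EReal) < M.b
    rw [h3]
    exact h1 n
  · filter_upwards [h2.eventually_lt_const hx.1] with n hn
    rw [← EReal.coe_lt_coe_iff, h3]
    exact hn

theorem exists_seq_right : ∃ u : ℕ → ℝ, (∀ n, u n ∈ M.J) ∧ ∀ x ∈ M.J, ∀ᶠ n in atTop, x < u n := by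
  obtain ⟨u, -, h1, h2⟩ := exists_seq_strictMono_tendsto' M.a_lt_b
  have h3 : ∀ n, ((u n).toReal : EReal) = u n := fun n =>
    EReal.coe_toReal ((h1 n).2.trans_le le_top).ne (bot_le.trans_lt (h1 n).1).ne'
  refine ⟨fun n => (u n).toReal, fun n => ?_, fun x hx => ?_⟩
  · change M.a < ((u n).toReal : EReal) ∧ ((u n).toReal : EReal) < M.b
    rw [h3]
    exact h1 n
  · filter_upwards [h2.eventually_const_lt hx.2] with n hn
    rw [← EReal.coe_lt_coe_iff, h3]
    exact hn

theorem D_neg_one : M.D (-1) = M.Dm := if_pos rfl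

theorem D_one : M.D 1 = {z | conj z ∈ M.Dm} := if_neg (by decide)

theorem conj_mem_D {z : ℂ} : conj z ∈ M.D (-l) ↔ z ∈ M.D l := by
  rcases Int.units_eq_one_or l with rfl | rfl
  · rw [D_neg_one, D_one, mem_ofPred_eq]
  · rw [neg_neg, D_neg_one, D_one, mem_ofPred_eq, Complex.conj_conj]

theorem im_of_mem_D {z : ℂ} (hz : z ∈ M.D l) : 0 < ((l : ℤ) : ℝ) * z.im := by
  rcases Int.units_eq_one_or l with rfl | rfl
  · rw [D_one] at hz
    have := M.Dm_subset hz
    simpa using this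
  · rw [D_neg_one] at hz
    have := M.Dm_subset hz
    simpa using this

theorem im_ne_zero {z : ℂ} (hz : z ∈ M.D l) : z.im ≠ 0 := fun h => by
  have := M.im_of_mem_D hz
  rw [h, mul_zero] at this
  exact this.false

theorem isOpen_D : IsOpen (M.D l) := by
  rcases Int.units_eq_one_or l with rfl | rfl
  · rw [D_one]
    exact M.isOpen_Dm.preimage Complex.continuous_conj
  · rw [D_neg_one]
    exact M.isOpen_Dm

theorem isSimplyConnected_D : IsSimplyConnected (M.D l) := by
  rcases Int.units_eq_one_or l with rfl | rfl
  · rw [D_one]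
    exact (Complex.conjCLE.toHomeomorph.isSimplyConnected_preimage).2 M.isSimplyConnected_Dm
  · rw [D_neg_one]
    exact M.isSimplyConnected_Dm

theorem K'_conj {z : ℂ} (hz : z.im ≠ 0) : M.K' (conj z) = star (M.K' z) := by
  rcases hz.lt_or_gt with h | h
  · rw [K', if_pos (by simpa), Complex.conj_conj, K', if_neg h.le.not_gt]
    rfl
  · rw [K', if_neg (by simpa using h.le), K', if_pos h, ← ContinuousLinearMap.star_eq_adjoint,
      star_star]

theorem differentiableOn_K' : DifferentiableOn ℂ M.K' (M.D l) := by
  have h1 : DifferentiableOn ℂ M.K' (M.D (-1)) := by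
    rw [D_neg_one]
    refine M.differentiableOn_Dm.congr fun z hz => ?_
    rw [K', if_neg (le_of_lt (M.Dm_subset hz)).not_gt]
  rcases Int.units_eq_one_or l with rfl | rfl
  · intro z hz
    have h2 : conj z ∈ M.D (-1) := M.conj_mem_D.2 hz
    have h3 := (h1.differentiableAt (M.isOpen_D.mem_nhds h2)).star_conj
    rw [Complex.conj_conj] at h3
    refine (h3.congr_of_eventuallyEq ?_).differentiableWithinAt
    filter_upwards [M.isOpen_D.mem_nhds hz] with w hw
    simp only [Function.comp_apply]
    rw [M.K'_conj (M.im_ne_zero hw), star_star]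
  · exact h1

/-- `Γ` is a locally Lipschitz curve in `D^l` with finite variation of `K_B`. -/
structure IsPath (l : ℤˣ) (Γ : ℝ → ℂ) : Prop where
  locallyLipschitzOn : LocallyLipschitzOn M.J Γ
  mapsTo : MapsTo Γ M.J (M.D l)
  finite_variation : IntegrableOn (fun x => ‖deriv Γ x‖ * ‖M.K' (Γ x)‖) M.J

variable {M}

theorem IsContour.isPath (h : M.IsContour l Γ) : M.IsPath l Γ :=
  ⟨h.locallyLipschitzOn, h.mapsTo, h.finite_variation⟩

theorem deriv_conj (Γ : ℝ → ℂ) (x : ℝ) : deriv (fun x => conj (Γ x)) x = conj (deriv Γ x) :=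
  deriv.star

theorem norm_K'_conj {z : ℂ} (hz : z.im ≠ 0) : ‖M.K' (conj z)‖ = ‖M.K' z‖ := by
  rw [M.K'_conj hz, norm_star]

theorem IsPath.im_ne_zero (h : M.IsPath l Γ) {x : ℝ} (hx : x ∈ M.J) : (Γ x).im ≠ 0 :=
  M.im_ne_zero (h.mapsTo hx)

theorem IsPath.norm_deriv_conj (h : M.IsPath l Γ) {x : ℝ} (hx : x ∈ M.J) :
    ‖deriv (fun x => conj (Γ x)) x‖ * ‖M.K' (conj (Γ x))‖ = ‖deriv Γ x‖ * ‖M.K' (Γ x)‖ := by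
  rw [deriv_conj, RCLike.norm_conj, norm_K'_conj (h.im_ne_zero hx)]

theorem IsPath.conj (h : M.IsPath l Γ) : M.IsPath (-l) fun x => conj (Γ x) where
  locallyLipschitzOn := fun x hx => by
    obtain ⟨K, t, ht, hK⟩ := h.locallyLipschitzOn hx
    refine ⟨K, t, ht, fun y hy z hz => ?_⟩
    exact (Complex.conjLIE.edist_map _ _).trans_le (hK hy hz)
  mapsTo := fun x hx => M.conj_mem_D.2 (h.mapsTo hx)
  finite_variation := h.finite_variation.congr_fun
    (fun x hx => (h.norm_deriv_conj hx).symm) M.isOpen_J.measurableSet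

theorem IsPath.variation_conj (h : M.IsPath l Γ) :
    M.variation (fun x => conj (Γ x)) = M.variation Γ :=
  setIntegral_congr_fun M.isOpen_J.measurableSet fun _ hx => h.norm_deriv_conj hx

theorem dist_conj_spec {s : ℂ} (hs : s ∈ spec M.A₁) (z : ℂ) : dist (conj z) s = dist z s := by
  rw [← M.conj_spec hs, ← Complex.conjLIE_apply, ← Complex.conjLIE_apply,
    Complex.conjLIE.dist_map, Complex.conjLIE_apply, M.conj_spec hs]

theorem d₀_conj (Γ : ℝ → ℂ) : M.d₀ (fun x => conj (Γ x)) = M.d₀ Γ := by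
  have : image2 dist (spec M.A₁) ((fun x => conj (Γ x)) '' M.J) =
      image2 dist (spec M.A₁) (Γ '' M.J) := by
    rw [image2_image_right, image2_image_right]
    exact image2_congr fun s hs x _ => by rw [dist_comm, dist_conj_spec hs, dist_comm]
  rw [d₀, this, d₀]

theorem variation_nonneg : 0 ≤ M.variation Γ :=
  integral_nonneg fun _ => by positivity

theorem d₀_le {s : ℂ} (hs : s ∈ spec M.A₁) {x : ℝ} (hx : x ∈ M.J) : M.d₀ Γ ≤ dist (Γ x) s := by
  refine csInf_le ⟨0, ?_⟩ ⟨s, hs, Γ x, mem_image_of_mem _ hx, dist_comm _ _⟩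
  rintro _ ⟨_, _, _, _, rfl⟩
  exact dist_nonneg

theorem IsSmall.d₀_pos (h : M.IsSmall Γ) : 0 < M.d₀ Γ := by
  have h1 : 0 ≤ M.d₀ Γ := by
    refine Real.sInf_nonneg ?_
    rintro _ ⟨_, _, _, _, rfl⟩
    exact dist_nonneg
  refine h1.lt_of_ne fun h2 => ?_
  have h3 := variation_nonneg.trans_lt h
  rw [← h2] at h3
  norm_num at h3

theorem IsSmall.spec_nonempty (h : M.IsSmall Γ) : (spec M.A₁).Nonempty := by
  by_contra h1
  have h2 := h.d₀_pos
  -- With the convention `sInf ∅ = 0`, an empty spectrum would give `d₀ = 0`.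
  rw [d₀, not_nonempty_iff_eq_empty.1 h1, image2_empty_left, Real.sInf_empty] at h2
  exact h2.false

theorem IsSmall.conj (h : M.IsPath l Γ) (hs : M.IsSmall Γ) : M.IsSmall fun x => conj (Γ x) := by
  rw [IsSmall, h.variation_conj, d₀_conj]
  exact hs

theorem IsSmall.rmin_lt (h : M.IsSmall Γ) : M.rmin Γ < M.d₀ Γ / 2 := by
  have h1 : 0 < √(M.d₀ Γ ^ 2 / 4 - M.variation Γ) := Real.sqrt_pos.2 (sub_pos.2 h)
  rw [rmin]
  linarith

theorem IsSolution.norm_lt (h : M.IsSmall Γ) {X : H₁ →L[ℂ] H₁} (hX : M.IsSolution Γ X) :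
    ‖X‖ < M.d₀ Γ / 2 :=
  hX.1.trans_lt h.rmin_lt

theorem notMem_spec_of_le (hΓ : 0 < M.d₀ Γ) {Y : H₁ →L[ℂ] H₁} (hY : ‖Y‖ < M.d₀ Γ) {x : ℝ}
    (hx : x ∈ M.J) : Γ x ∉ spec (perturb M.A₁ Y) ∧
      ‖res (perturb M.A₁ Y) (Γ x)‖ ≤ (M.d₀ Γ - ‖Y‖)⁻¹ := by
  obtain ⟨h1, h2⟩ := norm_res_le M.isSelfAdjoint₁ hΓ (z := Γ x) fun s hs => by
    rw [← dist_eq_norm]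
    exact d₀_le hs hx
  exact notMem_spec_perturb h1 h2 hY

theorem IsPath.continuousOn (h : M.IsPath l Γ) : ContinuousOn Γ M.J :=
  h.locallyLipschitzOn.continuousOn

theorem IsPath.continuousOn_K' (h : M.IsPath l Γ) : ContinuousOn (fun x => M.K' (Γ x)) M.J :=
  M.differentiableOn_K'.continuousOn.comp h.continuousOn h.mapsTo

theorem IsPath.continuousOn_res (h : M.IsPath l Γ) (hΓ : 0 < M.d₀ Γ) {Y : H₁ →L[ℂ] H₁}
    (hY : ‖Y‖ < M.d₀ Γ) : ContinuousOn (fun x => res (perturb M.A₁ Y) (Γ x)) M.J :=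
  (differentiableOn_res.continuousOn).comp h.continuousOn
    fun _ hx => (notMem_spec_of_le hΓ hY hx).1

section Integrals

variable {E : Type*} [NormedAddCommGroup E] [NormedSpace ℂ E]

theorem IsPath.integrableOn (h : M.IsPath l Γ) {F : ℂ → E}
    (hF : ContinuousOn (fun x => F (Γ x)) M.J) {C : ℝ}
    (hC : ∀ x ∈ M.J, ‖F (Γ x)‖ ≤ C * ‖M.K' (Γ x)‖) :
    IntegrableOn (fun x => deriv Γ x • F (Γ x)) M.J := by
  refine Integrable.mono' (h.finite_variation.const_mul C) ?_ ?_
  · exact (measurable_deriv Γ).aestronglyMeasurable.smul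
      (hF.aestronglyMeasurable M.isOpen_J.measurableSet)
  · filter_upwards [ae_restrict_mem M.isOpen_J.measurableSet] with x hx
    rw [norm_smul]
    calc _ ≤ ‖deriv Γ x‖ * (C * ‖M.K' (Γ x)‖) := by gcongr; exact hC x hx
      _ = _ := by ring

theorem IsPath.norm_integral_le (h : M.IsPath l Γ) {F : ℂ → E} {C : ℝ}
    (hC : ∀ x ∈ M.J, ‖F (Γ x)‖ ≤ C * ‖M.K' (Γ x)‖) :
    ‖M.integral Γ F‖ ≤ C * M.variation Γ := by
  rw [variation, ← integral_const_mul]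
  refine norm_integral_le_of_norm_le (h.finite_variation.const_mul C) ?_
  filter_upwards [ae_restrict_mem M.isOpen_J.measurableSet] with x hx
  rw [norm_smul]
  calc _ ≤ ‖deriv Γ x‖ * (C * ‖M.K' (Γ x)‖) := by gcongr; exact hC x hx
    _ = _ := by ring

theorem star_integral (F : ℂ → H₁ →L[ℂ] H₁) :
    star (M.integral Γ F) = M.integral (fun x => conj (Γ x)) fun μ => star (F (conj μ)) := by
  have h1 := (starL' ℝ (A := H₁ →L[ℂ] H₁)).integral_comp_comm (μ := volume.restrict M.J)
    fun x => deriv Γ x • F (Γ x)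
  change (∫ x in M.J, star (deriv Γ x • F (Γ x))) = star (M.integral Γ F) at h1
  rw [← h1]
  simp only [integral, deriv_conj, Complex.conj_conj, star_smul, RCLike.star_def]

end Integrals

end Model

/-! ### Exchange of contours for holomorphic integrands -/

namespace Model

variable {H₀ H₁ : Type*} [NormedAddCommGroup H₀] [InnerProductSpace ℂ H₀] [CompleteSpace H₀]
  [NormedAddCommGroup H₁] [InnerProductSpace ℂ H₁] [CompleteSpace H₁]
variable {M : Model H₀ H₁} {l : ℤˣ} {Γ Γ' : ℝ → ℂ}

theorem JoinedBySmallArc.conj {δ ε : ℝ} {p q : ℂ} (h : M.JoinedBySmallArc l δ ε p q) :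
    M.JoinedBySmallArc (-l) δ ε (conj p) (conj q) := by
  obtain ⟨c, ⟨C, hC⟩, h0, h1, hm, hi⟩ := h
  refine ⟨fun t => conj (c t), ⟨C, fun y hy z hz =>
    (Complex.conjLIE.edist_map _ _).trans_le (hC hy hz)⟩, congrArg _ h0, congrArg _ h1,
    fun t ht => ⟨M.conj_mem_D.2 (hm t ht).1, fun w hw => ?_⟩, ?_⟩
  · rw [dist_conj_spec hw]
    exact (hm t ht).2 w hw
  · refine lt_of_eq_of_lt (intervalIntegral.integral_congr fun t ht => ?_) hi
    rw [uIcc_of_le zero_le_one] at ht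
    simp only [deriv_conj, RCLike.norm_conj, norm_K'_conj (M.im_ne_zero (hm t ht).1)]

theorem SameEnds.conj (h : M.SameEnds l Γ Γ') :
    M.SameEnds (-l) (fun x => conj (Γ x)) (fun x => conj (Γ' x)) := by
  intro ε hε x hx
  obtain ⟨⟨y, hy, y', hy', h1, h2, h3⟩, ⟨z, hz, z', hz', h4, h5, h6⟩⟩ := h ε hε x hx
  rw [d₀_conj, d₀_conj]
  exact ⟨⟨y, hy, y', hy', h1, h2, h3.conj⟩, ⟨z, hz, z', hz', h4, h5, h6.conj⟩⟩

theorem JoinedBySmallArc.symm {δ ε : ℝ} {p q : ℂ} (h : M.JoinedBySmallArc l δ ε p q) :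
    M.JoinedBySmallArc l δ ε q p := by
  obtain ⟨c, ⟨C, hC⟩, h0, h1, hm, hi⟩ := h
  have hmem : ∀ t ∈ Icc (0 : ℝ) 1, 1 - t ∈ Icc (0 : ℝ) 1 := fun t ht =>
    ⟨by linarith [ht.2], by linarith [ht.1]⟩
  refine ⟨fun t => c (1 - t), ⟨C, fun y hy z hz => ?_⟩, by simp [h1], by simp [h0],
    fun t ht => hm _ (hmem t ht), ?_⟩
  · refine (hC (hmem y hy) (hmem z hz)).trans_eq ?_
    rw [edist_sub_left]
  · have h2 := intervalIntegral.integral_comp_sub_left (a := 0) (b := 1)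
      (fun t => ‖deriv c t‖ * ‖M.K' (c t)‖) 1
    rw [sub_self, sub_zero] at h2
    simp only [deriv_comp_const_sub, norm_neg]
    rw [h2]
    exact hi

theorem SameEnds.symm (h : M.SameEnds l Γ Γ') : M.SameEnds l Γ' Γ := by
  intro ε hε x hx
  obtain ⟨⟨y, hy, y', hy', h1, h2, h3⟩, ⟨z, hz, z', hz', h4, h5, h6⟩⟩ := h ε hε x hx
  rw [min_comm]
  exact ⟨⟨y', hy', y, hy, h2, h1, h3.symm⟩, ⟨z', hz', z, hz, h5, h4, h6.symm⟩⟩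

theorem IsPath.exists_lipschitzOnWith (h : M.IsPath l Γ) {x y : ℝ} (hx : x ∈ M.J) (hy : y ∈ M.J) :
    ∃ C, LipschitzOnWith C Γ (uIcc x y) :=
  LocallyLipschitzOn.exists_lipschitzOnWith_of_compact isCompact_uIcc
    (h.locallyLipschitzOn.mono (M.ordConnected_J.uIcc_subset hx hy))

section Deformation

variable {E : Type*} [NormedAddCommGroup E] [NormedSpace ℂ E] [CompleteSpace E]

omit [CompleteSpace E] in
theorem norm_arcIntegral_le {δ ε : ℝ} {c : ℝ → ℂ}
    (hc : ∃ C, LipschitzOnWith C c (Icc 0 1))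
    (hm : ∀ t ∈ Icc (0 : ℝ) 1, c t ∈ M.D l ∧ ∀ w ∈ spec M.A₁, δ ≤ dist (c t) w)
    (hi : ∫ t in (0 : ℝ)..1, ‖deriv c t‖ * ‖M.K' (c t)‖ < ε) {F : ℂ → E}
    {C : ℝ} (hC0 : 0 ≤ C)
    (hC : ∀ μ ∈ M.D l, (∀ s ∈ spec M.A₁, δ ≤ dist μ s) → ‖F μ‖ ≤ C * ‖M.K' μ‖) :
    ‖∫ t in (0 : ℝ)..1, deriv c t • F (c t)‖ ≤ C * ε := by
  obtain ⟨B, hB⟩ := hc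
  have h01 : uIcc (0 : ℝ) 1 = Icc 0 1 := uIcc_of_le zero_le_one
  have hi2 : IntervalIntegrable (fun t => ‖deriv c t‖ * ‖M.K' (c t)‖) volume 0 1 := by
    have := (intervalIntegrable_deriv_smul (γ := c) (a := 0) (b := 1) (C := B) (by rwa [h01])
      (F := fun t => M.K' (c t)) (by
        rw [h01]
        exact M.differentiableOn_K'.continuousOn.comp hB.continuousOn fun t ht => (hm t ht).1)).norm
    simpa only [norm_smul] using this
  calc _ ≤ ∫ t in (0 : ℝ)..1, C * (‖deriv c t‖ * ‖M.K' (c t)‖) := by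
        refine intervalIntegral.norm_integral_le_of_norm_le zero_le_one
          (Eventually.of_forall fun t ht => ?_) (hi2.const_mul C)
        obtain ⟨h1, h2⟩ := hm t (Ioc_subset_Icc_self ht)
        rw [norm_smul]
        calc _ ≤ ‖deriv c t‖ * (C * ‖M.K' (c t)‖) := by gcongr; exact hC _ h1 h2
          _ = _ := by ring
    _ ≤ C * ε := by
        rw [intervalIntegral.integral_const_mul]
        gcongr

/-- The integrals over two contours that agree at the ends coincide. -/
theorem integral_eq_of_sameEnds (hΓ : M.IsPath l Γ) (hΓ' : M.IsPath l Γ')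
    (h : M.SameEnds l Γ Γ') {F : ℂ → E} (hF : DifferentiableOn ℂ F (M.D l)) {C : ℝ} (hC0 : 0 ≤ C)
    (hC : ∀ μ ∈ M.D l, (∀ s ∈ spec M.A₁, min (M.d₀ Γ) (M.d₀ Γ') ≤ dist μ s) →
      ‖F μ‖ ≤ C * ‖M.K' μ‖) :
    M.integral Γ F = M.integral Γ' F := by
  obtain ⟨u, hu, hu'⟩ := M.exists_seq_left
  obtain ⟨v, hv, hv'⟩ := M.exists_seq_right
  have hpos : ∀ n : ℕ, (0 : ℝ) < 1 / (n + 1) := fun n => by positivity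
  choose y hy y' hy' hyu hyu' hp using fun n => (h _ (hpos n) (u n) (hu n)).1
  choose z hz z' hz' hzv hzv' hq using fun n => (h _ (hpos n) (v n) (hv n)).2
  have hlim : ∀ {Γ : ℝ → ℂ} {y z : ℕ → ℝ}, M.IsPath l Γ →
      (∀ x ∈ M.J, ‖F (Γ x)‖ ≤ C * ‖M.K' (Γ x)‖) → (∀ n, y n ∈ M.J) → (∀ n, z n ∈ M.J) →
      (∀ n, y n < u n) → (∀ n, v n < z n) →
      Tendsto (fun n => ∫ x in y n..z n, deriv Γ x • F (Γ x)) atTop (𝓝 (M.integral Γ F)) := by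
    intro Γ y z hΓ hb hy hz hyu hzv
    have hcov : AECover (volume.restrict M.J) atTop fun n => Ioc (y n) (z n) := by
      refine ⟨?_, fun n => measurableSet_Ioc⟩
      filter_upwards [ae_restrict_mem M.isOpen_J.measurableSet] with x hx
      filter_upwards [hu' x hx, hv' x hx] with n h1 h2
      exact ⟨(hyu n).trans h1, (h2.trans (hzv n)).le⟩
    have hint := hΓ.integrableOn (F := F)
      (hF.continuousOn.comp hΓ.continuousOn hΓ.mapsTo) hb
    refine (hcov.integral_tendsto_of_countably_generated hint).congr' ?_
    filter_upwards [hu' (v 0) (hv 0), hv' (v 0) (hv 0)] with n h1 h2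
    rw [Measure.restrict_restrict measurableSet_Ioc, inter_eq_left.2
      (Ioc_subset_Icc_self.trans (M.ordConnected_J.out (hy n) (hz n))),
      intervalIntegral.integral_of_le]
    exact ((hyu n).trans (h1.trans (h2.trans (hzv n)))).le
  have hb : ∀ x ∈ M.J, ‖F (Γ x)‖ ≤ C * ‖M.K' (Γ x)‖ := fun x hx =>
    hC _ (hΓ.mapsTo hx) fun s hs => (min_le_left _ _).trans (d₀_le hs hx)
  have hb' : ∀ x ∈ M.J, ‖F (Γ' x)‖ ≤ C * ‖M.K' (Γ' x)‖ := fun x hx =>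
    hC _ (hΓ'.mapsTo hx) fun s hs => (min_le_right _ _).trans (d₀_le hs hx)
  have hl := hlim hΓ hb hy hz hyu hzv
  have hl' := hlim hΓ' hb' hy' hz' hyu' hzv'
  have hdiff : ∀ n, ‖(∫ x in y n..z n, deriv Γ x • F (Γ x)) -
      ∫ x in y' n..z' n, deriv Γ' x • F (Γ' x)‖ ≤ 2 * C * (1 / (n + 1)) := by
    intro n
    obtain ⟨c, hc, hc0, hc1, hcm, hci⟩ := hp n
    obtain ⟨e, he, he0, he1, hem, hei⟩ := hq n
    have n1 := norm_arcIntegral_le hc hcm hci hC0 hC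
    have n2 := norm_arcIntegral_le he hem hei hC0 hC
    have h01 : uIcc (0 : ℝ) 1 = Icc 0 1 := uIcc_of_le zero_le_one
    -- The cycle runs along `Γ` from `y n` to `z n`, crosses to `Γ'` by `e`, returns along `Γ'` and
    -- closes up by `c` reversed. The two arcs contribute at most `C / (n + 1)` each.
    have hcyc : IsCycle (M.D l) ![Γ, e, Γ', c] ![y n, 0, z' n, 1] ![z n, 1, y' n, 0] := by
      refine ⟨?_, ?_, fun g => ?_⟩
      · intro i
        fin_cases i
        · exact hΓ.exists_lipschitzOnWith (hy n) (hz n)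
        · simpa [h01] using he
        · exact hΓ'.exists_lipschitzOnWith (hz' n) (hy' n)
        · simpa [uIcc_comm (1 : ℝ) 0, h01] using hc
      · intro i
        fin_cases i
        · exact fun t ht => hΓ.mapsTo (M.ordConnected_J.uIcc_subset (hy n) (hz n) ht)
        · intro t ht
          exact (hem t (by simpa [h01] using ht)).1
        · exact fun t ht => hΓ'.mapsTo (M.ordConnected_J.uIcc_subset (hz' n) (hy' n) ht)
        · intro t ht
          exact (hcm t (by simpa [uIcc_comm (1 : ℝ) 0, h01] using ht)).1
      · simp [Fin.sum_univ_four, hc0, hc1, he0, he1]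
        ring
    have h0 := hcyc.chainIntegral_eq_zero M.isOpen_D hF fun w hw =>
      hcyc.winding_eq_zero_of_isSimplyConnected M.isOpen_D M.isSimplyConnected_D hw
    rw [chainIntegral, Fin.sum_univ_four] at h0
    simp only [Matrix.cons_val_zero, Matrix.cons_val_one, Matrix.cons_val] at h0
    rw [intervalIntegral.integral_symm (y' n) (z' n), intervalIntegral.integral_symm 0 1] at h0
    have h1 : (∫ x in y n..z n, deriv Γ x • F (Γ x)) -
        (∫ x in y' n..z' n, deriv Γ' x • F (Γ' x)) =
        (∫ t in (0 : ℝ)..1, deriv c t • F (c t)) - ∫ t in (0 : ℝ)..1, deriv e t • F (e t) := by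
      rw [← sub_eq_zero, ← h0]
      abel
    rw [h1]
    refine (norm_sub_le _ _).trans ?_
    linarith
  refine sub_eq_zero.1 (tendsto_nhds_unique (hl.sub hl') ?_)
  refine squeeze_zero_norm hdiff ?_
  simpa using tendsto_one_div_add_atTop_nhds_zero_nat.const_mul (2 * C)

end Deformation

end Model

/-! ### Perturbed resolvents as limits of functions holomorphic off the real axis -/

section ResolventLimits

variable {H : Type*} [NormedAddCommGroup H] [InnerProductSpace ℂ H] [CompleteSpace H]
variable {A : H →ₗ.[ℂ] H} {Y : H →L[ℂ] H} {δ : ℝ}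

/-- The nonreal points at distance at least `δ` from the spectrum of `A`. -/
def awayFrom (A : H →ₗ.[ℂ] H) (δ : ℝ) : Set ℂ := {z | z.im ≠ 0 ∧ ∀ s ∈ spec A, δ ≤ dist z s}

/-- On `awayFrom A δ`, the function `L` is bounded, continuous, and a uniform limit of bounded
functions holomorphic off the real axis. -/
structure IsHolomorphicLimit (A : H →ₗ.[ℂ] H) (δ : ℝ) (L : ℂ → H →L[ℂ] H) : Prop where
  continuousOn : ContinuousOn L (awayFrom A δ)
  approx : ∃ (F : ℕ → ℂ → H →L[ℂ] H) (B : ℝ) (ε : ℕ → ℝ), 0 ≤ B ∧ Tendsto ε atTop (𝓝 0) ∧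
    (∀ n, DifferentiableOn ℂ (F n) {z | z.im ≠ 0}) ∧
    ∀ z ∈ awayFrom A δ, ‖L z‖ ≤ B ∧ ∀ n, ‖F n z‖ ≤ B ∧ ‖L z - F n z‖ ≤ ε n

omit [CompleteSpace H] in
theorem isHolomorphicLimit_one : IsHolomorphicLimit A δ fun _ => 1 :=
  ⟨continuousOn_const, fun _ _ => 1, ‖(1 : H →L[ℂ] H)‖, fun _ => 0, norm_nonneg _,
    tendsto_const_nhds, fun _ => differentiableOn_const _,
    fun z _ => ⟨le_rfl, fun _ => ⟨le_rfl, by simp⟩⟩⟩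

theorem norm_res_le_of_mem_awayFrom (hA : IsSelfAdjoint A) (hδ : 0 < δ) {z : ℂ}
    (hz : z ∈ awayFrom A δ) : z ∉ spec A ∧ ‖res A z‖ ≤ δ⁻¹ :=
  norm_res_le hA hδ fun s hs => by
    rw [← dist_eq_norm]
    exact hz.2 s hs

/-- The perturbed resolvent may have nonreal singularities, whereas its Neumann partial sums involve
only the resolvent of `A`, singular on the real axis alone. The remainder after `n` terms is the
perturbed resolvent times `(-Y * res A z) ^ n`, which decays geometrically since `‖Y‖ < δ`. -/
theorem isHolomorphicLimit_res (hA : IsSelfAdjoint A) (hs : ∀ s ∈ spec A, s.im = 0)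
    (hY : ‖Y‖ < δ) : IsHolomorphicLimit A δ (res (perturb A Y)) := by
  have hδ : 0 < δ := (norm_nonneg Y).trans_lt hY
  have h1 := fun z (hz : z ∈ awayFrom A δ) => norm_res_le_of_mem_awayFrom hA hδ hz
  have h2 := fun z (hz : z ∈ awayFrom A δ) => notMem_spec_perturb (h1 z hz).1 (h1 z hz).2 hY
  have h3 : 0 < δ - ‖Y‖ := sub_pos.2 hY
  -- A partial sum is the limit minus the remainder, each of norm at most `(δ - ‖Y‖)⁻¹`; hence the
  -- factor `2`.
  refine ⟨continuousOn_res fun z hz => (h2 z hz).1,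
    fun n z => res A z * ∑ k ∈ Finset.range n, (-Y * res A z) ^ k, 2 * (δ - ‖Y‖)⁻¹,
    fun n => (δ - ‖Y‖)⁻¹ * (‖Y‖ * δ⁻¹) ^ n, by positivity, ?_, fun n => ?_, fun z hz => ?_⟩
  · have h4 : ‖Y‖ * δ⁻¹ < 1 := by
      rw [← div_eq_mul_inv]
      exact (div_lt_one hδ).2 hY
    simpa using (tendsto_pow_atTop_nhds_zero_of_lt_one (by positivity) h4).const_mul (δ - ‖Y‖)⁻¹
  · have h5 : DifferentiableOn ℂ (res A) {z | z.im ≠ 0} :=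
      differentiableOn_res.mono fun z hz h => hz (hs z h)
    exact h5.mul (DifferentiableOn.fun_sum fun k _ => ((differentiableOn_const _).mul h5).pow k)
  · obtain ⟨h4, h5⟩ := h2 z hz
    have h6 : ∀ n, res (perturb A Y) z - res A z * ∑ k ∈ Finset.range n, (-Y * res A z) ^ k =
        res (perturb A Y) z * (-Y * res A z) ^ n := by
      intro n
      have h7 := res_perturb_sub_res_perturb (A := A) (X := Y) (Y := 0) h4
        (by rw [perturb_zero]; exact (h1 z hz).1)
      rw [perturb_zero, zero_sub] at h7
      have h8 : res A z = res (perturb A Y) z * (1 - -Y * res A z) := by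
        rw [mul_sub, mul_one, ← mul_assoc, ← h7, sub_sub_cancel]
      have h9 : res A z * ∑ k ∈ Finset.range n, (-Y * res A z) ^ k = res (perturb A Y) z *
          ((1 - -Y * res A z) * ∑ k ∈ Finset.range n, (-Y * res A z) ^ k) := by
        rw [← mul_assoc, ← h8]
      rw [h9, mul_neg_geom_sum, mul_sub, mul_one, sub_sub_cancel]
    have h7 : ∀ n, ‖res (perturb A Y) z * (-Y * res A z) ^ n‖ ≤
        (δ - ‖Y‖)⁻¹ * (‖Y‖ * δ⁻¹) ^ n := fun n => by
      have h10 : ‖(-Y * res A z) ^ n‖ ≤ (‖Y‖ * δ⁻¹) ^ n := by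
        -- The identity need not have norm `1`, as `H` may be the zero space, so the exponent `0` is
        -- treated apart.
        rcases n.eq_zero_or_pos with rfl | hn
        · rw [pow_zero, pow_zero]
          exact ContinuousLinearMap.norm_id_le
        · refine (norm_pow_le' _ hn).trans ?_
          gcongr
          refine (norm_mul_le _ _).trans ?_
          rw [norm_neg]
          gcongr
          exact (h1 z hz).2
      exact (norm_mul_le _ _).trans (by gcongr)
    have h8 : ∀ n, (δ - ‖Y‖)⁻¹ * (‖Y‖ * δ⁻¹) ^ n ≤ (δ - ‖Y‖)⁻¹ := fun n => by
      refine mul_le_of_le_one_right (by positivity) (pow_le_one₀ (by positivity) ?_)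
      rw [← div_eq_mul_inv]
      exact (div_le_one hδ).2 hY.le
    refine ⟨by linarith [norm_nonneg (res (perturb A Y) z)], fun n => ⟨?_, by rw [h6]; exact h7 n⟩⟩
    have h9 := norm_sub_le (res (perturb A Y) z) (res (perturb A Y) z * (-Y * res A z) ^ n)
    rw [← h6, sub_sub_cancel, h6] at h9
    linarith [h7 n, h8 n]

end ResolventLimits

/-! ### Exchange of contours for resolvents, and the fixed-point equation -/

namespace Model

variable {H₀ H₁ : Type*} [NormedAddCommGroup H₀] [InnerProductSpace ℂ H₀] [CompleteSpace H₀]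
  [NormedAddCommGroup H₁] [InnerProductSpace ℂ H₁] [CompleteSpace H₁]
variable {M : Model H₀ H₁} {l : ℤˣ} {Γ Γ' : ℝ → ℂ}

theorem IsPath.mem_awayFrom (h : M.IsPath l Γ) {δ : ℝ} (hδ : δ ≤ M.d₀ Γ) {x : ℝ} (hx : x ∈ M.J) :
    Γ x ∈ awayFrom M.A₁ δ :=
  ⟨h.im_ne_zero hx, fun _ hs => hδ.trans (d₀_le hs hx)⟩

theorem IsPath.continuousOn_comp (h : M.IsPath l Γ) {δ : ℝ} (hδ : δ ≤ M.d₀ Γ)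
    {L : ℂ → H₁ →L[ℂ] H₁} (hL : ContinuousOn L (awayFrom M.A₁ δ)) :
    ContinuousOn (fun x => L (Γ x)) M.J :=
  hL.comp h.continuousOn fun _ hx => h.mem_awayFrom hδ hx

theorem norm_mul_mul_le {𝔸 : Type*} [NormedRing 𝔸] {L K N : 𝔸} {p q : ℝ} (hL : ‖L‖ ≤ p)
    (hN : ‖N‖ ≤ q) : ‖L * K * N‖ ≤ p * q * ‖K‖ := by
  have hp : 0 ≤ p := (norm_nonneg L).trans hL
  calc ‖L * K * N‖ ≤ ‖L‖ * ‖K‖ * ‖N‖ :=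
        (norm_mul_le _ _).trans (mul_le_mul_of_nonneg_right (norm_mul_le _ _) (norm_nonneg _))
    _ ≤ p * ‖K‖ * q := by gcongr
    _ = _ := by ring

/-- The contours are exchanged for the holomorphic approximants, and the limit is then taken on each
contour separately, where finite variation of `K_B` turns uniform convergence of the outer factors
into convergence of the integrals. -/
theorem integral_mul_mul_eq_of_sameEnds (hΓ : M.IsPath l Γ) (hΓ' : M.IsPath l Γ')
    (h : M.SameEnds l Γ Γ') {L N : ℂ → H₁ →L[ℂ] H₁}
    (hL : IsHolomorphicLimit M.A₁ (min (M.d₀ Γ) (M.d₀ Γ')) L)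
    (hN : IsHolomorphicLimit M.A₁ (min (M.d₀ Γ) (M.d₀ Γ')) N) :
    M.integral Γ (fun μ => L μ * M.K' μ * N μ) = M.integral Γ' fun μ => L μ * M.K' μ * N μ := by
  set δ := min (M.d₀ Γ) (M.d₀ Γ') with hδ
  obtain ⟨F, B, ε, hB, hε, hF, hFb⟩ := hL.approx
  obtain ⟨G, B', ε', hB', hε', hG, hGb⟩ := hN.approx
  have hsub : M.D l ⊆ {z | z.im ≠ 0} := fun z hz => M.im_ne_zero hz
  have heq : ∀ n, M.integral Γ (fun μ => F n μ * M.K' μ * G n μ) =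
      M.integral Γ' fun μ => F n μ * M.K' μ * G n μ := fun n =>
    integral_eq_of_sameEnds hΓ hΓ' h (C := B * B')
      ((((hF n).mono hsub).mul M.differentiableOn_K').mul ((hG n).mono hsub)) (by positivity)
      fun μ hμ hd => norm_mul_mul_le ((hFb μ ⟨M.im_ne_zero hμ, hd⟩).2 n).1
        ((hGb μ ⟨M.im_ne_zero hμ, hd⟩).2 n).1
  have hlim : ∀ {Γ : ℝ → ℂ}, M.IsPath l Γ → δ ≤ M.d₀ Γ →
      Tendsto (fun n => M.integral Γ fun μ => F n μ * M.K' μ * G n μ) atTop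
        (𝓝 (M.integral Γ fun μ => L μ * M.K' μ * N μ)) := by
    intro Γ hΓ hd
    have hdiff : ∀ n, ‖M.integral Γ (fun μ => F n μ * M.K' μ * G n μ) -
        M.integral Γ (fun μ => L μ * M.K' μ * N μ)‖ ≤ (ε n * B' + B * ε' n) * M.variation Γ := by
      intro n
      have i1 := hΓ.integrableOn (F := fun μ => F n μ * M.K' μ * G n μ) (C := B * B')
        (((((hF n).mono hsub).mul M.differentiableOn_K').mul
          ((hG n).mono hsub)).continuousOn.comp hΓ.continuousOn hΓ.mapsTo)
        fun x hx => norm_mul_mul_le ((hFb _ (hΓ.mem_awayFrom hd hx)).2 n).1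
          ((hGb _ (hΓ.mem_awayFrom hd hx)).2 n).1
      have i2 := hΓ.integrableOn (F := fun μ => L μ * M.K' μ * N μ) (C := B * B')
        (((hΓ.continuousOn_comp hd hL.continuousOn).mul hΓ.continuousOn_K').mul
          (hΓ.continuousOn_comp hd hN.continuousOn))
        fun x hx => norm_mul_mul_le (hFb _ (hΓ.mem_awayFrom hd hx)).1
          (hGb _ (hΓ.mem_awayFrom hd hx)).1
      have e1 : M.integral Γ (fun μ => F n μ * M.K' μ * G n μ) -
          M.integral Γ (fun μ => L μ * M.K' μ * N μ) =
          M.integral Γ fun μ => F n μ * M.K' μ * G n μ - L μ * M.K' μ * N μ := by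
        rw [integral, integral, ← integral_sub i1 i2, integral]
        simp only [smul_sub]
      rw [e1]
      refine hΓ.norm_integral_le fun x hx => ?_
      set z := Γ x
      have hz := hΓ.mem_awayFrom hd hx
      have e2 : F n z * M.K' z * G n z - L z * M.K' z * N z =
          -((L z - F n z) * M.K' z * N z + F n z * M.K' z * (N z - G n z)) := by noncomm_ring
      rw [e2, norm_neg, add_mul]
      exact (norm_add_le _ _).trans (add_le_add
        (norm_mul_mul_le ((hFb z hz).2 n).2 (hGb z hz).1)
        (norm_mul_mul_le ((hFb z hz).2 n).1 ((hGb z hz).2 n).2))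
    rw [tendsto_iff_norm_sub_tendsto_zero]
    refine squeeze_zero (fun n => norm_nonneg _) hdiff ?_
    simpa using ((hε.mul_const B').add (hε'.const_mul B)).mul_const (M.variation Γ)
  refine tendsto_nhds_unique (hlim hΓ (min_le_left _ _)) ?_
  simp only [heq]
  exact hlim hΓ' (min_le_right _ _)

/-- A bound valid along `Γ` for perturbations of norm at most `d₀(Γ) / 2`. -/
theorem norm_res_le_two_div (hΓ : 0 < M.d₀ Γ) {Y : H₁ →L[ℂ] H₁} (hY : ‖Y‖ ≤ M.d₀ Γ / 2) {x : ℝ}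
    (hx : x ∈ M.J) : Γ x ∉ spec (perturb M.A₁ Y) ∧
      ‖res (perturb M.A₁ Y) (Γ x)‖ ≤ 2 / M.d₀ Γ := by
  obtain ⟨h1, h2⟩ := notMem_spec_of_le hΓ (hY.trans_lt (half_lt_self hΓ)) hx
  refine ⟨h1, h2.trans ?_⟩
  rw [← inv_div]
  exact inv_anti₀ (by positivity) (by linarith)

theorem norm_V₁op_le (h : M.IsPath l Γ) (hΓ : 0 < M.d₀ Γ) {Y : H₁ →L[ℂ] H₁}
    (hY : ‖Y‖ ≤ M.d₀ Γ / 2) :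
    ‖M.V₁op (perturb M.A₁ Y) Γ‖ ≤ 2 / M.d₀ Γ * M.variation Γ :=
  h.norm_integral_le fun x hx => by
    rw [mul_comm]
    exact (norm_mul_le _ _).trans (by gcongr; exact (norm_res_le_two_div hΓ hY hx).2)

/-- By the second resolvent identity the basic equation is a fixed-point problem with Lipschitz
constant `4 V / d₀ ^ 2`, which the smallness condition makes less than `1`. -/
theorem norm_V₁op_sub_le (h : M.IsPath l Γ) (hΓ : 0 < M.d₀ Γ) {Y Y' : H₁ →L[ℂ] H₁}
    (hY : ‖Y‖ ≤ M.d₀ Γ / 2) (hY' : ‖Y'‖ ≤ M.d₀ Γ / 2) :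
    ‖M.V₁op (perturb M.A₁ Y) Γ - M.V₁op (perturb M.A₁ Y') Γ‖ ≤
      (2 / M.d₀ Γ) ^ 2 * M.variation Γ * ‖Y - Y'‖ := by
  have hint : ∀ {Y : H₁ →L[ℂ] H₁}, ‖Y‖ ≤ M.d₀ Γ / 2 →
      IntegrableOn (fun x => deriv Γ x • (M.K' (Γ x) * res (perturb M.A₁ Y) (Γ x))) M.J :=
    fun hY => h.integrableOn (F := fun μ => M.K' μ * res (perturb M.A₁ _) μ) (C := 2 / M.d₀ Γ)
      (h.continuousOn_K'.mul (h.continuousOn_res hΓ (hY.trans_lt (half_lt_self hΓ))))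
      fun x hx => by
        rw [mul_comm (2 / M.d₀ Γ)]
        exact (norm_mul_le _ _).trans (by gcongr; exact (norm_res_le_two_div hΓ hY hx).2)
  have e1 : M.V₁op (perturb M.A₁ Y) Γ - M.V₁op (perturb M.A₁ Y') Γ = M.integral Γ
      fun μ => M.K' μ * res (perturb M.A₁ Y) μ - M.K' μ * res (perturb M.A₁ Y') μ := by
    simp only [integral, smul_sub]
    exact (integral_sub (hint hY) (hint hY')).symm
  rw [e1]
  calc _ ≤ ((2 / M.d₀ Γ) ^ 2 * ‖Y - Y'‖) * M.variation Γ := h.norm_integral_le fun x hx => ?_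
    _ = _ := by ring
  obtain ⟨h1, h2⟩ := norm_res_le_two_div hΓ hY hx
  obtain ⟨h3, h4⟩ := norm_res_le_two_div hΓ hY' hx
  rw [← mul_sub, res_perturb_sub_res_perturb h1 h3]
  calc _ ≤ ‖M.K' (Γ x)‖ * (‖res (perturb M.A₁ Y) (Γ x)‖ * ‖Y' - Y‖ *
        ‖res (perturb M.A₁ Y') (Γ x)‖) :=
        (norm_mul_le _ _).trans (by
          gcongr
          exact (norm_mul_le _ _).trans
            (mul_le_mul_of_nonneg_right (norm_mul_le _ _) (norm_nonneg _)))
    _ ≤ ‖M.K' (Γ x)‖ * ((2 / M.d₀ Γ) * ‖Y' - Y‖ * (2 / M.d₀ Γ)) := by gcongr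
    _ = _ := by rw [norm_sub_rev]; ring

theorem IsSmall.contraction_lt_one (h : M.IsSmall Γ) :
    (2 / M.d₀ Γ) ^ 2 * M.variation Γ < 1 := by
  have h1 := h.d₀_pos
  have h2 : M.variation Γ < M.d₀ Γ ^ 2 / 4 := h
  calc (2 / M.d₀ Γ) ^ 2 * M.variation Γ < (2 / M.d₀ Γ) ^ 2 * (M.d₀ Γ ^ 2 / 4) := by gcongr
    _ = 1 := by field_simp; norm_num

theorem IsSmall.norm_V₁op_lt (h : M.IsPath l Γ) (hs : M.IsSmall Γ) {Y : H₁ →L[ℂ] H₁}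
    (hY : ‖Y‖ ≤ M.d₀ Γ / 2) : ‖M.V₁op (perturb M.A₁ Y) Γ‖ < M.d₀ Γ / 2 := by
  have h1 := hs.d₀_pos
  refine (norm_V₁op_le h h1 hY).trans_lt ?_
  calc 2 / M.d₀ Γ * M.variation Γ = (2 / M.d₀ Γ) ^ 2 * M.variation Γ * (M.d₀ Γ / 2) := by
        field_simp
    _ < 1 * (M.d₀ Γ / 2) := by
        gcongr
        exact hs.contraction_lt_one
    _ = _ := one_mul _

theorem eq_of_eq_V₁op (h : M.IsPath l Γ) (hs : M.IsSmall Γ) {Y Y' : H₁ →L[ℂ] H₁}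
    (hY : ‖Y‖ ≤ M.d₀ Γ / 2) (hY' : ‖Y'‖ ≤ M.d₀ Γ / 2) (e : Y = M.V₁op (perturb M.A₁ Y) Γ)
    (e' : Y' = M.V₁op (perturb M.A₁ Y') Γ) : Y = Y' := by
  have h1 := norm_V₁op_sub_le h hs.d₀_pos hY hY'
  rw [← e, ← e'] at h1
  have h2 := hs.contraction_lt_one
  have h3 := norm_nonneg (Y - Y')
  by_contra hne
  have h4 : 0 < ‖Y - Y'‖ := norm_pos_iff.2 (sub_ne_zero.2 hne)
  nlinarith

theorem exists_eq_V₁op (h : M.IsPath l Γ) (hs : M.IsSmall Γ) :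
    ∃ Y : H₁ →L[ℂ] H₁, ‖Y‖ < M.d₀ Γ / 2 ∧ Y = M.V₁op (perturb M.A₁ Y) Γ := by
  have hd := hs.d₀_pos
  let f : (H₁ →L[ℂ] H₁) → H₁ →L[ℂ] H₁ := fun Y => M.V₁op (perturb M.A₁ Y) Γ
  let s : Set (H₁ →L[ℂ] H₁) := Metric.closedBall 0 (M.d₀ Γ / 2)
  have hmem : ∀ {Y}, Y ∈ s → ‖Y‖ ≤ M.d₀ Γ / 2 := fun hY => mem_closedBall_zero_iff.1 hY
  have hmaps : MapsTo f s s := fun Y hY =>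
    mem_closedBall_zero_iff.2 (hs.norm_V₁op_lt h (hmem hY)).le
  have hK0 : 0 ≤ (2 / M.d₀ Γ) ^ 2 * M.variation Γ := mul_nonneg (by positivity) variation_nonneg
  have hcontr : ContractingWith ⟨(2 / M.d₀ Γ) ^ 2 * M.variation Γ, hK0⟩ (hmaps.restrict f s s) := by
    refine ⟨hs.contraction_lt_one, LipschitzWith.of_dist_le_mul fun Y Y' => ?_⟩
    rw [Subtype.dist_eq, Subtype.dist_eq, dist_eq_norm, dist_eq_norm]
    exact norm_V₁op_sub_le h hd (hmem Y.2) (hmem Y'.2)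
  obtain ⟨Y, hY, hfix, -⟩ := hcontr.exists_fixedPoint' Metric.isClosed_closedBall.isComplete hmaps
    (x := 0) (Metric.mem_closedBall_self (half_pos hd).le) (edist_ne_top _ _)
  have e : Y = M.V₁op (perturb M.A₁ Y) Γ := hfix.symm
  exact ⟨Y, (congrArg norm e).trans_lt (hs.norm_V₁op_lt h (hmem hY)), e⟩

theorem V₁op_eq_of_sameEnds (hΓ : M.IsPath l Γ) (hΓ' : M.IsPath l Γ')
    (h : M.SameEnds l Γ Γ') {Y : H₁ →L[ℂ] H₁} (hY : ‖Y‖ < min (M.d₀ Γ) (M.d₀ Γ')) :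
    M.V₁op (perturb M.A₁ Y) Γ = M.V₁op (perturb M.A₁ Y) Γ' := by
  have := integral_mul_mul_eq_of_sameEnds hΓ hΓ' h isHolomorphicLimit_one
    (isHolomorphicLimit_res M.isSelfAdjoint₁ (fun _ => M.spec_im) hY)
  simp only [one_mul] at this
  exact this

/-- The solution for one contour is small also with respect to a contour with the same ends. -/
theorem IsSolution.norm_lt_of_sameEnds (hΓ : M.IsPath l Γ) (hΓ' : M.IsPath l Γ')
    (hs : M.IsSmall Γ) (hs' : M.IsSmall Γ') (h : M.SameEnds l Γ Γ') {X : H₁ →L[ℂ] H₁}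
    (hX : M.IsSolution Γ X) : ‖X‖ < M.d₀ Γ' / 2 := by
  rcases le_total (M.d₀ Γ) (M.d₀ Γ') with hd | hd
  · linarith [hX.norm_lt hs]
  -- Here `Γ'` is the contour nearer to the spectrum. Its own fixed point `Y` lies in the smaller
  -- ball, solves the equation on `Γ` too after the exchange of contours, and so equals `X` by
  -- uniqueness in the larger ball.
  · obtain ⟨Y, hY, e⟩ := exists_eq_V₁op hΓ' hs'
    have hd' := hs'.d₀_pos
    have e2 : Y = M.V₁op (perturb M.A₁ Y) Γ := by
      rw [V₁op_eq_of_sameEnds hΓ hΓ' h]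
      · exact e
      · rw [min_eq_right hd]
        linarith
    rw [eq_of_eq_V₁op hΓ hs (hX.norm_lt hs).le (by linarith) hX.2 e2]
    exact hY

end Model

/-! ### The two adjoint equations on a common contour -/

namespace Model

variable {H₀ H₁ : Type*} [NormedAddCommGroup H₀] [InnerProductSpace ℂ H₀] [CompleteSpace H₀]
  [NormedAddCommGroup H₁] [InnerProductSpace ℂ H₁] [CompleteSpace H₁]
variable {M : Model H₀ H₁} {l : ℤˣ} {Γ Γ' : ℝ → ℂ} {X Y : H₁ →L[ℂ] H₁}

theorem integral_congr {E : Type*} [NormedAddCommGroup E] [NormedSpace ℂ E] {F G : ℂ → E}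
    (h : ∀ x ∈ M.J, F (Γ x) = G (Γ x)) : M.integral Γ F = M.integral Γ G :=
  setIntegral_congr_fun M.isOpen_J.measurableSet fun x hx => congrArg (deriv Γ x • ·) (h x hx)

/-- The operators `X` and `Y` solve the two mutually adjoint forms of the basic equation on the
same contour `Γ`. -/
structure IsSolutionPair (M : Model H₀ H₁) (l : ℤˣ) (Γ : ℝ → ℂ) (X Y : H₁ →L[ℂ] H₁) : Prop where
  isPath : M.IsPath l Γ
  isSmall : M.IsSmall Γ
  norm_fst_lt : ‖X‖ < M.d₀ Γ / 2
  norm_snd_lt : ‖Y‖ < M.d₀ Γ / 2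
  eq_fst : X = M.integral Γ fun μ => M.K' μ * res (perturb M.A₁ X) μ
  eq_snd : Y = M.integral Γ fun μ => res (perturb M.A₁ Y) μ * M.K' μ

theorem star_V₁op (h : M.IsPath l Γ) (hΓ : 0 < M.d₀ Γ) (hX : ‖X‖ < M.d₀ Γ) :
    star (M.V₁op (perturb M.A₁ X) Γ) = M.integral (fun x => conj (Γ x)) fun μ =>
      res (perturb M.A₁ (star X)) μ * M.K' μ := by
  rw [V₁op, star_integral]
  refine integral_congr fun x hx => ?_
  change star (M.K' _ * _) = _
  have h1 := adjoint_res M.isSelfAdjoint₁ (notMem_spec_of_le hΓ hX hx).1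
  rw [star_mul, Complex.conj_conj, M.K'_conj (h.im_ne_zero hx), ContinuousLinearMap.star_eq_adjoint,
    h1]
  rfl

theorem star_integral_mul_mul (h : M.IsPath l Γ) (hΓ : 0 < M.d₀ Γ) (hX : ‖X‖ < M.d₀ Γ)
    (hY : ‖Y‖ < M.d₀ Γ) :
    star (M.integral Γ fun μ => res (perturb M.A₁ Y) μ * M.K' μ * res (perturb M.A₁ X) μ) =
      M.integral (fun x => conj (Γ x)) fun μ =>
        res (perturb M.A₁ (star X)) μ * M.K' μ * res (perturb M.A₁ (star Y)) μ := by
  rw [star_integral]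
  refine integral_congr fun x hx => ?_
  have h1 := adjoint_res M.isSelfAdjoint₁ (notMem_spec_of_le hΓ hX hx).1
  have h2 := adjoint_res M.isSelfAdjoint₁ (notMem_spec_of_le hΓ hY hx).1
  rw [star_mul, star_mul, Complex.conj_conj, M.K'_conj (h.im_ne_zero hx),
    ContinuousLinearMap.star_eq_adjoint, h1, ContinuousLinearMap.star_eq_adjoint (res _ _), h2,
    mul_assoc]
  rfl

section Contours

variable {Γ : ℤˣ → ℝ → ℂ} {X : ℤˣ → H₁ →L[ℂ] H₁}

theorem sameEnds_conj (hends : M.SameEnds 1 (Γ 1) fun x => conj (Γ (-1) x)) (l : ℤˣ) :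
    M.SameEnds l (Γ l) fun x => conj (Γ (-l) x) := by
  rcases Int.units_eq_one_or l with rfl | rfl
  · exact hends
  · have h := hends.conj.symm
    simp only [Complex.conj_conj] at h
    exact h

theorem IsSolution.norm_lt_opposite (hΓ : ∀ l, M.IsContour l (Γ l))
    (hs : ∀ l, M.IsSmall (Γ l)) (hends : M.SameEnds 1 (Γ 1) fun x => conj (Γ (-1) x))
    (hX : ∀ l, M.IsSolution (Γ l) (X l)) (l : ℤˣ) : ‖X (-l)‖ < M.d₀ (Γ l) / 2 := by
  have h1 := sameEnds_conj hends (-l)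
  have h2 := (hΓ l).isPath.conj
  have h3 := (hs l).conj (hΓ l).isPath
  rw [← d₀_conj]
  rw [neg_neg] at h1
  exact (hX (-l)).norm_lt_of_sameEnds (hΓ (-l)).isPath h2 (hs (-l)) h3 h1

/-- The adjoint of the equation for `X (-l)` lives on the mirror image of `Γ (-l)`, a curve in
`D^l`, which is then exchanged for `Γ l`. -/
theorem isSolutionPair (hΓ : ∀ l, M.IsContour l (Γ l))
    (hs : ∀ l, M.IsSmall (Γ l)) (hends : M.SameEnds 1 (Γ 1) fun x => conj (Γ (-1) x))
    (hX : ∀ l, M.IsSolution (Γ l) (X l)) (l : ℤˣ) :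
    M.IsSolutionPair l (Γ l) (X l) (star (X (-l))) := by
  have h1 := IsSolution.norm_lt_opposite hΓ hs hends hX l
  have hd := (hs l).d₀_pos
  have hd' := (hs (-l)).d₀_pos
  have h2 := (hX (-l)).norm_lt (hs (-l))
  refine ⟨(hΓ l).isPath, hs l, (hX l).norm_lt (hs l), by rwa [norm_star], (hX l).2, ?_⟩
  have h3 := star_V₁op (hΓ (-l)).isPath hd' (by linarith : ‖X (-l)‖ < M.d₀ (Γ (-l)))
  rw [← (hX (-l)).2] at h3
  have hp := (hΓ (-l)).isPath.conj
  rw [neg_neg] at hp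
  have hd2 : M.d₀ (fun x => conj (Γ (-l) x)) = M.d₀ (Γ (-l)) := d₀_conj _
  have h4 := integral_mul_mul_eq_of_sameEnds (hΓ l).isPath hp (sameEnds_conj hends l)
    (isHolomorphicLimit_res (Y := star (X (-l))) M.isSelfAdjoint₁ (fun _ => M.spec_im)
      (by rw [norm_star, hd2]; exact lt_min (by linarith) (by linarith)))
    isHolomorphicLimit_one
  simp only [mul_one] at h4
  rw [h4]
  exact h3

/-- The adjoint of the integral over `Γ l` is an integral of the same kind over the mirror image of
`Γ l`, which has the same ends as `Γ (-l)`. -/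
theorem integral_neg_eq_star (hΓ : ∀ l, M.IsContour l (Γ l))
    (hs : ∀ l, M.IsSmall (Γ l)) (hends : M.SameEnds 1 (Γ 1) fun x => conj (Γ (-1) x))
    (hX : ∀ l, M.IsSolution (Γ l) (X l)) (l : ℤˣ) :
    M.integral (Γ (-l)) (fun μ => res (perturb M.A₁ (star (X l))) μ * M.K' μ *
      res (perturb M.A₁ (X (-l))) μ) =
    star (M.integral (Γ l) fun μ => res (perturb M.A₁ (star (X (-l)))) μ * M.K' μ *
      res (perturb M.A₁ (X l)) μ) := by
  have h1 := IsSolution.norm_lt_opposite hΓ hs hends hX l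
  have h1' := IsSolution.norm_lt_opposite hΓ hs hends hX (-l)
  rw [neg_neg] at h1'
  have hd := (hs l).d₀_pos
  have hd' := (hs (-l)).d₀_pos
  have h2 := (hX (-l)).norm_lt (hs (-l))
  have h2' := (hX l).norm_lt (hs l)
  rw [star_integral_mul_mul (hΓ l).isPath hd (by linarith) (by rw [norm_star]; linarith), star_star]
  have hsame := sameEnds_conj hends (-l)
  rw [neg_neg] at hsame
  have hd2 : M.d₀ (fun x => conj (Γ l x)) = M.d₀ (Γ l) := d₀_conj _
  exact integral_mul_mul_eq_of_sameEnds (hΓ (-l)).isPath (hΓ l).isPath.conj hsame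
    (isHolomorphicLimit_res M.isSelfAdjoint₁ (fun _ => M.spec_im)
      (by rw [norm_star, hd2]; exact lt_min (by linarith) (by linarith)))
    (isHolomorphicLimit_res M.isSelfAdjoint₁ (fun _ => M.spec_im)
      (by rw [hd2]; exact lt_min (by linarith) (by linarith)))

end Contours

end Model

/-! ### Spectra of similar operators -/

section Similarity

variable {H : Type*} [NormedAddCommGroup H] [InnerProductSpace ℂ H]
variable {A T : H →ₗ.[ℂ] H} {S : H →L[ℂ] H} {z : ℂ}

theorem isBoundedInverse_of_similar (hS : IsUnit S)
    (h : ∀ x y, (x, y) ∈ A.graph ↔ (S x, S y) ∈ T.graph) (hz : z ∉ spec A) :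
    IsBoundedInverse (shift T z) (S * res A z * Ring.inverse S) := by
  rw [isBoundedInverse_iff]
  have hs := isUnit_apply_inverse hS
  have hs' := isUnit_inverse_apply hS
  refine ⟨fun x => ?_, fun x y hxy => ?_⟩
  · rw [mem_graph_shift]
    change (S (res A z (Ring.inverse S x)), x + z • S (res A z (Ring.inverse S x))) ∈ T.graph
    have h1 := (h _ _).1 (res_mem_graph hz (Ring.inverse S x))
    rwa [map_add, map_smul, hs] at h1
  · rw [mem_graph_shift] at hxy
    change S (res A z (Ring.inverse S y)) = x
    have h1 : (Ring.inverse S x, Ring.inverse S (y + z • x)) ∈ A.graph := by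
      rw [h, hs, hs]
      exact hxy
    have h2 := res_apply_sub hz h1
    rw [← map_smul, ← map_sub, add_sub_cancel_right] at h2
    rw [h2, hs]

theorem spec_eq_of_similar (hS : IsUnit S)
    (h : ∀ x y, (x, y) ∈ A.graph ↔ (S x, S y) ∈ T.graph) : spec A = spec T := by
  have h' : ∀ x y, (x, y) ∈ T.graph ↔ (Ring.inverse S x, Ring.inverse S y) ∈ A.graph := fun x y => by
    rw [h, isUnit_apply_inverse hS, isUnit_apply_inverse hS]
  ext z
  rw [← not_iff_not]
  exact ⟨fun hz => (isBoundedInverse_of_similar hS h hz).notMem_spec,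
    fun hz => (isBoundedInverse_of_similar hS.ringInverse h' hz).notMem_spec⟩

end Similarity

/-! ### Contour integrals with integrands dominated by `K'_B` -/

namespace Model

variable {H₀ H₁ : Type*} [NormedAddCommGroup H₀] [InnerProductSpace ℂ H₀] [CompleteSpace H₀]
  [NormedAddCommGroup H₁] [InnerProductSpace ℂ H₁] [CompleteSpace H₁]
variable {M : Model H₀ H₁} {l : ℤˣ} {Γ : ℝ → ℂ} {X Y : H₁ →L[ℂ] H₁}

/-- Along `Γ`, the function `F` is continuous and bounded by a multiple of `‖K'_B‖`. -/
structure IsDominated (M : Model H₀ H₁) (Γ : ℝ → ℂ) {E : Type*} [NormedAddCommGroup E]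
    (C : ℝ) (F : ℂ → E) : Prop where
  continuousOn : ContinuousOn (fun x => F (Γ x)) M.J
  norm_le : ∀ x ∈ M.J, ‖F (Γ x)‖ ≤ C * ‖M.K' (Γ x)‖

section Dominated

variable {F G : ℂ → H₁ →L[ℂ] H₁} {C C' : ℝ}

theorem IsDominated.integrableOn (hF : M.IsDominated Γ C F) (h : M.IsPath l Γ) :
    IntegrableOn (fun x => deriv Γ x • F (Γ x)) M.J :=
  h.integrableOn hF.continuousOn hF.norm_le

theorem isDominated_K' (h : M.IsPath l Γ) : M.IsDominated Γ 1 M.K' :=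
  ⟨h.continuousOn_K', fun _ _ => (one_mul _).ge⟩

theorem IsDominated.mul_res (hF : M.IsDominated Γ C F) (h : M.IsPath l Γ) (hs : M.IsSmall Γ)
    (hX : ‖X‖ < M.d₀ Γ / 2) :
    M.IsDominated Γ (C * (2 / M.d₀ Γ)) fun μ => F μ * res (perturb M.A₁ X) μ := by
  have hd := hs.d₀_pos
  refine ⟨hF.continuousOn.mul (h.continuousOn_res hd (by linarith)), fun x hx => ?_⟩
  have h1 := hF.norm_le x hx
  calc _ ≤ ‖F (Γ x)‖ * ‖res (perturb M.A₁ X) (Γ x)‖ := norm_mul_le _ _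
    _ ≤ (C * ‖M.K' (Γ x)‖) * (2 / M.d₀ Γ) :=
        mul_le_mul h1 (norm_res_le_two_div hd hX.le hx).2 (norm_nonneg _)
          ((norm_nonneg _).trans h1)
    _ = _ := by ring

theorem IsDominated.res_mul (hF : M.IsDominated Γ C F) (h : M.IsPath l Γ) (hs : M.IsSmall Γ)
    (hX : ‖X‖ < M.d₀ Γ / 2) :
    M.IsDominated Γ (C * (2 / M.d₀ Γ)) fun μ => res (perturb M.A₁ X) μ * F μ := by
  have hd := hs.d₀_pos
  refine ⟨(h.continuousOn_res hd (by linarith)).mul hF.continuousOn, fun x hx => ?_⟩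
  have h1 := hF.norm_le x hx
  calc _ ≤ ‖res (perturb M.A₁ X) (Γ x)‖ * ‖F (Γ x)‖ := norm_mul_le _ _
    _ ≤ (2 / M.d₀ Γ) * (C * ‖M.K' (Γ x)‖) := by
        gcongr
        exact (norm_res_le_two_div hd hX.le hx).2
    _ = _ := by ring

theorem IsDominated.cauchy (hF : M.IsDominated Γ C F) (h : M.IsPath l Γ) {η : ℝ} (hη : 0 < η)
    {z : ℂ} (hz : ∀ x ∈ M.J, η ≤ ‖z - Γ x‖) :
    M.IsDominated Γ (C * η⁻¹) fun μ => (z - μ)⁻¹ • F μ := by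
  refine ⟨((continuousOn_const.sub h.continuousOn).inv₀ fun x hx => ?_).smul hF.continuousOn,
    fun x hx => ?_⟩
  · exact norm_pos_iff.1 (hη.trans_le (hz x hx))
  · have h1 := hF.norm_le x hx
    rw [norm_smul, norm_inv]
    calc _ ≤ η⁻¹ * (C * ‖M.K' (Γ x)‖) := by
          gcongr
          exact hz x hx
      _ = _ := by ring

theorem IsDominated.integral_sub (hF : M.IsDominated Γ C F) (hG : M.IsDominated Γ C' G)
    (h : M.IsPath l Γ) :
    M.integral Γ (fun μ => F μ - G μ) = M.integral Γ F - M.integral Γ G := by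
  simp only [integral, smul_sub]
  exact MeasureTheory.integral_sub (hF.integrableOn h) (hG.integrableOn h)

theorem IsDominated.integral_mul_right (hF : M.IsDominated Γ C F) (h : M.IsPath l Γ)
    (B : H₁ →L[ℂ] H₁) : M.integral Γ (fun μ => F μ * B) = M.integral Γ F * B := by
  have := ((ContinuousLinearMap.mul ℂ (H₁ →L[ℂ] H₁)).flip B).integral_comp_comm (hF.integrableOn h)
  simp only [ContinuousLinearMap.flip_apply, ContinuousLinearMap.mul_apply', smul_mul_assoc] at this
  exact this

theorem IsDominated.integral_mul_left (hF : M.IsDominated Γ C F) (h : M.IsPath l Γ)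
    (B : H₁ →L[ℂ] H₁) : M.integral Γ (fun μ => B * F μ) = B * M.integral Γ F := by
  have := (ContinuousLinearMap.mul ℂ (H₁ →L[ℂ] H₁) B).integral_comp_comm (hF.integrableOn h)
  simp only [ContinuousLinearMap.mul_apply', mul_smul_comm] at this
  exact this

/-- The first resolvent identity in the form `R(μ) R(z) = (z - μ)⁻¹ (R(z) - R(μ))`. It serves for `F
= K'_B`, giving the factorization of `M₁`, and for `F = R' K'_B`, giving the product of `Ω` with
`R(z)`. -/
theorem IsDominated.integral_mul_res_mul_res (hF : M.IsDominated Γ C F) (h : M.IsPath l Γ)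
    (hs : M.IsSmall Γ) (hX : ‖X‖ < M.d₀ Γ / 2) {z : ℂ} (hz : z ∉ spec (perturb M.A₁ X))
    {η : ℝ} (hη : 0 < η) (hzη : ∀ x ∈ M.J, η ≤ ‖z - Γ x‖) :
    M.integral Γ (fun μ => F μ * res (perturb M.A₁ X) μ) * res (perturb M.A₁ X) z =
      M.integral Γ (fun μ => (z - μ)⁻¹ • F μ) * res (perturb M.A₁ X) z -
        M.integral Γ fun μ => (z - μ)⁻¹ • (F μ * res (perturb M.A₁ X) μ) := by
  have hd := hs.d₀_pos
  set R := res (perturb M.A₁ X) with hR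
  have d1 := hF.mul_res h hs hX
  have d2 := hF.cauchy h hη hzη
  have d3 := d1.cauchy h hη hzη
  have d4 : M.IsDominated Γ (C * η⁻¹ * ‖R z‖) fun μ => ((z - μ)⁻¹ • F μ) * R z :=
    ⟨d2.continuousOn.mul continuousOn_const, fun x hx => by
      calc _ ≤ ‖(z - Γ x)⁻¹ • F (Γ x)‖ * ‖R z‖ := norm_mul_le _ _
        _ ≤ (C * η⁻¹ * ‖M.K' (Γ x)‖) * ‖R z‖ := by gcongr; exact d2.norm_le x hx
        _ = _ := by ring⟩
  rw [← d1.integral_mul_right h, ← d2.integral_mul_right h, ← d4.integral_sub d3 h]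
  refine integral_congr fun x hx => ?_
  have h1 := res_sub_res (norm_res_le_two_div hd hX.le hx).1 hz
  have h2 : Γ x - z ≠ 0 := by
    rw [← norm_pos_iff, norm_sub_rev]
    exact hη.trans_le (hzη x hx)
  have h3 : R (Γ x) * R z = (z - Γ x)⁻¹ • (R z - R (Γ x)) := by
    rw [← neg_sub (R (Γ x)), h1, ← neg_sub (Γ x), inv_neg, neg_smul_neg, inv_smul_smul₀ h2]
  change F (Γ x) * R (Γ x) * R z = _
  rw [mul_assoc, h3, mul_smul_comm, mul_sub, smul_sub, smul_mul_assoc]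

theorem IsDominated.res_mul_integral_res_mul (hF : M.IsDominated Γ C F) (h : M.IsPath l Γ)
    (hs : M.IsSmall Γ) (hX : ‖X‖ < M.d₀ Γ / 2) {z : ℂ} (hz : z ∉ spec (perturb M.A₁ X))
    {η : ℝ} (hη : 0 < η) (hzη : ∀ x ∈ M.J, η ≤ ‖z - Γ x‖) :
    res (perturb M.A₁ X) z * M.integral Γ (fun μ => res (perturb M.A₁ X) μ * F μ) =
      res (perturb M.A₁ X) z * M.integral Γ (fun μ => (z - μ)⁻¹ • F μ) -
        M.integral Γ fun μ => (z - μ)⁻¹ • (res (perturb M.A₁ X) μ * F μ) := by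
  have hd := hs.d₀_pos
  set R := res (perturb M.A₁ X) with hR
  have d1 := hF.res_mul h hs hX
  have d2 := hF.cauchy h hη hzη
  have d3 := d1.cauchy h hη hzη
  have d4 : M.IsDominated Γ (‖R z‖ * (C * η⁻¹)) fun μ => R z * ((z - μ)⁻¹ • F μ) :=
    ⟨continuousOn_const.mul d2.continuousOn, fun x hx => by
      calc _ ≤ ‖R z‖ * ‖(z - Γ x)⁻¹ • F (Γ x)‖ := norm_mul_le _ _
        _ ≤ ‖R z‖ * (C * η⁻¹ * ‖M.K' (Γ x)‖) := by gcongr; exact d2.norm_le x hx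
        _ = _ := by ring⟩
  rw [← d1.integral_mul_left h, ← d2.integral_mul_left h, ← d4.integral_sub d3 h]
  refine integral_congr fun x hx => ?_
  have h1 := res_sub_res hz (norm_res_le_two_div hd hX.le hx).1
  have h2 : z - Γ x ≠ 0 := by
    rw [← norm_pos_iff]
    exact hη.trans_le (hzη x hx)
  have h3 : R z * R (Γ x) = (z - Γ x)⁻¹ • (R z - R (Γ x)) := by
    rw [h1, inv_smul_smul₀ h2]
  change R z * (R (Γ x) * F (Γ x)) = _
  rw [← mul_assoc, h3, smul_mul_assoc, sub_mul, smul_sub, mul_smul_comm]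

/-- Cauchy transforms along `Γ` are holomorphic away from `Γ`. -/
theorem IsDominated.differentiableOn_cauchy (hF : M.IsDominated Γ C F) (h : M.IsPath l Γ)
    {U : Set ℂ} (hU : IsOpen U) {η : ℝ} (hη : 0 < η) (hz : ∀ z ∈ U, ∀ x ∈ M.J, η ≤ ‖z - Γ x‖) :
    DifferentiableOn ℂ (fun z => M.integral Γ fun μ => (z - μ)⁻¹ • F μ) U := by
  intro z₀ hz₀
  obtain ⟨r, hr, hball⟩ := Metric.isOpen_iff.1 hU z₀ hz₀
  refine (differentiableAt_integral_of_bounded (ν := volume.restrict M.J)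
    (G := fun z x => deriv Γ x • (z - Γ x)⁻¹ • F (Γ x)) hr
    (h.finite_variation.const_mul (C * η⁻¹)) (fun w hw => ?_) ?_ ?_).differentiableWithinAt
  · exact ((hF.cauchy h hη (hz w (hball hw))).integrableOn h).aestronglyMeasurable
  · filter_upwards [ae_restrict_mem M.isOpen_J.measurableSet] with x hx
    have h1 : DifferentiableOn ℂ (fun w => (w - Γ x)⁻¹) (Metric.ball z₀ r) :=
      DifferentiableOn.inv (by fun_prop) fun w hw =>
        norm_pos_iff.1 (hη.trans_le (hz w (hball hw) x hx))
    exact (h1.smul (differentiableOn_const (F (Γ x)))).const_smul (deriv Γ x)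
  · filter_upwards [ae_restrict_mem M.isOpen_J.measurableSet] with x hx w hw
    have h1 := (hF.cauchy h hη (hz w (hball hw))).norm_le x hx
    rw [norm_smul]
    calc _ ≤ ‖deriv Γ x‖ * (C * η⁻¹ * ‖M.K' (Γ x)‖) := by gcongr
      _ = _ := by ring

end Dominated

end Model

/-! ### Factorization of `M₁` and similarity of the two effective operators -/

namespace Model

variable {H₀ H₁ : Type*} [NormedAddCommGroup H₀] [InnerProductSpace ℂ H₀] [CompleteSpace H₀]
  [NormedAddCommGroup H₁] [InnerProductSpace ℂ H₁] [CompleteSpace H₁]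
variable {M : Model H₀ H₁} {l : ℤˣ} {Γ : ℝ → ℂ} {X Y : H₁ →L[ℂ] H₁}

/-- The overlap operator of the perturbations `X` and `Y`. -/
def overlap (M : Model H₀ H₁) (Γ : ℝ → ℂ) (X Y : H₁ →L[ℂ] H₁) : H₁ →L[ℂ] H₁ :=
  M.integral Γ fun μ => res (perturb M.A₁ Y) μ * M.K' μ * res (perturb M.A₁ X) μ

/-- The factor `W(z) = M₁(z) (A₁ + X - z)⁻¹`. -/
def rightFactor (M : Model H₀ H₁) (Γ : ℝ → ℂ) (X : H₁ →L[ℂ] H₁) (z : ℂ) : H₁ →L[ℂ] H₁ :=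
  1 + M.integral Γ fun μ => (z - μ)⁻¹ • (M.K' μ * res (perturb M.A₁ X) μ)

/-- The Cauchy transform of the integrand of the overlap operator. -/
def overlapCauchy (M : Model H₀ H₁) (Γ : ℝ → ℂ) (X Y : H₁ →L[ℂ] H₁) (z : ℂ) : H₁ →L[ℂ] H₁ :=
  M.integral Γ fun μ =>
    (z - μ)⁻¹ • (res (perturb M.A₁ Y) μ * M.K' μ * res (perturb M.A₁ X) μ)

namespace IsSolutionPair

variable (h : M.IsSolutionPair l Γ X Y)
include h

theorem isDominated_mul_res : M.IsDominated Γ (1 * (2 / M.d₀ Γ)) fun μ =>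
    M.K' μ * res (perturb M.A₁ X) μ :=
  (isDominated_K' h.isPath).mul_res h.isPath h.isSmall h.norm_fst_lt

theorem isDominated_res_mul : M.IsDominated Γ (1 * (2 / M.d₀ Γ)) fun μ =>
    res (perturb M.A₁ Y) μ * M.K' μ :=
  (isDominated_K' h.isPath).res_mul h.isPath h.isSmall h.norm_snd_lt

theorem isDominated_res_mul_res : M.IsDominated Γ (1 * (2 / M.d₀ Γ) * (2 / M.d₀ Γ)) fun μ =>
    res (perturb M.A₁ Y) μ * M.K' μ * res (perturb M.A₁ X) μ :=
  h.isDominated_res_mul.mul_res h.isPath h.isSmall h.norm_fst_lt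

theorem norm_overlap_lt_one : ‖M.overlap Γ X Y‖ < 1 := by
  refine (h.isPath.norm_integral_le h.isDominated_res_mul_res.norm_le).trans_lt ?_
  rw [one_mul, ← sq]
  exact h.isSmall.contraction_lt_one

theorem isUnit_one_add_overlap : IsUnit (1 + M.overlap Γ X Y) := by
  have h1 : ‖-M.overlap Γ X Y‖ < 1 := by
    rw [norm_neg]
    exact h.norm_overlap_lt_one
  have h2 := isUnit_one_sub_of_norm_lt_one h1
  rwa [sub_neg_eq_add] at h2

section Identities

variable {z : ℂ} {η : ℝ} (hη : 0 < η) (hzη : ∀ x ∈ M.J, η ≤ ‖z - Γ x‖)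
include hη hzη

theorem fst_mul_res (hz : z ∉ spec (perturb M.A₁ X)) :
    X * res (perturb M.A₁ X) z =
      M.V₁ z Γ * res (perturb M.A₁ X) z - (M.rightFactor Γ X z - 1) := by
  have h1 := (isDominated_K' h.isPath).integral_mul_res_mul_res h.isPath h.isSmall h.norm_fst_lt
    hz hη hzη
  rw [← h.eq_fst] at h1
  rw [h1, rightFactor, add_sub_cancel_left]
  rfl

/-- `M₁(z)` is `A₁ + X - z` plus the bounded operator `V₁(z) - X`, and by the equation for `X` the
Neumann factor `1 + (V₁(z) - X) R(z)` is exactly `W(z)`. -/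
theorem isBoundedInverse_M₁ (hz : z ∉ spec (perturb M.A₁ X)) (hW : IsUnit (M.rightFactor Γ X z)) :
    IsBoundedInverse (M.M₁ z Γ)
      (res (perturb M.A₁ X) z * Ring.inverse (M.rightFactor Γ X z)) := by
  have h1 := h.fst_mul_res hη hzη hz
  have h2 : 1 + (M.V₁ z Γ - X) * res (perturb M.A₁ X) z = M.rightFactor Γ X z := by
    rw [sub_mul, h1]
    abel
  have h3 := (isBoundedInverse_res hz).perturb (S := M.V₁ z Γ - X) (by rwa [h2])
  rw [h2, shift_perturb, perturb_perturb, add_sub_cancel] at h3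
  exact h3

/-- The second product needs only the splitting of `R'(z) R'(μ)` under the integral for `Ω`. The
first one also needs the second resolvent identity between `X` and `Y`: once both equations are
substituted into it, `V₁(z)` cancels and `R + Q R = R' W` remains. -/
theorem one_add_overlap_mul_res (hz : z ∉ spec (perturb M.A₁ X))
    (hz' : z ∉ spec (perturb M.A₁ Y)) :
    (1 + M.overlap Γ X Y) * res (perturb M.A₁ X) z =
      res (perturb M.A₁ Y) z * M.rightFactor Γ X z - M.overlapCauchy Γ X Y z ∧
    res (perturb M.A₁ Y) z * (1 + M.overlap Γ X Y) =
      res (perturb M.A₁ Y) z * M.rightFactor Γ X z - M.overlapCauchy Γ X Y z := by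
  set R := res (perturb M.A₁ X) z with hR
  set R' := res (perturb M.A₁ Y) z with hR'
  set W := M.rightFactor Γ X z with hW
  set V := M.V₁ z Γ with hV
  set Q := M.integral Γ fun μ => (z - μ)⁻¹ • (res (perturb M.A₁ Y) μ * M.K' μ) with hQ
  set N := M.overlapCauchy Γ X Y z with hN
  have e1 : X * R = V * R - (W - 1) := h.fst_mul_res hη hzη hz
  have e2 : R' * Y = R' * V - Q := by
    have := (isDominated_K' h.isPath).res_mul_integral_res_mul h.isPath h.isSmall h.norm_snd_lt
      hz' hη hzη
    rw [← h.eq_snd] at this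
    exact this
  have e3 : M.overlap Γ X Y * R = Q * R - N :=
    h.isDominated_res_mul.integral_mul_res_mul_res h.isPath h.isSmall h.norm_fst_lt hz hη hzη
  have e4 : R' * M.overlap Γ X Y = R' * (W - 1) - N := by
    have := h.isDominated_mul_res.res_mul_integral_res_mul h.isPath h.isSmall h.norm_snd_lt
      hz' hη hzη
    simp only [← mul_assoc] at this
    rw [hW, rightFactor, add_sub_cancel_left]
    exact this
  have e5 : R' - R = R' * (X - Y) * R := res_perturb_sub_res_perturb hz' hz
  have e6 : R + Q * R = R' * W := by
    have e7 : R' * (X - Y) * R = R' * (X * R) - (R' * Y) * R := by noncomm_ring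
    rw [e7, e1, e2] at e5
    have e8 : R' = R + (R' * (V * R - (W - 1)) - (R' * V - Q) * R) := by rw [← e5]; abel
    calc R + Q * R = R + (R' * (V * R - (W - 1)) - (R' * V - Q) * R) + R' * (W - 1) := by
          noncomm_ring
      _ = R' + R' * (W - 1) := by rw [← e8]
      _ = R' * W := by noncomm_ring
  refine ⟨?_, ?_⟩
  · rw [add_mul, one_mul, e3, ← e6]
    abel
  · rw [mul_add, mul_one, e4]
    noncomm_ring

end Identities

theorem mem_graph_iff {u v : H₁} : (u, v) ∈ (perturb M.A₁ X).graph ↔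
    ((1 + M.overlap Γ X Y) u, (1 + M.overlap Γ X Y) v) ∈ (perturb M.A₁ Y).graph := by
  set t : ℝ := ‖X‖ + ‖Y‖ + 1 with ht
  have ht0 : 0 < t := by positivity
  -- A point of the imaginary axis in the half-plane opposite to `D^l`, at height above both norms:
  -- it lies in both resolvent sets and at distance at least `t` from `Γ`.
  set z : ℂ := ((-(((l : ℤ) : ℝ) * t) : ℝ) : ℂ) * Complex.I with hz
  have hzim : z.im = -(((l : ℤ) : ℝ) * t) := by
    rw [hz, Complex.im_ofReal_mul, Complex.I_im, mul_one]
  have hl : ((l : ℤ) : ℝ) * ((l : ℤ) : ℝ) = 1 := by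
    rcases Int.units_eq_one_or l with rfl | rfl <;> simp
  have hl1 : |((l : ℤ) : ℝ)| = 1 := by
    rcases Int.units_eq_one_or l with rfl | rfl <;> simp
  have hres := norm_res_le M.isSelfAdjoint₁ ht0 (z := z) fun s hs => by
    have h1 := Complex.abs_im_le_norm (z - s)
    rw [Complex.sub_im, M.spec_im hs, sub_zero, hzim, abs_neg, abs_mul, hl1, one_mul,
      abs_of_pos ht0] at h1
    exact h1
  have hX : z ∉ spec (perturb M.A₁ X) := (notMem_spec_perturb hres.1 hres.2
    (by linarith [norm_nonneg Y])).1
  have hY : z ∉ spec (perturb M.A₁ Y) := (notMem_spec_perturb hres.1 hres.2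
    (by linarith [norm_nonneg X])).1
  have hzη : ∀ x ∈ M.J, t ≤ ‖z - Γ x‖ := fun x hx => by
    have h1 := M.im_of_mem_D (h.isPath.mapsTo hx)
    have h2 := Complex.abs_im_le_norm (z - Γ x)
    have h3 : |(z - Γ x).im| = t + ((l : ℤ) : ℝ) * (Γ x).im := by
      have h4 : (z - Γ x).im = -((l : ℤ) : ℝ) * (t + ((l : ℤ) : ℝ) * (Γ x).im) := by
        rw [Complex.sub_im, hzim]
        linear_combination (Γ x).im * hl
      rw [h4, abs_mul, abs_neg, hl1, one_mul, abs_of_pos (by linarith)]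
    linarith
  have h1 := h.one_add_overlap_mul_res ht0 hzη hX hY
  exact perturb_mem_graph_iff_mul hX h.isUnit_one_add_overlap hY (h1.1.trans h1.2.symm)

theorem spec_eq : spec (perturb M.A₁ X) = spec (perturb M.A₁ Y) :=
  spec_eq_of_similar h.isUnit_one_add_overlap fun _ _ => h.mem_graph_iff

/-- The constant `η` with `2 V / d < η < d / 2`. -/
theorem margin : 0 < M.variation Γ / M.d₀ Γ + M.d₀ Γ / 4 ∧
    M.variation Γ / M.d₀ Γ + M.d₀ Γ / 4 < M.d₀ Γ / 2 ∧
    2 / M.d₀ Γ * M.variation Γ < M.variation Γ / M.d₀ Γ + M.d₀ Γ / 4 := by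
  have hd := h.isSmall.d₀_pos
  have hV : 0 ≤ M.variation Γ := variation_nonneg
  -- The constant is the arithmetic mean of `2 V / d₀` and `d₀ / 2`, so all inequalities reduce to
  -- this one.
  have h1 : M.variation Γ / M.d₀ Γ < M.d₀ Γ / 4 := by
    have h2 : M.variation Γ < M.d₀ Γ ^ 2 / 4 := h.isSmall
    rw [div_lt_iff₀ hd]
    nlinarith
  have h3 : 2 / M.d₀ Γ * M.variation Γ = 2 * (M.variation Γ / M.d₀ Γ) := by ring
  have h4 : 0 ≤ M.variation Γ / M.d₀ Γ := by positivity
  exact ⟨by positivity, by linarith, by linarith⟩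

end IsSolutionPair

/-- An open neighbourhood of `𝒪` on which `M₁(z) (A₁ + X - z)⁻¹` is invertible. -/
def openNbhd (M : Model H₀ H₁) (Γ : ℝ → ℂ) : Set ℂ :=
  {z | Metric.infDist z (spec M.A₁) < M.d₀ Γ - (M.variation Γ / M.d₀ Γ + M.d₀ Γ / 4)}

theorem isOpen_openNbhd : IsOpen (M.openNbhd Γ) :=
  isOpen_lt (Metric.continuous_infDist_pt _) continuous_const

namespace IsSolutionPair

variable (h : M.IsSolutionPair l Γ X Y)
include h

theorem nbhd_subset : M.nbhd Γ ⊆ M.openNbhd Γ := fun z hz => by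
  have h1 : Metric.infDist z (spec M.A₁) ≤ M.d₀ Γ / 2 := hz
  have h2 := h.margin.2.1
  change Metric.infDist z (spec M.A₁) < _
  linarith

theorem margin_le {z : ℂ} (hz : z ∈ M.openNbhd Γ) {x : ℝ} (hx : x ∈ M.J) :
    M.variation Γ / M.d₀ Γ + M.d₀ Γ / 4 ≤ ‖z - Γ x‖ := by
  have h1 : Metric.infDist z (spec M.A₁) < _ := hz
  have h2 : M.d₀ Γ ≤ Metric.infDist (Γ x) (spec M.A₁) :=
    (Metric.le_infDist h.isSmall.spec_nonempty).2 fun _ hs => d₀_le hs hx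
  have h3 : Metric.infDist (Γ x) (spec M.A₁) ≤ Metric.infDist z (spec M.A₁) + dist (Γ x) z :=
    Metric.infDist_le_infDist_add_dist
  rw [dist_comm, dist_eq_norm] at h3
  linarith

/-- At distance at least `η` from `Γ` one has `‖W(z) - 1‖ ≤ (2 V / d₀) / η`, and `η` was chosen
above `2 V / d₀`. -/
theorem isUnit_rightFactor {z : ℂ} (hz : z ∈ M.openNbhd Γ) : IsUnit (M.rightFactor Γ X z) := by
  obtain ⟨h1, h2, h3⟩ := h.margin
  set η := M.variation Γ / M.d₀ Γ + M.d₀ Γ / 4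
  have h4 := (h.isDominated_mul_res.cauchy h.isPath h1 fun x hx => h.margin_le hz hx).norm_le
  have h5 : ‖-(M.integral Γ fun μ => (z - μ)⁻¹ • (M.K' μ * res (perturb M.A₁ X) μ))‖ < 1 := by
    rw [norm_neg]
    refine (h.isPath.norm_integral_le h4).trans_lt ?_
    calc 1 * (2 / M.d₀ Γ) * η⁻¹ * M.variation Γ = 2 / M.d₀ Γ * M.variation Γ / η := by ring
      _ < 1 := (div_lt_one h1).2 h3
  have h6 := isUnit_one_sub_of_norm_lt_one h5
  rwa [sub_neg_eq_add] at h6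

/-- The part of `(1 + Ω) M₁(z)⁻¹` that is holomorphic near `𝒪`. -/
theorem differentiableOn_overlapCauchy_mul_inverse :
    DifferentiableOn ℂ (fun z => M.overlapCauchy Γ X Y z * Ring.inverse (M.rightFactor Γ X z))
      (M.openNbhd Γ) := by
  have h1 := h.isDominated_res_mul_res.differentiableOn_cauchy h.isPath isOpen_openNbhd h.margin.1
    fun z hz x hx => h.margin_le hz hx
  have h2 : DifferentiableOn ℂ (M.rightFactor Γ X) (M.openNbhd Γ) :=
    (h.isDominated_mul_res.differentiableOn_cauchy h.isPath isOpen_openNbhd h.margin.1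
      fun z hz x hx => h.margin_le hz hx).const_add 1
  refine h1.mul fun z hz => ?_
  exact ((differentiableAt_inverse (h.isUnit_rightFactor hz)).comp z
    ((h2 z hz).differentiableAt (isOpen_openNbhd.mem_nhds hz))).differentiableWithinAt

theorem isBoundedInverse_M₁_of_mem {z : ℂ} (hz : z ∈ M.openNbhd Γ)
    (hz' : z ∉ spec (perturb M.A₁ X)) : IsBoundedInverse (M.M₁ z Γ)
      (res (perturb M.A₁ X) z * Ring.inverse (M.rightFactor Γ X z)) :=
  h.isBoundedInverse_M₁ h.margin.1 (fun _ hx => h.margin_le hz hx) hz' (h.isUnit_rightFactor hz)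

/-- This isolates the singular part of `M₁(z)⁻¹` near `𝒪`: the subtracted term is holomorphic there
and drops out of every contour integral. -/
theorem boundedInverse_M₁ {z : ℂ} (hz : z ∈ M.openNbhd Γ) (hz' : z ∉ spec (perturb M.A₁ X)) :
    boundedInverse (M.M₁ z Γ) = Ring.inverse (1 + M.overlap Γ X Y) *
      (res (perturb M.A₁ Y) z -
        M.overlapCauchy Γ X Y z * Ring.inverse (M.rightFactor Γ X z)) := by
  have h1 := (h.one_add_overlap_mul_res h.margin.1 (fun _ hx => h.margin_le hz hx) hz'
    (by rwa [← h.spec_eq])).1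
  have hW := Ring.mul_inverse_cancel _ (h.isUnit_rightFactor hz)
  have hS := Ring.inverse_mul_cancel _ h.isUnit_one_add_overlap
  rw [(h.isBoundedInverse_M₁_of_mem hz hz').boundedInverse_eq]
  have h2 : res (perturb M.A₁ Y) z -
      M.overlapCauchy Γ X Y z * Ring.inverse (M.rightFactor Γ X z) =
      (1 + M.overlap Γ X Y) * res (perturb M.A₁ X) z * Ring.inverse (M.rightFactor Γ X z) := by
    rw [h1, sub_mul, mul_assoc, hW, mul_one]
  rw [h2, mul_assoc (1 + _), ← mul_assoc, hS, one_mul]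

end IsSolutionPair

end Model

/-! ### Closed curves homologous to a circle -/

section ClosedCurves

variable {E F : Type*} [NormedAddCommGroup E] [NormedSpace ℂ E] [NormedAddCommGroup F]
  [NormedSpace ℂ F]

theorem isCycle_of_isClosedCurve {ι : Type*} [Fintype ι] {γ : ι → ℝ → ℂ} {U : Set ℂ}
    (hc : ∀ i, IsClosedCurve (γ i)) (hm : ∀ i, ∀ t ∈ Icc (0 : ℝ) 1, γ i t ∈ U) :
    IsCycle U γ (fun _ => 0) (fun _ => 1) := by
  have h01 : uIcc (0 : ℝ) 1 = Icc 0 1 := uIcc_of_le zero_le_one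
  refine ⟨fun i => ?_, fun i => ?_, fun g => Finset.sum_eq_zero fun i _ => ?_⟩
  · rw [h01]
    exact (hc i).1
  · rw [h01]
    exact hm i
  · rw [(hc i).2, sub_self]

theorem IsCycle.chainIntegral_clm_comp [CompleteSpace E] [CompleteSpace F] {ι : Type*} [Fintype ι]
    {γ : ι → ℝ → ℂ} {a b : ι → ℝ} {U : Set ℂ} (h : IsCycle U γ a b) {f : ℂ → E}
    (hf : ContinuousOn f U) (L : E →L[ℂ] F) :
    chainIntegral γ a b (fun z => L (f z)) = L (chainIntegral γ a b f) := by
  rw [chainIntegral, chainIntegral, map_sum]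
  refine Finset.sum_congr rfl fun i _ => ?_
  simp only [← L.map_smul]
  exact L.intervalIntegral_comp_comm (h.intervalIntegrable hf i)

theorem sum_contourIntegral {n : ℕ} (γ : Fin n → ℝ → ℂ) (f : ℂ → E) :
    ∑ i, contourIntegral (γ i) f = chainIntegral γ (fun _ => 0) (fun _ => 1) f := rfl

theorem sum_winding {n : ℕ} (γ : Fin n → ℝ → ℂ) (w : ℂ) :
    ∑ i, winding (γ i) w = (2 * Real.pi * Complex.I)⁻¹ *
      chainIntegral γ (fun _ => 0) (fun _ => 1) fun z => (z - w)⁻¹ := by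
  simp only [winding, ← Finset.mul_sum, ← sum_contourIntegral]

/-- The index `none` carries the circle, run backwards from `2π` to `0`, so that the difference of
the two contours is a single cycle. -/
theorem chainIntegral_option {n : ℕ} (γ : Fin n → ℝ → ℂ) (c : ℂ) (ρ : ℝ) (f : ℂ → E) :
    chainIntegral (fun o : Option (Fin n) => o.elim (circleMap c ρ) γ)
      (fun o => o.elim (2 * Real.pi) fun _ => 0) (fun o => o.elim 0 fun _ => 1) f =
      -(∮ z in C(c, ρ), f z) + chainIntegral γ (fun _ => 0) (fun _ => 1) f := by
  rw [chainIntegral, Fintype.sum_option]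
  change (∫ t in (2 * Real.pi)..0, deriv (circleMap c ρ) t • f (circleMap c ρ t)) + _ = _
  rw [intervalIntegral.integral_symm]
  rfl

/-- Closed curves homologous to a circle in the domain of `f`. -/
theorem chainIntegral_eq_circleIntegral [CompleteSpace E] {n : ℕ} {γ : Fin n → ℝ → ℂ} {U : Set ℂ}
    (hU : IsOpen U) (h : IsCycle U γ (fun _ => 0) (fun _ => 1)) {c : ℂ} {ρ : ℝ} (hρ : 0 ≤ ρ)
    (hc : Metric.sphere c ρ ⊆ U)
    (hw : ∀ w ∉ U, chainIntegral γ (fun _ => 0) (fun _ => 1) (fun z => (z - w)⁻¹) =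
      ∮ z in C(c, ρ), (z - w)⁻¹) {f : ℂ → E} (hf : DifferentiableOn ℂ f U) :
    chainIntegral γ (fun _ => 0) (fun _ => 1) f = ∮ z in C(c, ρ), f z := by
  let γ' : Option (Fin n) → ℝ → ℂ := fun o => o.elim (circleMap c ρ) γ
  let a : Option (Fin n) → ℝ := fun o => o.elim (2 * Real.pi) fun _ => 0
  let b : Option (Fin n) → ℝ := fun o => o.elim 0 fun _ => 1
  have hcyc : IsCycle U γ' a b := by
    refine ⟨?_, ?_, fun g => ?_⟩
    · rintro (_ | i)
      · exact ⟨_, (lipschitzWith_circleMap c ρ).lipschitzOnWith⟩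
      · exact h.lipschitz i
    · rintro (_ | i)
      · exact fun t _ => hc (circleMap_mem_sphere c hρ t)
      · exact h.mem i
    · rw [Fintype.sum_option]
      change g (circleMap c ρ 0) - g (circleMap c ρ (2 * Real.pi)) +
        ∑ i, (g (γ i 1) - g (γ i 0)) = 0
      rw [h.boundary g, (periodic_circleMap c ρ).eq, sub_self, add_zero]
  have hzero := hcyc.chainIntegral_eq_zero hU hf fun w hwU => by
    rw [chainIntegral_option, hw w hwU, neg_add_cancel]
  rw [chainIntegral_option] at hzero
  exact (neg_add_eq_zero.1 hzero).symm

end ClosedCurves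

/-! ### Contour integrals of the inverse of `M₁` and their strong limits -/

namespace Model

variable {H₀ H₁ : Type*} [NormedAddCommGroup H₀] [InnerProductSpace ℂ H₀] [CompleteSpace H₀]
  [NormedAddCommGroup H₁] [InnerProductSpace ℂ H₁] [CompleteSpace H₁]
variable {M : Model H₀ H₁} {l : ℤˣ} {Γ : ℝ → ℂ} {X Y : H₁ →L[ℂ] H₁}

theorem ofReal_re_spec {s : ℂ} (hs : s ∈ spec M.A₁) : (s.re : ℂ) = s :=
  Complex.ext (Complex.ofReal_re _) ((Complex.ofReal_im _).trans (M.spec_im hs).symm)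

theorem half_lt_abs_sub {a : ℝ} (ha : ∀ z ∈ M.nbhd Γ, z.re ≠ a) {s : ℂ} (hs : s ∈ spec M.A₁) :
    M.d₀ Γ / 2 < |s.re - a| := by
  by_contra! hle
  refine ha a ?_ (Complex.ofReal_re a)
  have h1 : Metric.infDist (a : ℂ) (spec M.A₁) ≤ dist (a : ℂ) s := Metric.infDist_le_dist_of_mem hs
  refine h1.trans ?_
  rw [← ofReal_re_spec hs, dist_comm, dist_eq_norm, ← Complex.ofReal_sub, Complex.norm_real]
  exact hle

/-- The circle on the diameter `[a, b]` meets the real axis at `a` and `b` only, so for real `s` the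
right-hand side is the distance from `s` to one of these points. -/
theorem half_le_abs_norm_sub {a b : ℝ} (ha : ∀ z ∈ M.nbhd Γ, z.re ≠ a ∧ z.re ≠ b) {s : ℂ}
    (hs : s ∈ spec M.A₁) : M.d₀ Γ / 2 ≤ |‖s - ((a + b) / 2 : ℝ)‖ - (b - a) / 2| := by
  have h1 := half_lt_abs_sub (fun z hz => (ha z hz).1) hs
  have h2 := half_lt_abs_sub (fun z hz => (ha z hz).2) hs
  rw [← ofReal_re_spec hs, ← Complex.ofReal_sub, Complex.norm_real, Real.norm_eq_abs]
  rcases le_total 0 (s.re - (a + b) / 2) with h | h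
  · rw [abs_of_nonneg h]
    refine h2.le.trans (le_of_eq (congrArg _ ?_))
    ring
  · rw [abs_of_nonpos h]
    refine h1.le.trans (le_of_eq ?_)
    rw [← abs_neg]
    refine congrArg _ ?_
    ring

namespace IsSolutionPair

variable (h : M.IsSolutionPair l Γ X Y)
include h

theorem exists_dist_lt {w : ℂ} (hw : w ∈ spec (perturb M.A₁ Y)) :
    ∃ s ∈ spec M.A₁, dist w s < M.d₀ Γ / 2 := by
  by_contra! hle
  obtain ⟨h1, h2⟩ := norm_res_le M.isSelfAdjoint₁ (half_pos h.isSmall.d₀_pos) (z := w)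
    fun s hs => by rw [← dist_eq_norm]; exact hle s hs
  exact (notMem_spec_perturb h1 h2 h.norm_snd_lt).1 hw

theorem spec_subset_nbhd : spec (perturb M.A₁ Y) ⊆ M.nbhd Γ := fun w hw => by
  obtain ⟨s, hs, hlt⟩ := h.exists_dist_lt hw
  exact (Metric.infDist_le_dist_of_mem hs).trans hlt.le

theorem mem_ball_of_mem_strip {a b : ℝ} (ha : ∀ z ∈ M.nbhd Γ, z.re ≠ a ∧ z.re ≠ b) {w : ℂ}
    (hw : w ∈ spec (perturb M.A₁ Y)) (hab : w ∈ strip a b) :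
    w ∈ Metric.ball (((a + b) / 2 : ℝ) : ℂ) ((b - a) / 2) := by
  obtain ⟨s, hs, hlt⟩ := h.exists_dist_lt hw
  have h1 := half_lt_abs_sub (fun z hz => (ha z hz).1) hs
  have h2 := half_lt_abs_sub (fun z hz => (ha z hz).2) hs
  have h3 : |w.re - s.re| < M.d₀ Γ / 2 := by
    refine lt_of_le_of_lt ?_ hlt
    rw [dist_eq_norm, ← Complex.sub_re]
    exact Complex.abs_re_le_norm _
  obtain ⟨hwa, hwb⟩ : a < w.re ∧ w.re < b := hab
  obtain ⟨h4, h5⟩ := abs_lt.1 h3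
  have h6 : M.d₀ Γ / 2 < s.re - a := by
    rcases lt_abs.1 h1 with h | h <;> linarith
  have h7 : M.d₀ Γ / 2 < b - s.re := by
    rcases lt_abs.1 h2 with h | h <;> linarith
  rw [Metric.mem_ball]
  have h8 : dist s (((a + b) / 2 : ℝ) : ℂ) < (b - a) / 2 - M.d₀ Γ / 2 := by
    rw [← ofReal_re_spec hs, dist_eq_norm, ← Complex.ofReal_sub, Complex.norm_real,
      Real.norm_eq_abs, abs_lt]
    constructor <;> linarith
  linarith [dist_triangle w s (((a + b) / 2 : ℝ) : ℂ)]

/-- Closed curves in `𝒪` do not wind about points outside its open neighbourhood. -/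
theorem chainIntegral_eq_zero {E : Type*} [NormedAddCommGroup E] [NormedSpace ℂ E]
    [CompleteSpace E] {ι : Type*} [Fintype ι] {γ : ι → ℝ → ℂ} {a b : ι → ℝ}
    (hγ : IsCycle (M.nbhd Γ) γ a b) {g : ℂ → E} (hg : DifferentiableOn ℂ g (M.openNbhd Γ)) :
    chainIntegral γ a b g = 0 := by
  have hsub := h.nbhd_subset
  have hcyc := hγ.mono (hγ.support_subset.trans hsub)
  refine hcyc.chainIntegral_eq_zero isOpen_openNbhd hg fun w hw => ?_
  -- Since `σ(A₁)` is real, distances to it do not decrease when a point moves vertically away from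
  -- the real axis. Hence the vertical ray leaving `w` outwards misses `𝒪` and can serve as a branch
  -- cut.
  have hdist : ∀ z ∈ M.nbhd Γ, z.re = w.re → |w.im| ≤ |z.im| → False := by
    intro z hz hre him
    have h1 : Metric.infDist z (spec M.A₁) ≤ M.d₀ Γ / 2 := hz
    refine hw (h.nbhd_subset (?_ : Metric.infDist w (spec M.A₁) ≤ M.d₀ Γ / 2))
    refine le_trans ?_ h1
    refine (Metric.le_infDist h.isSmall.spec_nonempty).2 fun s hs => ?_
    refine (Metric.infDist_le_dist_of_mem hs).trans ?_
    rw [Complex.dist_eq_re_im, Complex.dist_eq_re_im, hre, M.spec_im hs, sub_zero, sub_zero]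
    exact Real.sqrt_le_sqrt (by linarith [sq_le_sq.2 him])
  have hslit : ∀ z : ℂ, z ∉ Complex.slitPlane → z.re ≤ 0 ∧ z.im = 0 := fun z hz => by
    rw [Complex.mem_slitPlane_iff] at hz
    push Not at hz
    exact hz
  rcases le_total 0 w.im with him | him
  · refine hcyc.winding_eq_zero_of_slitPlane (θ := Complex.I) fun z hz => ?_
    by_contra hz'
    obtain ⟨h1, h2⟩ := hslit _ hz'
    simp only [Complex.mul_re, Complex.I_re, Complex.I_im, Complex.sub_re, Complex.sub_im,
      Complex.mul_im] at h1 h2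
    refine hdist z (hγ.support_subset hz) (by linarith) ?_
    rw [abs_of_nonneg him, abs_of_nonneg (by linarith)]
    linarith
  · refine hcyc.winding_eq_zero_of_slitPlane (θ := -Complex.I) fun z hz => ?_
    by_contra hz'
    obtain ⟨h1, h2⟩ := hslit _ hz'
    simp only [Complex.mul_re, Complex.I_re, Complex.I_im, Complex.sub_re, Complex.sub_im,
      Complex.mul_im, Complex.neg_re, Complex.neg_im] at h1 h2
    refine hdist z (hγ.support_subset hz) (by linarith) ?_
    rw [abs_of_nonpos him, abs_of_nonpos (by linarith)]
    linarith

/-- The curves and the circle on the diameter `[a, b]` are homologous in the resolvent set: both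
wind once about the spectral points in the strip, which lie inside the circle, and neither winds
about the others, from which a horizontal ray escapes. -/
theorem cauchyIntegral_res {a b : ℝ} (hab : a < b)
    (ha : ∀ z ∈ M.nbhd Γ, z.re ≠ a ∧ z.re ≠ b) {n : ℕ} {γ : Fin n → ℝ → ℂ}
    (hγ : IsContourAround (M.nbhd Γ ∩ strip a b) (spec (perturb M.A₁ X) ∩ strip a b) γ) (u : H₁) :
    cauchyIntegral γ (fun z => res (perturb M.A₁ Y) z u) =
      circleProj (perturb M.A₁ Y) ((a + b) / 2) ((b - a) / 2) u := by
  have hρ : 0 < (b - a) / 2 := by linarith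
  rw [h.spec_eq] at hγ
  have hsph : ∀ z ∈ Metric.sphere (((a + b) / 2 : ℝ) : ℂ) ((b - a) / 2),
      z ∉ spec (perturb M.A₁ Y) := fun z hz =>
    (res_perturb_on_sphere M.isSelfAdjoint₁ (fun _ => M.spec_im) h.norm_snd_lt
      (fun s hs => half_le_abs_norm_sub ha hs) hz).1
  have hcyc : IsCycle (M.nbhd Γ ∩ strip a b) γ (fun _ => 0) (fun _ => 1) :=
    isCycle_of_isClosedCurve hγ.isClosedCurve fun i t ht => (hγ.mem i t ht).1
  have hcyc' : IsCycle (spec (perturb M.A₁ Y))ᶜ γ (fun _ => 0) (fun _ => 1) :=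
    isCycle_of_isClosedCurve hγ.isClosedCurve fun i t ht hs =>
      (hγ.mem i t ht).2 ⟨hs, (hγ.mem i t ht).1.2⟩
  rw [cauchyIntegral, sum_contourIntegral, circleProj_apply hρ.le hsph]
  congr 1
  refine chainIntegral_eq_circleIntegral isOpen_compl_spec hcyc' hρ.le hsph ?_
    ((ContinuousLinearMap.apply ℂ H₁ u).differentiable.comp_differentiableOn differentiableOn_res)
  intro w hw
  rw [notMem_compl_iff] at hw
  by_cases hstrip : w ∈ strip a b
  · have h1 := hγ.winding w ⟨hw, hstrip⟩
    rw [sum_winding, inv_mul_eq_one₀ Complex.two_pi_I_ne_zero] at h1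
    rw [← h1, circleIntegral.integral_sub_inv_of_mem_ball (h.mem_ball_of_mem_strip ha hw hstrip)]
  · have h2 := ha w (h.spec_subset_nbhd hw)
    have h3 : w.re < a ∨ b < w.re := by
      by_contra! h4
      exact hstrip ⟨lt_of_le_of_ne h4.1 h2.1.symm, lt_of_le_of_ne h4.2 h2.2⟩
    have h5 : (b - a) / 2 < ‖w - ((a + b) / 2 : ℝ)‖ := by
      refine lt_of_lt_of_le ?_ (Complex.abs_re_le_norm _)
      rw [Complex.sub_re, Complex.ofReal_re, lt_abs]
      rcases h3 with h3 | h3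
      · right; linarith
      · left; linarith
    rw [circleIntegral_inv_sub_of_lt hρ.le h5]
    rcases h3 with h3 | h3
    · refine hcyc.winding_eq_zero_of_slitPlane (θ := 1) fun z hz => Or.inl ?_
      have h6 : a < z.re := (hcyc.support_subset hz).2.1
      rw [one_mul, Complex.sub_re]
      linarith
    · refine hcyc.winding_eq_zero_of_slitPlane (θ := -1) fun z hz => Or.inl ?_
      have h6 : z.re < b := (hcyc.support_subset hz).2.2
      rw [neg_one_mul, Complex.neg_re, Complex.sub_re]
      linarith

/-- The common form of both limits: the holomorphic part `g` integrates to zero, and the resolvent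
part becomes a circle integral tending to `v`. -/
theorem tendsto_cauchyIntegral {a b : ℕ → ℝ} {n : ℕ → ℕ} {γ : ∀ k, Fin (n k) → ℝ → ℂ}
    (ha : Tendsto a atTop atBot) (hb : Tendsto b atTop atTop)
    (hab : ∀ k, ∀ z ∈ M.nbhd Γ, z.re ≠ a k ∧ z.re ≠ b k)
    (hγ : ∀ k, IsContourAround (M.nbhd Γ ∩ strip (a k) (b k))
      (spec (perturb M.A₁ X) ∩ strip (a k) (b k)) (γ k)) {f g : ℂ → H₁} {L : H₁ →L[ℂ] H₁} {v : H₁}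
    (hf : ∀ z ∈ M.nbhd Γ, z ∉ spec (perturb M.A₁ X) →
      f z = L (res (perturb M.A₁ Y) z v - g z))
    (hg : DifferentiableOn ℂ g (M.openNbhd Γ)) :
    Tendsto (fun k => cauchyIntegral (γ k) f) atTop (𝓝 (L v)) := by
  have hlim := tendsto_circleProj M.isSelfAdjoint₁ (fun _ => M.spec_im) h.norm_snd_lt ha hb
    (fun k s hs => half_le_abs_norm_sub (hab k) hs) v
  refine ((L.continuous.tendsto v).comp hlim).congr' ?_
  -- The inequality `a k < b k` holds only for large `k`, when `0` separates the two.
  filter_upwards [ha.eventually_lt_atBot 0, hb.eventually_gt_atTop 0] with k h1 h2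
  have hmem : ∀ i, ∀ t ∈ Icc (0 : ℝ) 1,
      γ k i t ∈ M.nbhd Γ \ spec (perturb M.A₁ Y) := fun i t ht =>
    ⟨((hγ k).mem i t ht).1.1, fun hs => ((hγ k).mem i t ht).2
      ⟨by rwa [h.spec_eq], ((hγ k).mem i t ht).1.2⟩⟩
  have hcyc := isCycle_of_isClosedCurve (hγ k).isClosedCurve hmem
  have hcyc' := hcyc.mono (hcyc.support_subset.trans sdiff_subset)
  have hc1 : ContinuousOn (fun z => res (perturb M.A₁ Y) z v)
      (M.nbhd Γ \ spec (perturb M.A₁ Y)) :=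
    (ContinuousLinearMap.apply ℂ H₁ v).continuous.comp_continuousOn
      (continuousOn_res fun z hz => hz.2)
  have hc2 : ContinuousOn g (M.nbhd Γ \ spec (perturb M.A₁ Y)) :=
    hg.continuousOn.mono fun z hz => h.nbhd_subset hz.1
  change L (circleProj (perturb M.A₁ Y) ((a k + b k) / 2) ((b k - a k) / 2) v) = _
  rw [← h.cauchyIntegral_res (h1.trans h2) (hab k) (hγ k), cauchyIntegral, cauchyIntegral,
    map_smul, sum_contourIntegral, sum_contourIntegral]
  congr 1
  have e1 : chainIntegral (γ k) (fun _ => 0) (fun _ => 1) f = chainIntegral (γ k) (fun _ => 0)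
      (fun _ => 1) fun z => L (res (perturb M.A₁ Y) z v - g z) :=
    hcyc.chainIntegral_congr fun z hz => hf z hz.1 (by rw [h.spec_eq]; exact hz.2)
  rw [e1, hcyc.chainIntegral_clm_comp (f := fun z => res (perturb M.A₁ Y) z v - g z)
    (hc1.sub hc2), hcyc.chainIntegral_sub hc1 hc2,
    h.chainIntegral_eq_zero hcyc' hg, sub_zero]

theorem tendsto_cauchyIntegral_boundedInverse {a b : ℕ → ℝ} {n : ℕ → ℕ}
    {γ : ∀ k, Fin (n k) → ℝ → ℂ}
    (ha : Tendsto a atTop atBot) (hb : Tendsto b atTop atTop)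
    (hab : ∀ k, ∀ z ∈ M.nbhd Γ, z.re ≠ a k ∧ z.re ≠ b k)
    (hγ : ∀ k, IsContourAround (M.nbhd Γ ∩ strip (a k) (b k))
      (spec (perturb M.A₁ X) ∩ strip (a k) (b k)) (γ k)) :
    (∀ u : H₁, Tendsto (fun k => cauchyIntegral (γ k) fun z => boundedInverse (M.M₁ z Γ) u) atTop
      (𝓝 (Ring.inverse (1 + M.overlap Γ X Y) u))) ∧
    ∀ u v : H₁, (u, v) ∈ (perturb M.A₁ Y).graph →
      Tendsto (fun k => cauchyIntegral (γ k) fun z => z • boundedInverse (M.M₁ z Γ) u) atTop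
        (𝓝 (Ring.inverse (1 + M.overlap Γ X Y) v)) := by
  have hG := fun u => (ContinuousLinearMap.apply ℂ H₁ u).differentiable.comp_differentiableOn
    h.differentiableOn_overlapCauchy_mul_inverse
  refine ⟨fun u => h.tendsto_cauchyIntegral ha hb hab hγ (fun z hz hz' => ?_) (hG u),
    -- For `v = (A₁ + Y) u` one has `z R'(z) u = R'(z) v - u`, so the first-moment integrand has the
    -- same form, with `u` joining the holomorphic part.
    fun u v huv => h.tendsto_cauchyIntegral ha hb hab hγ (g := fun z => u + z •
      (M.overlapCauchy Γ X Y z * Ring.inverse (M.rightFactor Γ X z)) u) (fun z hz hz' => ?_)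
      ((differentiableOn_id.smul (hG u)).const_add u)⟩
  · rw [h.boundedInverse_M₁ (h.nbhd_subset hz) hz']
    rfl
  · rw [h.boundedInverse_M₁ (h.nbhd_subset hz) hz']
    change z • Ring.inverse (1 + M.overlap Γ X Y) (res (perturb M.A₁ Y) z u - _) = _
    rw [← map_smul]
    refine congrArg _ ?_
    have h1 := res_apply_sub (by rwa [← h.spec_eq]) huv
    rw [map_sub, map_smul, sub_eq_iff_eq_add] at h1
    rw [smul_sub, h1, add_sub_add_left_eq_sub]
    rfl

end IsSolutionPair

end Model

/-! ### Everywhere defined selfadjoint operators -/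

section Everywhere

variable {H : Type*} [NormedAddCommGroup H] [InnerProductSpace ℂ H] [CompleteSpace H]
variable {A : H →ₗ.[ℂ] H}

/-- An everywhere defined selfadjoint operator is bounded. -/
theorem exists_mem_graph_iff_of_domain_eq_top (hA : IsSelfAdjoint A) (h : A.domain = ⊤) :
    ∃ B : H →L[ℂ] H, ∀ x y, (x, y) ∈ A.graph ↔ y = B x := by
  have hmem : ∀ x : H, x ∈ A.domain := fun x => h ▸ Submodule.mem_top
  let B : H →ₗ[ℂ] H := A.toFun ∘ₗ (LinearMap.id.codRestrict A.domain hmem)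
  have hB : B.IsSymmetric := fun x y => by
    have h1 := LinearPMap.adjoint_isFormalAdjoint hA.dense_domain
    rw [LinearPMap.isSelfAdjoint_def.1 hA] at h1
    exact h1 ⟨x, hmem x⟩ ⟨y, hmem y⟩
  refine ⟨⟨B, hB.continuous⟩, fun x y => ?_⟩
  rw [LinearPMap.mem_graph_iff]
  constructor
  · rintro ⟨z, hz, rfl⟩
    change z.1 = x at hz
    subst hz
    rfl
  · rintro rfl
    exact ⟨⟨x, hmem x⟩, rfl, rfl⟩

/-- Subtracting the bounded extension `B` leaves the zero operator with resolvent `-z⁻¹`; adding `B`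
back is a small perturbation when `‖z‖ > ‖B‖`. -/
theorem exists_norm_le_of_mem_spec (hA : IsSelfAdjoint A) (h : A.domain = ⊤) :
    ∃ K, ∀ z ∈ spec A, ‖z‖ ≤ K := by
  obtain ⟨B, hB⟩ := exists_mem_graph_iff_of_domain_eq_top hA h
  refine ⟨‖B‖, fun z hz => ?_⟩
  by_contra! hlt
  have hz0 : z ≠ 0 := norm_pos_iff.1 ((norm_nonneg B).trans_lt hlt)
  have h1 : IsBoundedInverse (shift (perturb A (-B)) z) (-z⁻¹ • (1 : H →L[ℂ] H)) := by
    rw [isBoundedInverse_iff]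
    have h2 : ∀ x y, (x, y) ∈ (shift (perturb A (-B)) z).graph ↔ y = -(z • x) := fun x y => by
      rw [mem_graph_shift, mem_graph_perturb, hB, neg_apply, sub_neg_eq_add, add_eq_right,
        add_eq_zero_iff_eq_neg]
    refine ⟨fun x => ?_, fun x y hxy => ?_⟩
    · rw [h2, smul_apply, one_apply_eq_self, neg_smul, smul_neg, neg_neg, smul_inv_smul₀ hz0]
    · rw [(h2 x y).1 hxy, smul_apply, one_apply_eq_self, neg_smul, smul_neg, neg_neg,
        inv_smul_smul₀ hz0]
  have h3 : ‖res (perturb A (-B)) z‖ ≤ ‖z‖⁻¹ := by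
    rw [h1.res_eq, norm_smul, norm_neg, norm_inv]
    exact mul_le_of_le_one_right (by positivity) ContinuousLinearMap.norm_id_le
  have h4 := (notMem_spec_perturb h1.notMem_spec h3 hlt).1
  rw [perturb_perturb, neg_add_cancel, perturb_zero] at h4
  exact h4 hz

end Everywhere

/-! ### The bounded case, integrability and the transported graph -/

namespace Model

variable {H₀ H₁ : Type*} [NormedAddCommGroup H₀] [InnerProductSpace ℂ H₀] [CompleteSpace H₀]
  [NormedAddCommGroup H₁] [InnerProductSpace ℂ H₁] [CompleteSpace H₁]
variable {M : Model H₀ H₁} {l : ℤˣ} {Γ : ℝ → ℂ} {X Y : H₁ →L[ℂ] H₁}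

theorem IsSmall.exists_abs_re_lt (hs : M.IsSmall Γ) (h : M.A₁.domain = ⊤) :
    ∃ K, ∀ z ∈ M.nbhd Γ, |z.re| < K := by
  obtain ⟨K, hK⟩ := exists_norm_le_of_mem_spec M.isSelfAdjoint₁ h
  refine ⟨K + M.d₀ Γ, fun z hz => ?_⟩
  have hz' : Metric.infDist z (spec M.A₁) < M.d₀ Γ :=
    lt_of_le_of_lt hz (half_lt_self hs.d₀_pos)
  obtain ⟨s, hs, hlt⟩ := (Metric.infDist_lt_iff hs.spec_nonempty).1 hz'
  have h1 := Complex.abs_re_le_norm z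
  have h2 := norm_le_norm_add_norm_sub' z s
  rw [dist_eq_norm] at hlt
  linarith [hK s hs]

namespace IsSolutionPair

variable (h : M.IsSolutionPair l Γ X Y)
include h

/-- For bounded `A₁` the set `𝒪` lies in a vertical strip, so the given contour is admissible for
every member of a sequence of widening strips. The limit theorem is applied to this constant
sequence. -/
theorem cauchyIntegral_boundedInverse (htop : M.A₁.domain = ⊤) {n : ℕ} {γ : Fin n → ℝ → ℂ}
    (hγ : IsContourAround (M.nbhd Γ) (spec (perturb M.A₁ X)) γ) :
    (∀ u : H₁, cauchyIntegral γ (fun z => boundedInverse (M.M₁ z Γ) u) =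
      Ring.inverse (1 + M.overlap Γ X Y) u) ∧
    ∀ u v : H₁, (u, v) ∈ (perturb M.A₁ Y).graph →
      cauchyIntegral γ (fun z => z • boundedInverse (M.M₁ z Γ) u) =
        Ring.inverse (1 + M.overlap Γ X Y) v := by
  obtain ⟨K, hK⟩ := h.isSmall.exists_abs_re_lt htop
  have hk : ∀ k : ℕ, ∀ z ∈ M.nbhd Γ, -(K + k) < z.re ∧ z.re < K + k := fun k z hz => by
    obtain ⟨h1, h2⟩ := abs_lt.1 (hK z hz)
    have h3 : (0 : ℝ) ≤ k := k.cast_nonneg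
    constructor <;> linarith
  have hb : Tendsto (fun k : ℕ => K + (k : ℝ)) atTop atTop :=
    tendsto_atTop_add_const_left _ _ tendsto_natCast_atTop_atTop
  have hO : ∀ k : ℕ, M.nbhd Γ ∩ strip (-(K + k)) (K + k) = M.nbhd Γ := fun k =>
    inter_eq_left.2 fun z hz => hk k z hz
  have hS : ∀ k : ℕ, spec (perturb M.A₁ X) ∩ strip (-(K + k)) (K + k) = spec (perturb M.A₁ X) :=
    fun k => inter_eq_left.2 fun z hz => hk k z (h.spec_subset_nbhd (by rwa [← h.spec_eq]))
  obtain ⟨h1, h2⟩ := h.tendsto_cauchyIntegral_boundedInverse (n := fun _ => n) (γ := fun _ => γ)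
    (tendsto_neg_atTop_atBot.comp hb) hb
    (fun k z hz => ⟨(hk k z hz).1.ne', (hk k z hz).2.ne⟩) fun k => by
      change IsContourAround (M.nbhd Γ ∩ strip (-(K + k)) (K + k))
        (spec (perturb M.A₁ X) ∩ strip (-(K + k)) (K + k)) γ
      rw [hO, hS]
      exact hγ
  exact ⟨fun u => tendsto_nhds_unique tendsto_const_nhds (h1 u),
    fun u v huv => tendsto_nhds_unique tendsto_const_nhds (h2 u v huv)⟩

theorem intervalIntegrable_boundedInverse {γ : ℝ → ℂ} (hγ : IsClosedCurve γ)
    (hm : ∀ t ∈ Icc (0 : ℝ) 1, γ t ∈ M.nbhd Γ \ spec (perturb M.A₁ X)) (u : H₁) :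
    IntervalIntegrable (fun t => deriv γ t • boundedInverse (M.M₁ (γ t) Γ) u) volume 0 1 := by
  obtain ⟨C, hC⟩ := hγ.1
  rw [← uIcc_of_le zero_le_one] at hC hm
  refine intervalIntegrable_deriv_smul hC ?_
  have hc : ContinuousOn (fun z => boundedInverse (M.M₁ z Γ))
      (M.nbhd Γ \ spec (perturb M.A₁ X)) := by
    refine ContinuousOn.congr (f := fun z => Ring.inverse (1 + M.overlap Γ X Y) *
      (res (perturb M.A₁ Y) z -
        M.overlapCauchy Γ X Y z * Ring.inverse (M.rightFactor Γ X z))) ?_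
      fun z hz => h.boundedInverse_M₁ (h.nbhd_subset hz.1) hz.2
    refine continuousOn_const.mul (ContinuousOn.sub (continuousOn_res fun z hz => ?_) ?_)
    · rw [← h.spec_eq]
      exact hz.2
    · exact h.differentiableOn_overlapCauchy_mul_inverse.continuousOn.mono
        fun z hz => h.nbhd_subset hz.1
  exact (ContinuousLinearMap.apply ℂ H₁ u).continuous.comp_continuousOn
    (hc.comp hC.continuousOn hm)

/-- Expressing the product through the existence of `v` in the graph makes the equivalence contain
the equality of the domains. -/
theorem mem_graph_inverse_iff (u w : H₁) :
    (∃ v : H₁, (u, v) ∈ (perturb M.A₁ Y).graph ∧ Ring.inverse (1 + M.overlap Γ X Y) v = w) ↔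
      (Ring.inverse (1 + M.overlap Γ X Y) u, w) ∈ (perturb M.A₁ X).graph := by
  rw [h.mem_graph_iff, isUnit_apply_inverse h.isUnit_one_add_overlap]
  constructor
  · rintro ⟨v, hv, rfl⟩
    rwa [isUnit_apply_inverse h.isUnit_one_add_overlap]
  · intro hw
    exact ⟨_, hw, isUnit_inverse_apply h.isUnit_one_add_overlap w⟩

end IsSolutionPair

theorem omegaIntegrand_eq (X X' : H₁ →L[ℂ] H₁) : M.omegaIntegrand X' X = fun μ =>
    res (perturb M.A₁ (star X')) μ * M.K' μ * res (perturb M.A₁ X) μ := by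
  funext μ
  rw [omegaIntegrand, adjoint_perturb M.isSelfAdjoint₁]
  rfl

theorem omega_eq (X X' : H₁ →L[ℂ] H₁) : M.omega X' X Γ = M.overlap Γ X (star X') := by
  rw [omega, omegaIntegrand_eq, overlap]

end Model

end TwoChannel

end

/-! ### The theorem, assembled from the solution pair `X (l)`, `star (X (-l))` -/

open TwoChannel in
theorem mainTheorem5 {H₀ H₁ : Type*}
    [NormedAddCommGroup H₀] [InnerProductSpace ℂ H₀] [CompleteSpace H₀]
    [NormedAddCommGroup H₁] [InnerProductSpace ℂ H₁] [CompleteSpace H₁]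
    (M : Model H₀ H₁) (Γ : ℤˣ → ℝ → ℂ) (X : ℤˣ → H₁ →L[ℂ] H₁)
    (hΓ : ∀ l, M.IsContour l (Γ l))
    (hsmall : ∀ l, M.IsSmall (Γ l))
    (hends : M.SameEnds 1 (Γ 1) (fun x => conj (Γ (-1) x)))
    (hX : ∀ l, M.IsSolution (Γ l) (X l))
    (l : ℤˣ) :
    let H : ℤˣ → H₁ →ₗ.[ℂ] H₁ := fun k => perturb M.A₁ (X k)
    let Ω : ℤˣ → H₁ →L[ℂ] H₁ := fun k => M.omega (X (-k)) (X k) (Γ k)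
    let R : H₁ →L[ℂ] H₁ := Ring.inverse (1 + Ω l)
    let Minv : ℂ → H₁ →L[ℂ] H₁ := fun z => boundedInverse (M.M₁ z (Γ l))
    let O : Set ℂ := M.nbhd (Γ l)
    -- the integral defining `Ω^{(l)}` converges in norm, and `‖Ω^{(l)}‖ < 1`
    IntegrableOn (fun x => deriv (Γ l) x • M.omegaIntegrand (X (-l)) (X l) (Γ l x)) M.J ∧
    ‖Ω l‖ < 1 ∧
    -- `Ω^{(-l)} = Ω^{(l)*}`
    Ω (-l) = ContinuousLinearMap.adjoint (Ω l) ∧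
    -- `(I + Ω^{(l)})⁻¹ H^{(-l)*} = H^{(l)} (I + Ω^{(l)})⁻¹`, including equality of the domains
    (∀ u w : H₁, (∃ v : H₁, (u, v) ∈ (H (-l)).adjoint.graph ∧ R v = w) ↔
      (R u, w) ∈ (H l).graph) ∧
    -- the integrands below are well defined and integrable
    (∀ z ∈ O \ spec (H l), IsBoundedlyInvertible (M.M₁ z (Γ l))) ∧
    (∀ γ : ℝ → ℂ, IsClosedCurve γ → (∀ t ∈ Icc (0 : ℝ) 1, γ t ∈ O \ spec (H l)) → ∀ u : H₁,
      IntervalIntegrable (fun t => deriv γ t • Minv (γ t) u) volume 0 1) ∧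
    -- the contour integrals if `A₁` is bounded
    (M.A₁.domain = ⊤ →
      ∀ (n : ℕ) (γ : Fin n → ℝ → ℂ), IsContourAround O (spec (H l)) γ →
        (∀ u : H₁, cauchyIntegral γ (fun z => Minv z u) = R u) ∧
        (∀ u : (H (-l)).adjoint.domain,
          cauchyIntegral γ (fun z => z • Minv z (u : H₁)) = R ((H (-l)).adjoint u))) ∧
    -- in general, infinite contours composed of closed curves, with strong convergence
    (∀ (a b : ℕ → ℝ) (n : ℕ → ℕ) (γ : ∀ k, Fin (n k) → ℝ → ℂ),
      Tendsto a atTop atBot → Tendsto b atTop atTop →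
      (∀ k, ∀ z ∈ O, z.re ≠ a k ∧ z.re ≠ b k) →
      (∀ k, IsContourAround (O ∩ strip (a k) (b k)) (spec (H l) ∩ strip (a k) (b k)) (γ k)) →
        (∀ u : H₁, Tendsto (fun k => cauchyIntegral (γ k) (fun z => Minv z u)) atTop (𝓝 (R u))) ∧
        (∀ u : (H (-l)).adjoint.domain,
          Tendsto (fun k => cauchyIntegral (γ k) (fun z => z • Minv z (u : H₁))) atTop
            (𝓝 (R ((H (-l)).adjoint u))))) := by
  intro H Ω R Minv O
  have h := Model.isSolutionPair hΓ hsmall hends hX l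
  have hT : (H (-l)).adjoint = perturb M.A₁ (star (X (-l))) := adjoint_perturb M.isSelfAdjoint₁
  have hΩ : Ω l = M.overlap (Γ l) (X l) (star (X (-l))) := Model.omega_eq _ _
  have hgraph : ∀ u : (H (-l)).adjoint.domain,
      ((u : H₁), (H (-l)).adjoint u) ∈ (perturb M.A₁ (star (X (-l)))).graph := fun u =>
    (congrArg LinearPMap.graph hT).le ((H (-l)).adjoint.mem_graph u)
  have hR : R = Ring.inverse (1 + M.overlap (Γ l) (X l) (star (X (-l)))) :=
    congrArg (fun S => Ring.inverse (1 + S)) hΩ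
  refine ⟨?_, ?_, ?_, ?_, ?_, ?_, ?_, ?_⟩
  · rw [Model.omegaIntegrand_eq]
    exact h.isDominated_res_mul_res.integrableOn h.isPath
  · rw [hΩ]
    exact h.norm_overlap_lt_one
  · have h1 := Model.integral_neg_eq_star hΓ hsmall hends hX l
    rw [hΩ]
    refine Eq.trans ?_ h1
    change M.omega (X (- -l)) (X (-l)) (Γ (-l)) = _
    rw [neg_neg, Model.omega_eq, Model.overlap]
  · rw [hT, hR]
    exact h.mem_graph_inverse_iff
  · exact fun z hz => ⟨_, h.isBoundedInverse_M₁_of_mem (h.nbhd_subset hz.1) hz.2⟩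
  · exact fun γ hγ hm u => h.intervalIntegrable_boundedInverse hγ hm u
  · intro htop n γ hγ
    rw [hR]
    obtain ⟨h1, h2⟩ := h.cauchyIntegral_boundedInverse htop hγ
    exact ⟨h1, fun u => h2 _ _ (hgraph u)⟩
  · intro a b n γ ha hb hab hγ
    rw [hR]
    obtain ⟨h1, h2⟩ := h.tendsto_cauchyIntegral_boundedInverse ha hb hab hγ
    exact ⟨h1, fun u => h2 _ _ (hgraph u)⟩
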